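/- Let $\mathbb T=\mathbb R/2\pi\mathbb Z$, with Lebesgue measure $dx$ of total mass $2\pi$. Write $\langle n\rangle=(1+n^2)^{1/2}$, $v=\sum_{n\in\mathbb Z}\widehat v_n e^{inx}$ and $v^N=P_Nv=\sum_{|n|\le N}\widehat v_ne^{inx}$. For $s\in\mathbb R$ and $1\le r<\infty$ let $\mathcal FL^{s,r}(\mathbb T)$ be the space of all $v$ with $\|v\|_{\mathcal FL^{s,r}}=\|(\langle n\rangle^s\widehat v_n)_n\|_{\ell^r(\mathbb Z)}<\infty$. Let $\rho$ be the Wiener measure, i.e. the law of $v=\sum_n\widehat v_ne^{inx}$ where the real and imaginary parts of all the $\widehat v_n$, $n\in\mathbb Z$, are independent centred real Gaussians, those of $\widehat v_n$ having variance $(1+n^2)^{-1}$. For $N\ge 0$ let $$d\rho_N=Z_{0,N}^{-1}\exp\Big(-\tfrac12\sum_{|n|\le N}(1+n^2)|\widehat v_n|^2\Big)\prod_{|n|\le N}da_n\,db_n,\qquad \widehat v_n=a_n+ib_n,$$ a probability measure on $E_N=\mathrm{span}\{e^{inx}:|n|\le N\}$, also regarded as a measure on all $v$ carried by $E_N$.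 Let $$\mathcal N(v)=-\tfrac12\,\mathrm{Im}\!\int_{\mathbb T}v^2\overline v\,\overline v_x\,dx-\tfrac1{4\pi}\Big(\int_{\mathbb T}|v|^2dx\Big)\Big(\int_{\mathbb T}|v|^4dx\Big)+\tfrac1\pi\Big(\int_{\mathbb T}|v|^2dx\Big)\Big(\mathrm{Im}\!\int_{\mathbb T}v\,\overline v_x\,dx\Big)+\tfrac1{4\pi^2}\Big(\int_{\mathbb T}|v|^2dx\Big)^3 .$$ For trigonometric polynomials $v$ this is meant literally. For $\rho$-almost every $v$ the two integrals containing $\overline v_x$ are understood as the limits in $L^2(d\rho)$, as $N\to\infty$, of the same integrals with $v$ replaced by $v^N$; these limits exist. For $B>0$ put $$R(v)=\chi_{\{\|v\|_{L^2}\le B\}}e^{-\frac12\mathcal N(v)},\quad R_N(v)=\chi_{\{\|v^N\|_{L^2}\le B\}}e^{-\frac12\mathcal N(v^N)},\quad d\mu=Z^{-1}R\,d\rho,\quad d\mu_N=Z_N^{-1}R_N\,d\rho_N,$$ where $Z=\int R\,d\rho$ and $Z_N=\int R_N\,d\rho_N$. There is $B_0>0$ such that for every $0<B\le B_0$ the following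 hold. (a) $R\in L^2(d\rho)$, and $\mu$ is a probability measure that is absolutely continuous with respect to $\rho$. Moreover, for all $s\in\mathbb R$ and $2\le r<\infty$ with $(s-1)r<-1$, the measures $\mu$ and $\mu_N$ ($N\ge 0$) are Borel probability measures on $\mathcal FL^{s,r}(\mathbb T)$, and: (b) there are $c>0$ and $K_0>0$ such that $\mu(\|v\|_{\mathcal FL^{s,r}}>K)\le e^{-cK^2}$ for all $K\ge K_0$; (c) $\mu_N$ converges weakly to $\mu$ on $\mathcal FL^{s,r}(\mathbb T)$ as $N\to\infty$. -/

import Mathlib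

open MeasureTheory ProbabilityTheory Filter Topology
open scoped ENNReal NNReal BoundedContinuousFunction

noncomputable section

namespace WeightedWiener

/-- Periodic functions and distributions `v` on `𝕋 = ℝ / 2πℤ` are represented by the family of their
Fourier coefficients `v̂ n`, with the convention `v = ∑ₙ v̂ n e^{inx}`. -/
abbrev Coeff : Type := ℤ → ℂ

/-- The bracket `⟨n⟩ = (1 + n²)^{1/2}`. -/
def bracket (n : ℤ) : ℝ := Real.sqrt (1 + (n : ℝ) ^ 2)

theorem bracket_pos (n : ℤ) : 0 < bracket n := Real.sqrt_pos.mpr (by positivity)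

/-! ### Fourier–Lebesgue spaces -/

/-- Multiplication of the `n`-th coefficient by `⟨n⟩^s`. -/
def weight (s : ℝ) : Coeff →ₗ[ℂ] (∀ _ : ℤ, ℂ) where
  toFun a n := ((bracket n ^ s : ℝ) : ℂ) * a n
  map_add' a b := by funext n; simp [mul_add]
  map_smul' c a := by funext n; simp [mul_left_comm]

/-- The Fourier–Lebesgue space `FL^{s,r}(𝕋)`: all `v` with `(⟨n⟩^s v̂ n)ₙ ∈ ℓ^r(ℤ)`. -/
def FL (s : ℝ) (r : ℝ≥0∞) : Type := {a : Coeff // Memℓp (weight s a) r}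

namespace FL

variable {s : ℝ} {r : ℝ≥0∞}

/-- The Fourier coefficients of an element of `FL^{s,r}`. -/
def coeff (v : FL s r) : Coeff := v.1

instance : AddCommGroup (FL s r) :=
  inferInstanceAs (AddCommGroup
    ({ carrier := {a : Coeff | Memℓp (weight s a) r}
       zero_mem' := by simpa using (zero_memℓp (E := fun _ : ℤ => ℂ) (p := r))
       add_mem' := fun {a b} ha hb => by
         have ha' : Memℓp (weight s a) r := ha
         have hb' : Memℓp (weight s b) r := hb
         simpa using ha'.add hb'
       neg_mem' := fun {a} ha => by
         have ha' : Memℓp (weight s a) r := ha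
         simpa using ha'.neg } : AddSubgroup Coeff))

/-- The map `v ↦ (⟨n⟩^s v̂ n)ₙ` into `ℓ^r(ℤ)`. -/
def toLp (s : ℝ) (r : ℝ≥0∞) : FL s r →+ lp (fun _ : ℤ => ℂ) r where
  toFun v := ⟨weight s v.coeff, v.2⟩
  map_zero' := Subtype.ext (map_zero (weight s))
  map_add' v w := Subtype.ext (map_add (weight s) v.coeff w.coeff)

theorem toLp_injective : Function.Injective (toLp s r) := by
  intro v w h
  refine Subtype.ext (funext fun n => ?_)
  have h1 : weight s v.coeff n = weight s w.coeff n := congrFun (congrArg Subtype.val h) n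
  have h2 : ((bracket n ^ s : ℝ) : ℂ) ≠ 0 :=
    Complex.ofReal_ne_zero.mpr (Real.rpow_pos_of_pos (bracket_pos n) s).ne'
  exact mul_left_cancel₀ h2 h1

/-- The norm `‖v‖_{FL^{s,r}} = ‖(⟨n⟩^s v̂ n)ₙ‖_{ℓ^r}`. -/
instance [Fact (1 ≤ r)] : NormedAddCommGroup (FL s r) :=
  NormedAddCommGroup.induced (FL s r) (lp (fun _ : ℤ => ℂ) r) (toLp s r) toLp_injective

instance [Fact (1 ≤ r)] : MeasurableSpace (FL s r) := borel (FL s r)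

instance [Fact (1 ≤ r)] : BorelSpace (FL s r) := ⟨rfl⟩

end FL

/-- A measure on the space of Fourier coefficients, regarded as a (Borel) measure on `FL^{s,r}`:
a Borel set `A` of `FL^{s,r}` gets the mass that `m` gives to `A` as a set of coefficients. -/
def onFL (s : ℝ) (r : ℝ≥0∞) [Fact (1 ≤ r)] (m : Measure Coeff) : Measure (FL s r) :=
  Measure.comap (FL.coeff (s := s) (r := r)) m

/-! ### Gaussian measures -/

/-- The law on `ℂ` of `a + i b` with `a`, `b` independent centred real Gaussian variables of
variance `(1 + n²)⁻¹`, i.e. the probability density proportional to `exp (-(1 + n²)|z|²/2)`. -/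
def modeLaw (n : ℤ) : Measure ℂ :=
  ((gaussianReal 0 (1 + (n.natAbs : ℝ≥0) ^ 2)⁻¹).prod
    (gaussianReal 0 (1 + (n.natAbs : ℝ≥0) ^ 2)⁻¹)).map Complex.measurableEquivRealProd.symm

instance (n : ℤ) : IsProbabilityMeasure (modeLaw n) :=
  Measure.isProbabilityMeasure_map Complex.measurableEquivRealProd.symm.measurable.aemeasurable

/-- The Wiener measure `ρ`: the Fourier coefficients `v̂ n` are independent, with law `modeLaw n`. -/
def wiener : Measure Coeff := Measure.infinitePi modeLaw

/-- `Z⁻¹ m`, where `Z` is the total mass of `m`. -/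
def normalize {α : Type*} [MeasurableSpace α] (m : Measure α) : Measure α := (m Set.univ)⁻¹ • m

/-- A measure of total mass one as a point of the space of probability measures, which carries the
topology of weak convergence. -/
def asProb {α : Type*} [MeasurableSpace α] (m : Measure α) (h : IsProbabilityMeasure m) :
    ProbabilityMeasure α := ⟨m, h⟩

/-- The frequencies `|n| ≤ N`. -/
def modes (N : ℕ) : Finset ℤ := Finset.Icc (-(N : ℤ)) N

/-- The inclusion of `E_N = span {e^{inx} : |n| ≤ N}` (as `ℂ^{2N+1}`) into all coefficients. -/
def embed (N : ℕ) (w : modes N → ℂ) : Coeff :=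
  fun n => if h : n ∈ modes N then w ⟨n, h⟩ else 0

/-- `dρ_N = Z_{0,N}⁻¹ exp (-½ ∑_{|n| ≤ N} (1 + n²)|v̂ n|²) ∏_{|n| ≤ N} da_n db_n` on `E_N`,
extended to all coefficients (it is carried by `E_N`). -/
def wienerN (N : ℕ) : Measure Coeff :=
  (normalize ((volume : Measure (modes N → ℂ)).withDensity fun w =>
    ENNReal.ofReal (Real.exp
      (-(1 / 2) * ∑ n : modes N, (1 + ((n : ℤ) : ℝ) ^ 2) * ‖w n‖ ^ 2)))).map (embed N)

/-! ### The nonlinear part of the energy -/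

/-- `∫_𝕋 |f|² dx`. -/
def mass (f : ℝ → ℂ) : ℝ := ∫ x in (0)..(2 * Real.pi), ‖f x‖ ^ 2

/-- `∫_𝕋 |f|⁴ dx`. -/
def quartic (f : ℝ → ℂ) : ℝ := ∫ x in (0)..(2 * Real.pi), ‖f x‖ ^ 4

/-- `Im ∫_𝕋 f f̄_x dx` for smooth `f`. -/
def momentum (f : ℝ → ℂ) : ℝ :=
  (∫ x in (0)..(2 * Real.pi), f x * (starRingEnd ℂ) (deriv f x)).im

/-- `Im ∫_𝕋 f² f̄ f̄_x dx` for smooth `f`. -/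
def cubic (f : ℝ → ℂ) : ℝ :=
  (∫ x in (0)..(2 * Real.pi), f x ^ 2 * (starRingEnd ℂ) (f x) * (starRingEnd ℂ) (deriv f x)).im

/-- `L²` norm on `𝕋`. -/
def l2norm (f : ℝ → ℂ) : ℝ := Real.sqrt (mass f)

/-- `𝒩` in terms of `m = ∫|v|²`, `q = ∫|v|⁴`, `p = Im ∫ v v̄_x` and `c = Im ∫ v² v̄ v̄_x`. -/
def energyExpr (m q p c : ℝ) : ℝ :=
  -(1 / 2) * c - 1 / (4 * Real.pi) * (m * q) + 1 / Real.pi * (m * p)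
    + 1 / (4 * Real.pi ^ 2) * m ^ 3

/-- The trigonometric polynomial `v^N = P_N v = ∑_{|n| ≤ N} v̂ n e^{inx}`. -/
def trunc (N : ℕ) (a : Coeff) : ℝ → ℂ :=
  fun x => ∑ n ∈ modes N, a n * Complex.exp (Complex.I * n * x)

/-- `𝒩_N(v) = 𝒩(v^N)`. -/
def energyN (N : ℕ) (a : Coeff) : ℝ :=
  energyExpr (mass (trunc N a)) (quartic (trunc N a)) (momentum (trunc N a)) (cubic (trunc N a))

instance factTwoPiPos : Fact (0 < 2 * Real.pi) := ⟨Real.two_pi_pos⟩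

open Classical in
/-- The `L²(𝕋)` function with Fourier coefficients `a`, as a `2π`-periodic function on `ℝ`
(and `0` if `a` is not square summable). -/
def realize (a : Coeff) : ℝ → ℂ :=
  if h : Memℓp a 2 then
    fun x => ((fourierBasis (T := 2 * Real.pi)).repr.symm
      (⟨a, h⟩ : lp (fun _ : ℤ => ℂ) 2) : AddCircle (2 * Real.pi) → ℂ) (x : AddCircle (2 * Real.pi))
  else 0

/-- `Q N → f` in `L²(dρ)`. -/
def TendstoL2 (Q : ℕ → Coeff → ℝ) (f : Coeff → ℝ) : Prop :=
  Tendsto (fun N => eLpNorm (Q N - f) 2 wiener) atTop (𝓝 0)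

open Classical in
/-- The limit of a sequence in `L²(dρ)` (a measurable representative of it; `0` if there is none). -/
def limL2 (Q : ℕ → Coeff → ℝ) : Coeff → ℝ :=
  if h : ∃ f : Coeff → ℝ, Measurable f ∧ TendstoL2 Q f then h.choose else 0

/-- `Im ∫_𝕋 v v̄_x dx` for `ρ`-almost every `v`: a function in the support of `ρ` is too rough for
the integral to exist, so that it is the `L²(dρ)`-limit of `Im ∫_𝕋 v^N v̄^N_x dx`. -/
def momentumLim : Coeff → ℝ := limL2 fun N a => momentum (trunc N a)

/-- `Im ∫_𝕋 v² v̄ v̄_x dx` for `ρ`-almost every `v`: the `L²(dρ)`-limit of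
`Im ∫_𝕋 (v^N)² v̄^N v̄^N_x dx`. -/
def cubicLim : Coeff → ℝ := limL2 fun N a => cubic (trunc N a)

/-- `𝒩(v)`, for `ρ`-almost every `v`. -/
def energy (a : Coeff) : ℝ :=
  energyExpr (mass (realize a)) (quartic (realize a)) (momentumLim a) (cubicLim a)

/-! ### Weighted Wiener measures -/

open Classical in
/-- `R(v) = χ_{‖v‖_{L²} ≤ B} e^{-𝒩(v)/2}`. -/
def R (B : ℝ) (a : Coeff) : ℝ :=
  if Memℓp a 2 ∧ l2norm (realize a) ≤ B then Real.exp (-(1 / 2) * energy a) else 0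

open Classical in
/-- `R_N(v) = R(v^N) = χ_{‖v^N‖_{L²} ≤ B} e^{-𝒩(v^N)/2}`. -/
def RN (B : ℝ) (N : ℕ) (a : Coeff) : ℝ :=
  if l2norm (trunc N a) ≤ B then Real.exp (-(1 / 2) * energyN N a) else 0

/-- `dμ = Z⁻¹ R dρ`. -/
def mu (B : ℝ) : Measure Coeff := normalize (wiener.withDensity fun a => ENNReal.ofReal (R B a))

/-- `dμ_N = Z_N⁻¹ R_N dρ_N`. -/
def muN (B : ℝ) (N : ℕ) : Measure Coeff :=
  normalize ((wienerN N).withDensity fun a => ENNReal.ofReal (RN B N a))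

end WeightedWiener

end

open WeightedWiener

noncomputable section

namespace WeightedWiener

/-! ### The infimum-convolution property of Gaussian measures -/

/-! Everything rests on one estimate: `∫ R_N² dρ` is bounded uniformly in `N`
(`exists_lintegral_RN_sq_le`). On the mass ball `R_N² = exp(-𝒩(v^N))`, so this is exponential
integrability of a quartic form with a derivative, a growth that only the smallness of the mass can
tame.

The tool is the infimum-convolution inequality: if `f(x) g(y) ≤ exp(‖x - y‖²/4)` for all `x`, `y`,
with the Cameron–Martin (`H¹`) norm, then `∫ f dρ · ∫ g dρ ≤ 1`. It follows from the
Prékopa–Leindler inequality on the line and tensorizes (`lintegral_mul_lintegral_wiener_le`). It is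
applied with `f = R_N²` and `g = e^{-C}` on a set of good points `y`, which leaves two tasks.

Deterministic task (`exists_neg_energyN_le`): for good `y`, `-𝒩(y + h) ≤ ‖h‖²/4 + C` as long as `y +
h` has small mass. The form is expanded in `h`. Carlson's inequality bounds `‖h‖²_{ℓ¹}` by
`‖h‖_{L²}‖h‖_{H¹}`, so the top order is a small multiple of `‖h‖²_{H¹}` when the mass is small, and
lower orders are absorbed by Young's inequality. Where the derivative has to fall on the rough `y`,
an `H⁻¹` norm of an expression in `y` is used.

Probabilistic task (`exists_le_wiener_isGood`): good points have probability bounded below,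
uniformly in `N`. This combines a small ball estimate for the mass with second moments. Unpaired
terms are almost orthogonal because the law of each mode is invariant under rotations; paired terms
reduce to the momentum, which cancels under `n ↔ -n`.

The same second moments give the `L²(ρ)` limits of the singular integrals. Hence `R_N → R` in
measure, and the uniform bound yields `R ∈ L²` by Fatou and convergence in `L¹` by uniform
integrability. This gives (a) and (c). For (b), the Cauchy–Schwarz inequality reduces the claim to a
Gaussian tail of the Fourier–Lebesgue norm under `ρ`; this norm is dominated by the Cameron–Martin
norm, and the infimum-convolution inequality applies once more. -/

theorem volume_add_le_of_isCompact {K L C : Set ℝ} (hK : IsCompact K) (hL : IsCompact L)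
    (hK0 : K.Nonempty) (hL0 : L.Nonempty) (h : ∀ x ∈ K, ∀ y ∈ L, x + y ∈ C) :
    volume K + volume L ≤ volume C := by
  obtain ⟨k, hk, hk'⟩ := hK.exists_isGreatest hK0
  obtain ⟨l, hl, hl'⟩ := hL.exists_isLeast hL0
  have h1 : volume ((fun x => x + l) '' K) = volume K := by
    rw [Set.image_add_right, measure_preimage_add_right]
  have h2 : volume ((fun y => k + y) '' L) = volume L := by
    rw [Set.image_add_left, measure_preimage_add]
  have hm : MeasurableSet ((fun y => k + y) '' L) :=
    (hL.image (by fun_prop)).isClosed.measurableSet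
  -- With `k` the largest point of `K` and `l` the least of `L`, one translate lies to the left of
  -- `k + l` and the other to the right.
  have hd : AEDisjoint volume ((fun x => x + l) '' K) ((fun y => k + y) '' L) := by
    refine measure_mono_null (t := {k + l}) ?_ (by simp)
    rintro z ⟨⟨x, hx, rfl⟩, ⟨y, hy, hxy⟩⟩
    have := hk' hx
    have := hl' hy
    simp only at hxy
    simp only [Set.mem_singleton_iff]
    linarith
  rw [← h1, ← h2, ← measure_union₀ hm.nullMeasurableSet hd]
  refine measure_mono (Set.union_subset ?_ ?_)
  · rintro _ ⟨x, hx, rfl⟩; exact h x hx l hl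
  · rintro _ ⟨y, hy, rfl⟩; exact h k hk y hy

/-- The one-dimensional Brunn–Minkowski inequality. -/
theorem volume_add_le {A B C : Set ℝ} (hA : MeasurableSet A) (hB : MeasurableSet B)
    (hA0 : A.Nonempty) (hB0 : B.Nonempty) (h : ∀ x ∈ A, ∀ y ∈ B, x + y ∈ C) :
    volume A + volume B ≤ volume C := by
  obtain ⟨a, ha⟩ := hA0
  obtain ⟨b, hb⟩ := hB0
  have key : ∀ K, K ⊆ A ∧ IsCompact K → ∀ L, L ⊆ B ∧ IsCompact L →
      volume K + volume L ≤ volume C := by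
    rintro K ⟨hKA, hK⟩ L ⟨hLB, hL⟩
    -- The points `a` and `b` are adjoined to keep the inner compact sets nonempty.
    refine le_trans (add_le_add (measure_mono (Set.subset_insert a K))
      (measure_mono (Set.subset_insert b L))) ?_
    refine volume_add_le_of_isCompact (hK.insert a) (hL.insert b) (Set.insert_nonempty _ _)
      (Set.insert_nonempty _ _) fun x hx y hy => h x ?_ y ?_
    · exact Set.insert_subset ha hKA hx
    · exact Set.insert_subset hb hLB hy
  have := ENNReal.biSup_add_biSup_le' (p := fun K => K ⊆ A ∧ IsCompact K)
    (q := fun L => L ⊆ B ∧ IsCompact L) ⟨∅, by simp⟩ ⟨∅, by simp⟩ key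
  rw [hA.measure_eq_iSup_isCompact, hB.measure_eq_iSup_isCompact]
  simpa only [iSup_and] using this

/-- Layer-cake formula: for `t < 1` the superlevel sets of `f` and `g` are nonempty and half their
sum lies in that of `h`, so one-dimensional Brunn–Minkowski applies level by level. For `t ≥ 1` the
sets on the left are empty, which is why both suprema are normalized to `1`. -/
theorem lintegral_add_le_of_mul_le_sq_of_sup {f g h : ℝ → ℝ} (hf : Measurable f)
    (hg : Measurable g) (hh : Measurable h) (f0 : ∀ x, 0 ≤ f x) (g0 : ∀ x, 0 ≤ g x)
    (h0 : ∀ x, 0 ≤ h x) (f1 : ∀ x, f x ≤ 1) (g1 : ∀ x, g x ≤ 1)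
    (fs : ∀ t < 1, ∃ x, t < f x) (gs : ∀ t < 1, ∃ x, t < g x)
    (hfg : ∀ x y, f x * g y ≤ h ((x + y) / 2) ^ 2) :
    (∫⁻ x, ENNReal.ofReal (f x)) + ∫⁻ x, ENNReal.ofReal (g x) ≤
      2 * ∫⁻ x, ENNReal.ofReal (h x) := by
  rw [lintegral_eq_lintegral_meas_lt _ (ae_of_all _ f0) hf.aemeasurable,
    lintegral_eq_lintegral_meas_lt _ (ae_of_all _ g0) hg.aemeasurable,
    lintegral_eq_lintegral_meas_lt _ (ae_of_all _ h0) hh.aemeasurable,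
    ← lintegral_const_mul' _ _ (by simp), ← lintegral_add_left']
  swap
  · refine (Antitone.measurable fun s t hst => measure_mono fun x hx => ?_).aemeasurable
    exact lt_of_le_of_lt hst hx
  refine setLIntegral_mono' measurableSet_Ioi fun t ht => ?_
  rcases lt_or_ge t 1 with h1 | h1
  · have := volume_add_le (A := {a | t < f a}) (B := {a | t < g a})
      (C := (fun x => (1 / 2 : ℝ) * x) ⁻¹' {a | t < h a})
      (measurableSet_lt measurable_const hf) (measurableSet_lt measurable_const hg)
      (fs t h1) (gs t h1) ?_
    · refine this.trans ?_
      rw [Real.volume_preimage_mul_left (by norm_num)]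
      norm_num
    · intro x hx y hy
      simp only [Set.mem_ofPred_eq, Set.mem_preimage, Set.mem_Ioi] at *
      have := hfg x y
      rw [show 1 / 2 * (x + y) = (x + y) / 2 by ring]
      by_contra hc
      push Not at hc
      have := h0 ((x + y) / 2)
      nlinarith
  · have e1 : {a | t < f a} = ∅ := by
      ext a; simpa using (f1 a).trans h1
    have e2 : {a | t < g a} = ∅ := by
      ext a; simpa using (g1 a).trans h1
    simp [e1, e2]

/-- The one-dimensional Prékopa–Leindler inequality for bounded functions. -/
theorem lintegral_mul_lintegral_le_of_bounded {f g h : ℝ → ℝ} (hf : Measurable f)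
    (hg : Measurable g) (hh : Measurable h) (f0 : ∀ x, 0 ≤ f x) (g0 : ∀ x, 0 ≤ g x)
    (h0 : ∀ x, 0 ≤ h x) {M : ℝ} (f1 : ∀ x, f x ≤ M) (g1 : ∀ x, g x ≤ M)
    (hfg : ∀ x y, f x * g y ≤ h ((x + y) / 2) ^ 2) :
    (∫⁻ x, ENNReal.ofReal (f x)) * ∫⁻ x, ENNReal.ofReal (g x) ≤
      (∫⁻ x, ENNReal.ofReal (h x)) ^ 2 := by
  have bf : BddAbove (Set.range f) := ⟨M, by rintro _ ⟨x, rfl⟩; exact f1 x⟩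
  have bg : BddAbove (Set.range g) := ⟨M, by rintro _ ⟨x, rfl⟩; exact g1 x⟩
  set a := ⨆ x, f x with ha
  set b := ⨆ x, g x with hb
  have fa : ∀ x, f x ≤ a := le_ciSup bf
  have gb : ∀ x, g x ≤ b := le_ciSup bg
  rcases ((f0 0).trans (fa 0)).eq_or_lt with a0 | a0
  · have : ∀ x, f x = 0 := fun x => le_antisymm (a0 ▸ fa x) (f0 x)
    simp [this]
  rcases ((g0 0).trans (gb 0)).eq_or_lt with b0 | b0
  · have : ∀ x, g x = 0 := fun x => le_antisymm (b0 ▸ gb x) (g0 x)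
    simp [this]
  -- Dividing by the suprema `a`, `b`, and `h` by `√(a b)`, preserves the hypothesis and makes both
  -- suprema equal to `1`.
  have key := lintegral_add_le_of_mul_le_sq_of_sup (f := fun x => a⁻¹ * f x)
    (g := fun x => b⁻¹ * g x) (h := fun x => (√(a * b))⁻¹ * h x)
    (by fun_prop) (by fun_prop) (by fun_prop)
    (fun x => mul_nonneg (by positivity) (f0 x)) (fun x => mul_nonneg (by positivity) (g0 x))
    (fun x => mul_nonneg (by positivity) (h0 x))
    (fun x => by rw [inv_mul_le_one₀ a0]; exact fa x)
    (fun x => by rw [inv_mul_le_one₀ b0]; exact gb x)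
    (fun t ht => by
      obtain ⟨x, hx⟩ := exists_lt_of_lt_ciSup (f := f) (b := a * t) (by rw [← ha]; nlinarith)
      exact ⟨x, by rwa [lt_inv_mul_iff₀ a0]⟩)
    (fun t ht => by
      obtain ⟨x, hx⟩ := exists_lt_of_lt_ciSup (f := g) (b := b * t) (by rw [← hb]; nlinarith)
      exact ⟨x, by rwa [lt_inv_mul_iff₀ b0]⟩)
    (fun x y => by
      rw [mul_pow, inv_pow, Real.sq_sqrt (by positivity), mul_inv]
      have := mul_le_mul_of_nonneg_left (hfg x y) (by positivity : 0 ≤ a⁻¹ * b⁻¹)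
      linarith)
  have e : ∀ (c : ℝ) (u : ℝ → ℝ), 0 < c → (∫⁻ x, ENNReal.ofReal (c * u x)) =
      ENNReal.ofReal c * ∫⁻ x, ENNReal.ofReal (u x) := by
    intro c u hc
    rw [← lintegral_const_mul' _ _ (by simp)]
    simp_rw [ENNReal.ofReal_mul hc.le]
  rw [e _ _ (by positivity), e _ _ (by positivity), e _ _ (by positivity)] at key
  generalize (∫⁻ x, ENNReal.ofReal (f x)) = F at *
  generalize (∫⁻ x, ENNReal.ofReal (g x)) = G at *
  generalize (∫⁻ x, ENNReal.ofReal (h x)) = H at *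
  rcases eq_or_ne H ⊤ with rfl | hH
  · simp
  have hfin : ENNReal.ofReal a⁻¹ * F + ENNReal.ofReal b⁻¹ * G ≠ ⊤ :=
    ne_top_of_le_ne_top (by finiteness) key
  have ha' : ENNReal.ofReal a⁻¹ ≠ 0 := by simpa using a0
  have hb' : ENNReal.ofReal b⁻¹ ≠ 0 := by simpa using b0
  have hF : F ≠ ⊤ := by
    rintro rfl; simp [ENNReal.mul_top ha'] at hfin
  have hG : G ≠ ⊤ := by
    rintro rfl; simp [ENNReal.mul_top hb'] at hfin
  lift F to ℝ≥0 using hF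
  lift G to ℝ≥0 using hG
  lift H to ℝ≥0 using hH
  simp only [ENNReal.ofReal] at key
  norm_cast at key ⊢
  have key' : a⁻¹ * F + b⁻¹ * G ≤ 2 * ((√(a * b))⁻¹ * H) := by
    have := NNReal.coe_le_coe.2 key
    push_cast at this
    rwa [Real.coe_toNNReal _ (by positivity), Real.coe_toNNReal _ (by positivity),
      Real.coe_toNNReal _ (by positivity)] at this
  rw [← NNReal.coe_le_coe]
  push_cast
  -- The arithmetic–geometric mean inequality turns the additive bound into the multiplicative one.
  have h4 : 4 * ((a⁻¹ * F) * (b⁻¹ * G)) ≤ (2 * ((√(a * b))⁻¹ * H)) ^ 2 := by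
    have : (a⁻¹ * F + b⁻¹ * G) ^ 2 ≤ (2 * ((√(a * b))⁻¹ * H)) ^ 2 :=
      pow_le_pow_left₀ (by positivity) key' 2
    nlinarith [sq_nonneg (a⁻¹ * F - b⁻¹ * G)]
  rw [mul_pow, mul_pow, inv_pow, Real.sq_sqrt (by positivity)] at h4
  have h5 : (F : ℝ) * G = (a * b) * ((a⁻¹ * F) * (b⁻¹ * G)) := by field_simp
  have h6 : (H : ℝ) ^ 2 = (a * b) * ((a * b)⁻¹ * H ^ 2) := by field_simp
  rw [h5, h6]
  exact mul_le_mul_of_nonneg_left (by linarith) (by positivity)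

/-- The one-dimensional Prékopa–Leindler inequality. -/
theorem lintegral_mul_lintegral_le {f g h : ℝ → ℝ} (hf : Measurable f)
    (hg : Measurable g) (hh : Measurable h) (f0 : ∀ x, 0 ≤ f x) (g0 : ∀ x, 0 ≤ g x)
    (h0 : ∀ x, 0 ≤ h x) (hfg : ∀ x y, f x * g y ≤ h ((x + y) / 2) ^ 2) :
    (∫⁻ x, ENNReal.ofReal (f x)) * ∫⁻ x, ENNReal.ofReal (g x) ≤
      (∫⁻ x, ENNReal.ofReal (h x)) ^ 2 := by
  have lim : ∀ u : ℝ → ℝ, Measurable u → Tendsto (fun n : ℕ =>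
      ∫⁻ x, ENNReal.ofReal (min (u x) n)) atTop (𝓝 (∫⁻ x, ENNReal.ofReal (u x))) := by
    intro u hu
    refine lintegral_tendsto_of_tendsto_of_monotone (fun n => by fun_prop) ?_ ?_
    · refine ae_of_all _ fun x m n hmn => ENNReal.ofReal_le_ofReal ?_
      exact min_le_min le_rfl (by exact_mod_cast hmn)
    · refine ae_of_all _ fun x => tendsto_const_nhds.congr' ?_
      obtain ⟨n, hn⟩ := exists_nat_ge (u x)
      filter_upwards [eventually_ge_atTop n] with m hm
      rw [min_eq_left (hn.trans (by exact_mod_cast hm))]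
  -- Multiplication on `[0, ∞]` is discontinuous at `(0, ∞)`, so vanishing integrals are set aside
  -- before passing to the limit.
  rcases eq_or_ne (∫⁻ x, ENNReal.ofReal (f x)) 0 with h1 | h1
  · simp [h1]
  rcases eq_or_ne (∫⁻ x, ENNReal.ofReal (g x)) 0 with h2 | h2
  · simp [h2]
  have hlim := ENNReal.Tendsto.mul (lim f hf) (Or.inl h1) (lim g hg) (Or.inl h2)
  refine le_of_tendsto hlim (Eventually.of_forall fun n => ?_)
  refine lintegral_mul_lintegral_le_of_bounded (M := n) (by fun_prop) (by fun_prop) hh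
    (fun x => le_min (f0 x) (by positivity)) (fun x => le_min (g0 x) (by positivity)) h0
    (fun x => min_le_right _ _) (fun x => min_le_right _ _) fun x y => ?_
  exact (mul_le_mul (min_le_left _ _) (min_le_left _ _) (le_min (g0 y) (by positivity))
    (f0 x)).trans (hfg x y)

/-- The infimum-convolution property of a measure `μ` for the (exponentiated) cost `c`. -/
def PropertyTau {E : Type*} [MeasurableSpace E] (μ : Measure E) (c : E → E → ℝ≥0∞) : Prop :=
  ∀ f g : E → ℝ≥0∞, Measurable f → Measurable g → (∀ x y, f x * g y ≤ c x y) →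
    (∫⁻ x, f x ∂μ) * ∫⁻ y, g y ∂μ ≤ 1

namespace PropertyTau

variable {E F : Type*} [MeasurableSpace E] [MeasurableSpace F] {μ : Measure E} {ν : Measure F}
  {c : E → E → ℝ≥0∞} {d : F → F → ℝ≥0∞}

theorem of_measurePreserving (h : PropertyTau μ c) {T : E → F} (hT : MeasurePreserving T μ ν)
    (hd : ∀ x y, d (T x) (T y) ≤ c x y) : PropertyTau ν d := by
  intro f g hf hg hfg
  rw [← hT.lintegral_comp hf, ← hT.lintegral_comp hg]
  exact h _ _ (hf.comp hT.measurable) (hg.comp hT.measurable) fun x y =>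
    (hfg _ _).trans (hd x y)

/-- Tensorization: for frozen first coordinates, divide `g` by `c x y` and use the property of `ν`.
The partial integrals then satisfy the hypothesis for `μ`. -/
theorem prod [SFinite ν] (hμ : PropertyTau μ c) (hν : PropertyTau ν d)
    (c0 : ∀ x y, c x y ≠ 0) (c1 : ∀ x y, c x y ≠ ⊤) :
    PropertyTau (μ.prod ν) fun p q => c p.1 q.1 * d p.2 q.2 := by
  intro f g hf hg hfg
  rw [lintegral_prod _ hf.aemeasurable, lintegral_prod _ hg.aemeasurable]
  refine hμ _ _ hf.lintegral_prod_right' hg.lintegral_prod_right' fun x y => ?_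
  have key := hν (fun x' => f (x, x')) (fun y' => (c x y)⁻¹ * g (y, y')) (by fun_prop)
    (by fun_prop) fun x' y' => ?_
  · rw [lintegral_const_mul' _ _ (by simpa using c0 x y)] at key
    calc _ = c x y * ((∫⁻ x', f (x, x') ∂ν) * ((c x y)⁻¹ * ∫⁻ y', g (y, y') ∂ν)) := by
          rw [mul_left_comm _ (c x y)⁻¹, ← mul_assoc, ENNReal.mul_inv_cancel (c0 x y) (c1 x y),
            one_mul]
      _ ≤ c x y * 1 := by gcongr
      _ = _ := mul_one _
  · calc _ = (c x y)⁻¹ * (f (x, x') * g (y, y')) := by ring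
      _ ≤ (c x y)⁻¹ * (c x y * d x' y') := mul_le_mul_right (hfg (x, x') (y, y')) _
      _ = _ := by
        rw [← mul_assoc, ENNReal.inv_mul_cancel (c0 x y) (c1 x y), one_mul]

/-- Prékopa–Leindler for `φ f`, `φ g` and `φ`, where `φ` is the Gaussian density. By the
parallelogram identity the cost is exactly what makes `φ(x) φ(y) exp((x - y)²/(4v)) = φ((x +
y)/2)²`. -/
theorem gaussianReal {v : ℝ≥0} (hv : v ≠ 0) :
    PropertyTau (gaussianReal 0 v) fun x y => ENNReal.ofReal (Real.exp ((x - y) ^ 2 / (4 * v))) := by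
  intro f g hf hg hfg
  have hv' : (0 : ℝ) < v := by positivity
  by_cases hg0 : ∀ y, g y = 0
  · simp [hg0]
  by_cases hf0 : ∀ x, f x = 0
  · simp [hf0]
  push Not at hf0 hg0
  obtain ⟨x₀, hx₀⟩ := hf0
  obtain ⟨y₀, hy₀⟩ := hg0
  -- The cost is finite and `g` is nonzero somewhere, so `f` never takes the value `⊤`; likewise for
  -- `g`.
  have hft : ∀ x, f x ≠ ⊤ := fun x hx => by
    have := hfg x y₀
    rw [hx, ENNReal.top_mul hy₀] at this
    simp at this
  have hgt : ∀ y, g y ≠ ⊤ := fun y hy => by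
    have := hfg x₀ y
    rw [hy, ENNReal.mul_top hx₀] at this
    simp at this
  have hp : ∀ x, 0 ≤ gaussianPDFReal 0 v x := gaussianPDFReal_nonneg 0 v
  have hm := measurable_gaussianPDFReal 0 v
  have e : ∀ u : ℝ → ℝ≥0∞, Measurable u → (∀ x, u x ≠ ⊤) →
      ∫⁻ x, u x ∂ProbabilityTheory.gaussianReal 0 v =
        ∫⁻ x, ENNReal.ofReal (gaussianPDFReal 0 v x * (u x).toReal) := by
    intro u hu hu'
    rw [gaussianReal_of_var_ne_zero _ hv, lintegral_withDensity_eq_lintegral_mul _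
      (measurable_gaussianPDF 0 v) hu]
    refine lintegral_congr fun x => ?_
    rw [ENNReal.ofReal_mul (hp x), ENNReal.ofReal_toReal (hu' x)]
    rfl
  rw [e f hf hft, e g hg hgt]
  refine (lintegral_mul_lintegral_le (h := gaussianPDFReal 0 v) (hm.mul hf.ennreal_toReal)
    (hm.mul hg.ennreal_toReal) hm (fun x => mul_nonneg (hp x) ENNReal.toReal_nonneg)
    (fun x => mul_nonneg (hp x) ENNReal.toReal_nonneg) hp fun x y => ?_).trans ?_
  · have h1 : (f x).toReal * (g y).toReal ≤ Real.exp ((x - y) ^ 2 / (4 * v)) := by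
      rw [← ENNReal.toReal_mul]
      exact ENNReal.toReal_le_of_le_ofReal (Real.exp_pos _).le (hfg x y)
    calc _ = gaussianPDFReal 0 v x * gaussianPDFReal 0 v y * ((f x).toReal * (g y).toReal) := by
          simp only [Pi.mul_apply]; ring
      _ ≤ gaussianPDFReal 0 v x * gaussianPDFReal 0 v y * Real.exp ((x - y) ^ 2 / (4 * v)) :=
          mul_le_mul_of_nonneg_left h1 (mul_nonneg (hp x) (hp y))
      _ = _ := by
          simp only [gaussianPDFReal, sub_zero]
          rw [mul_pow, ← Real.exp_nat_mul, mul_mul_mul_comm, mul_assoc, ← Real.exp_add,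
            ← Real.exp_add, ← sq]
          congr 2
          push_cast
          field_simp
          ring
  · have : ∫⁻ x, ENNReal.ofReal (gaussianPDFReal 0 v x) = 1 := lintegral_gaussianPDFReal_eq_one 0 hv
    rw [this]; simp

theorem pi_fin {n : ℕ} {E : Fin n → Type*} [∀ i, MeasurableSpace (E i)]
    {μ : ∀ i, Measure (E i)} {c : ∀ i, E i → E i → ℝ≥0∞}
    [∀ i, IsProbabilityMeasure (μ i)]
    (h : ∀ i, PropertyTau (μ i) (c i)) (c0 : ∀ i x y, c i x y ≠ 0)
    (c1 : ∀ i x y, c i x y ≠ ⊤) :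
    PropertyTau (Measure.pi μ) fun x y => ∏ i, c i (x i) (y i) := by
  induction n with
  | zero =>
    intro f g hf hg hfg
    have := hfg default default
    simp only [Finset.univ_eq_empty, Finset.prod_empty] at this
    simpa [Measure.pi_of_empty μ default] using this
  | succ n ih =>
    have h1 := (h 0).prod (ih (fun i => h (Fin.succ i)) (fun i => c0 _) (fun i => c1 _))
      (c0 0) (c1 0)
    refine h1.of_measurePreserving (measurePreserving_piFinSuccAbove μ 0).symm fun x y => ?_
    have e0 : ∀ z, (MeasurableEquiv.piFinSuccAbove E 0).symm z 0 = z.1 := fun z =>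
      Fin.insertNth_apply_same (α := E) 0 z.1 z.2
    have es : ∀ z i, (MeasurableEquiv.piFinSuccAbove E 0).symm z (Fin.succ i) = z.2 i := fun z i =>
      Fin.insertNth_apply_succAbove (α := E) 0 z.1 z.2 i
    rw [Fin.prod_univ_succ]
    exact (congrArg₂ (· * ·) (congrArg₂ (c 0) (e0 x) (e0 y)) (Finset.prod_congr rfl fun i _ =>
      congrArg₂ (c i.succ) (es x i) (es y i))).le

theorem pi {ι : Type*} [Fintype ι] {E : ι → Type*} [∀ i, MeasurableSpace (E i)]
    {μ : ∀ i, Measure (E i)} [∀ i, IsProbabilityMeasure (μ i)] {c : ∀ i, E i → E i → ℝ≥0∞}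
    (h : ∀ i, PropertyTau (μ i) (c i)) (c0 : ∀ i x y, c i x y ≠ 0)
    (c1 : ∀ i x y, c i x y ≠ ⊤) :
    PropertyTau (Measure.pi μ) fun x y => ∏ i, c i (x i) (y i) := by
  let e := (Fintype.equivFin ι).symm
  refine (pi_fin (fun i => h (e i)) (fun i => c0 _) (fun i => c1 _)).of_measurePreserving
    (measurePreserving_piCongrLeft μ e) fun x y => ?_
  rw [← e.prod_comp]
  simp [MeasurableEquiv.coe_piCongrLeft, Equiv.piCongrLeft_apply_apply]

end PropertyTau

/-! ### The infimum-convolution property of the Wiener measure -/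

/-- The weight `1 + n²`. -/
def wt (n : ℤ) : ℝ := 1 + (n : ℝ) ^ 2

theorem wt_pos (n : ℤ) : 0 < wt n := by unfold wt; positivity

theorem one_le_wt (n : ℤ) : 1 ≤ wt n := by unfold wt; nlinarith [sq_nonneg (n : ℝ)]

/-- The variance is `1 / wt n`, so the costs of the real and imaginary parts multiply to a quarter
of the Cameron–Martin square in the exponent. -/
theorem propertyTau_modeLaw (n : ℤ) :
    PropertyTau (modeLaw n) fun x y => ENNReal.ofReal (Real.exp (wt n * ‖x - y‖ ^ 2 / 4)) := by
  have hv : ((1 + (n.natAbs : ℝ≥0) ^ 2)⁻¹ : ℝ≥0) ≠ 0 := by positivity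
  have h1 := PropertyTau.gaussianReal hv
  refine (h1.prod h1 (fun x y => by simp [Real.exp_pos]) (by simp)).of_measurePreserving
    ⟨Complex.measurableEquivRealProd.symm.measurable, rfl⟩ fun x y => le_of_eq ?_
  rw [← ENNReal.ofReal_mul (Real.exp_pos _).le, ← Real.exp_add]
  congr 2
  have : (((1 + (n.natAbs : ℝ≥0) ^ 2)⁻¹ : ℝ≥0) : ℝ) = (wt n)⁻¹ := by
    simp [wt, Nat.cast_natAbs]
  rw [this, ← Complex.normSq_eq_norm_sq, Complex.normSq_apply]
  have := (wt_pos n).ne'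
  simp [Complex.measurableEquivRealProd]
  field_simp

theorem measurePreserving_restrict (S : Finset ℤ) :
    MeasurePreserving S.restrict wiener (Measure.pi fun n : S => modeLaw n) :=
  ⟨Finset.measurable_restrict S, Measure.infinitePi_map_restrict modeLaw⟩

/-- The infimum-convolution property of `wiener`, for functions of finitely many coefficients. -/
theorem lintegral_mul_lintegral_wiener_le (S : Finset ℤ) {f g : (S → ℂ) → ℝ≥0∞}
    (hf : Measurable f) (hg : Measurable g)
    (hfg : ∀ x y, f x * g y ≤ ENNReal.ofReal (Real.exp (∑ n : S, wt n * ‖x n - y n‖ ^ 2 / 4))) :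
    (∫⁻ a, f (S.restrict a) ∂wiener) * ∫⁻ a, g (S.restrict a) ∂wiener ≤ 1 := by
  rw [(measurePreserving_restrict S).lintegral_comp hf,
    (measurePreserving_restrict S).lintegral_comp hg]
  refine PropertyTau.pi (fun n : S => propertyTau_modeLaw n) (by simp [Real.exp_pos]) (by simp)
    f g hf hg fun x y => (hfg x y).trans_eq ?_
  rw [Real.exp_sum, ENNReal.ofReal_prod_of_nonneg fun _ _ => (Real.exp_pos _).le]

open scoped ComplexConjugate

/-! ### Trigonometric polynomials -/

/-- The trigonometric polynomial `∑_{n ∈ S} a n e^{inx}`. -/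
def trig (S : Finset ℤ) (a : Coeff) (x : ℝ) : ℂ := ∑ n ∈ S, a n * Complex.exp (Complex.I * n * x)

theorem trunc_eq_trig (N : ℕ) (a : Coeff) : trunc N a = trig (modes N) a := rfl

/-- Quadruples of frequencies in `S` with `n₁ + n₂ = n₃ + n₄`. -/
def quads (S : Finset ℤ) : Finset (ℤ × ℤ × ℤ × ℤ) :=
  (S ×ˢ S ×ˢ S ×ˢ S).filter fun q => q.1 + q.2.1 = q.2.2.1 + q.2.2.2

theorem mem_quads {S : Finset ℤ} {q : ℤ × ℤ × ℤ × ℤ} : q ∈ quads S ↔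
    (q.1 ∈ S ∧ q.2.1 ∈ S ∧ q.2.2.1 ∈ S ∧ q.2.2.2 ∈ S) ∧ q.1 + q.2.1 = q.2.2.1 + q.2.2.2 := by
  simp [quads]

@[fun_prop]
theorem continuous_trig (S : Finset ℤ) (a : Coeff) : Continuous (trig S a) := by
  unfold trig; fun_prop

theorem conj_exp_freq (n : ℤ) (x : ℝ) :
    conj (Complex.exp (Complex.I * n * x)) = Complex.exp (-(Complex.I * n * x)) := by
  rw [← Complex.exp_conj]; simp

theorem integral_exp_freq (k : ℤ) :
    ∫ x in (0)..(2 * Real.pi), Complex.exp (Complex.I * k * x) =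
      if k = 0 then ((2 * Real.pi : ℝ) : ℂ) else 0 := by
  split_ifs with hk
  · simp [hk]
  · have hc : Complex.I * k ≠ 0 := mul_ne_zero Complex.I_ne_zero (by exact_mod_cast hk)
    rw [integral_exp_mul_complex hc]
    have : Complex.exp (Complex.I * k * ((2 * Real.pi : ℝ) : ℂ)) = 1 := by
      rw [Complex.exp_eq_one_iff]; exact ⟨k, by push_cast; ring⟩
    rw [this]; simp

theorem integral_trig_mul_conj (S : Finset ℤ) (a b : Coeff) :
    ∫ x in (0)..(2 * Real.pi), trig S a x * conj (trig S b x) =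
      ((2 * Real.pi : ℝ) : ℂ) * ∑ n ∈ S, a n * conj (b n) := by
  have h : ∀ x : ℝ, trig S a x * conj (trig S b x) = ∑ p ∈ S ×ˢ S,
      (a p.1 * conj (b p.2)) * Complex.exp (Complex.I * ((p.1 - p.2 : ℤ) : ℂ) * x) := by
    intro x
    simp only [trig, map_sum, map_mul, conj_exp_freq]
    rw [Finset.sum_mul_sum, ← Finset.sum_product']
    refine Finset.sum_congr rfl fun p _ => ?_
    rw [mul_mul_mul_comm, ← Complex.exp_add]
    push_cast; ring_nf
  simp_rw [h]
  rw [intervalIntegral.integral_finsetSum fun p _ =>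
    (Continuous.intervalIntegrable (by fun_prop) _ _)]
  simp_rw [intervalIntegral.integral_const_mul, integral_exp_freq]
  rw [Finset.sum_product, Finset.mul_sum]
  refine Finset.sum_congr rfl fun n hn => ?_
  rw [Finset.sum_eq_single n (fun m _ hm => by simp [sub_eq_zero, hm.symm])
    (fun h => absurd hn h)]
  simp [mul_comm]

theorem integral_trig_mul_trig_mul_conj (S : Finset ℤ) (a b c d : Coeff) :
    ∫ x in (0)..(2 * Real.pi), trig S a x * trig S b x * conj (trig S c x) * conj (trig S d x) =
      ((2 * Real.pi : ℝ) : ℂ) * ∑ q ∈ quads S,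
        a q.1 * b q.2.1 * conj (c q.2.2.1) * conj (d q.2.2.2) := by
  have h : ∀ x : ℝ, trig S a x * trig S b x * conj (trig S c x) * conj (trig S d x) =
      ∑ q ∈ S ×ˢ S ×ˢ S ×ˢ S, (a q.1 * b q.2.1 * conj (c q.2.2.1) * conj (d q.2.2.2)) *
        Complex.exp (Complex.I * ((q.1 + q.2.1 - q.2.2.1 - q.2.2.2 : ℤ) : ℂ) * x) := by
    intro x
    simp only [trig, map_sum, map_mul, conj_exp_freq]
    rw [mul_assoc, mul_assoc, Finset.sum_mul_sum S S (fun i => conj (c i) * _), ← Finset.sum_product',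
      Finset.sum_mul_sum, ← Finset.sum_product', Finset.sum_mul_sum, ← Finset.sum_product']
    refine Finset.sum_congr rfl fun p _ => ?_
    push_cast
    rw [show Complex.I * ((p.1 : ℂ) + p.2.1 - p.2.2.1 - p.2.2.2) * x =
      Complex.I * p.1 * x + (Complex.I * p.2.1 * x + (-(Complex.I * p.2.2.1 * x) +
        -(Complex.I * p.2.2.2 * x))) by ring, Complex.exp_add, Complex.exp_add, Complex.exp_add]
    ring
  simp_rw [h]
  rw [intervalIntegral.integral_finsetSum fun p _ =>
    (Continuous.intervalIntegrable (by fun_prop) _ _)]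
  simp_rw [intervalIntegral.integral_const_mul, integral_exp_freq]
  rw [quads, Finset.sum_filter, Finset.mul_sum]
  refine Finset.sum_congr rfl fun q _ => ?_
  have : (q.1 + q.2.1 - q.2.2.1 - q.2.2.2 = 0) ↔ q.1 + q.2.1 = q.2.2.1 + q.2.2.2 := by
    constructor <;> intro h <;> linarith
  simp only [this]
  split_ifs <;> simp [mul_comm]

theorem deriv_trig (S : Finset ℤ) (a : Coeff) :
    deriv (trig S a) = trig S fun n => Complex.I * n * a n := by
  funext x
  refine HasDerivAt.deriv ?_
  unfold trig
  refine HasDerivAt.fun_sum fun n _ => ?_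
  have h1 : HasDerivAt (fun y : ℝ => Complex.I * n * (y : ℂ)) (Complex.I * n) x := by
    simpa using (Complex.ofRealCLM.hasDerivAt (x := x)).const_mul (Complex.I * (n : ℂ))
  convert! (h1.cexp.const_mul (a n)) using 1
  ring

theorem mass_trig (S : Finset ℤ) (a : Coeff) :
    mass (trig S a) = 2 * Real.pi * ∑ n ∈ S, ‖a n‖ ^ 2 := by
  have h := integral_trig_mul_conj S a a
  simp_rw [Complex.mul_conj, Complex.normSq_eq_norm_sq] at h
  rw [intervalIntegral.integral_ofReal] at h
  unfold mass
  exact_mod_cast h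

theorem momentum_trig (S : Finset ℤ) (a : Coeff) :
    momentum (trig S a) = -(2 * Real.pi * ∑ n ∈ S, (n : ℝ) * ‖a n‖ ^ 2) := by
  unfold momentum
  rw [deriv_trig, integral_trig_mul_conj]
  have : ∀ n : ℤ, a n * conj (Complex.I * n * a n) =
      -(((n : ℝ) * ‖a n‖ ^ 2 : ℝ) : ℂ) * Complex.I := by
    intro n
    have h := Complex.mul_conj (a n)
    rw [Complex.normSq_eq_norm_sq] at h
    simp only [map_mul, Complex.conj_I, map_intCast, Complex.ofReal_mul, ← h]
    push_cast
    ring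
  simp_rw [this, ← Finset.sum_mul, Finset.sum_neg_distrib, ← Complex.ofReal_sum]
  simp [Complex.mul_im, -Complex.ofReal_pow]

/-! ### The quartic form with one derivative -/

/-- The quadrilinear form `∑ (n₁ + n₂) a_{n₁} b_{n₂} c̄_{n₃} d̄_{n₄}` over `n₁ + n₂ = n₃ + n₄`. -/
def qform (S : Finset ℤ) (a b c d : Coeff) : ℂ :=
  ∑ q ∈ quads S, ((q.1 : ℂ) + q.2.1) * (a q.1 * b q.2.1 * conj (c q.2.2.1) * conj (d q.2.2.2))

/-- `(n₁, n₂, n₃, n₄) ↦ (n₂, n₁, n₃, n₄)`. -/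
theorem sum_quads_swap_left {M : Type*} [AddCommMonoid M] (S : Finset ℤ)
    (F : ℤ → ℤ → ℤ → ℤ → M) :
    ∑ q ∈ quads S, F q.1 q.2.1 q.2.2.1 q.2.2.2 = ∑ q ∈ quads S, F q.2.1 q.1 q.2.2.1 q.2.2.2 := by
  refine Finset.sum_nbij' (fun q => (q.2.1, q.1, q.2.2.1, q.2.2.2))
    (fun q => (q.2.1, q.1, q.2.2.1, q.2.2.2)) ?_ ?_ ?_ ?_ ?_ <;>
    simp +contextual [mem_quads, add_comm]

theorem sum_quads_swap_right {M : Type*} [AddCommMonoid M] (S : Finset ℤ)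
    (F : ℤ → ℤ → ℤ → ℤ → M) :
    ∑ q ∈ quads S, F q.1 q.2.1 q.2.2.1 q.2.2.2 = ∑ q ∈ quads S, F q.1 q.2.1 q.2.2.2 q.2.2.1 := by
  refine Finset.sum_nbij' (fun q => (q.1, q.2.1, q.2.2.2, q.2.2.1))
    (fun q => (q.1, q.2.1, q.2.2.2, q.2.2.1)) ?_ ?_ ?_ ?_ ?_ <;>
    simp +contextual [mem_quads, add_comm]

theorem sum_quads_swap_sides {M : Type*} [AddCommMonoid M] (S : Finset ℤ)
    (F : ℤ → ℤ → ℤ → ℤ → M) :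
    ∑ q ∈ quads S, F q.1 q.2.1 q.2.2.1 q.2.2.2 = ∑ q ∈ quads S, F q.2.2.1 q.2.2.2 q.1 q.2.1 := by
  refine Finset.sum_nbij' (fun q => (q.2.2.1, q.2.2.2, q.1, q.2.1))
    (fun q => (q.2.2.1, q.2.2.2, q.1, q.2.1)) ?_ ?_ ?_ ?_ ?_ <;>
    simp +contextual [mem_quads]

theorem qform_swap_left (S : Finset ℤ) (a b c d : Coeff) :
    qform S a b c d = qform S b a c d := by
  unfold qform
  rw [sum_quads_swap_left S fun i j k l => ((i : ℂ) + j) * (a i * b j * conj (c k) * conj (d l))]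
  exact Finset.sum_congr rfl fun q _ => by ring

theorem qform_swap_right (S : Finset ℤ) (a b c d : Coeff) :
    qform S a b c d = qform S a b d c := by
  unfold qform
  rw [sum_quads_swap_right S fun i j k l => ((i : ℂ) + j) * (a i * b j * conj (c k) * conj (d l))]
  exact Finset.sum_congr rfl fun q _ => by ring

/-- On `n₁ + n₂ = n₃ + n₄` the weight can be read off either pair. This lets the derivative be moved
to whichever pair is smoother. -/
theorem qform_conj (S : Finset ℤ) (a b c d : Coeff) :
    conj (qform S a b c d) = qform S c d a b := by
  unfold qform
  rw [map_sum, sum_quads_swap_sides S fun i j k l =>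
    ((i : ℂ) + j) * (c i * d j * conj (a k) * conj (b l))]
  refine Finset.sum_congr rfl fun q hq => ?_
  have : (q.1 : ℂ) + q.2.1 = q.2.2.1 + q.2.2.2 := by exact_mod_cast (mem_quads.1 hq).2
  simp only [map_mul, map_add, map_intCast, Complex.conj_conj]
  rw [this]
  ring

/-- The derivative produces the weight `n₄`. Symmetrizing in `n₃` and `n₄` replaces it by `(n₃ +
n₄)/2 = (n₁ + n₂)/2`. -/
theorem cubic_trig (S : Finset ℤ) (a : Coeff) :
    cubic (trig S a) = -(Real.pi * (qform S a a a a).re) := by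
  unfold cubic
  rw [deriv_trig]
  have h := integral_trig_mul_trig_mul_conj S a a a fun n => Complex.I * n * a n
  have e : ∀ x, trig S a x ^ 2 * conj (trig S a x) * conj (trig S (fun n => Complex.I * n * a n) x)
      = trig S a x * trig S a x * conj (trig S a x) *
        conj (trig S (fun n => Complex.I * n * a n) x) := fun x => by ring
  simp_rw [e, h]
  set G : ℤ → ℤ → ℤ → ℤ → ℂ := fun i j k l => (l : ℂ) * (a i * a j * conj (a k) * conj (a l))
    with hG
  have h1 : ∑ q ∈ quads S, a q.1 * a q.2.1 * conj (a q.2.2.1) *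
      conj (Complex.I * q.2.2.2 * a q.2.2.2) =
      -Complex.I * ∑ q ∈ quads S, G q.1 q.2.1 q.2.2.1 q.2.2.2 := by
    rw [Finset.mul_sum]
    refine Finset.sum_congr rfl fun q _ => ?_
    simp [hG]; ring
  have h2 : qform S a a a a = 2 * ∑ q ∈ quads S, G q.1 q.2.1 q.2.2.1 q.2.2.2 := by
    rw [two_mul]
    nth_rewrite 2 [sum_quads_swap_right S G]
    rw [← Finset.sum_add_distrib]
    refine Finset.sum_congr rfl fun q hq => ?_
    have : (q.1 : ℂ) + q.2.1 = q.2.2.1 + q.2.2.2 := by exact_mod_cast (mem_quads.1 hq).2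
    rw [this, hG]; ring
  rw [h1, h2]
  simp [Complex.mul_re, Complex.mul_im]
  ring

theorem quartic_trig (S : Finset ℤ) (a : Coeff) :
    quartic (trig S a) = 2 * Real.pi * (∑ q ∈ quads S,
      a q.1 * a q.2.1 * conj (a q.2.2.1) * conj (a q.2.2.2)).re := by
  have h := integral_trig_mul_trig_mul_conj S a a a a
  have e : ∀ x, trig S a x * trig S a x * conj (trig S a x) * conj (trig S a x) =
      ((‖trig S a x‖ ^ 4 : ℝ) : ℂ) := fun x => by
    have := Complex.mul_conj (trig S a x)
    rw [Complex.normSq_eq_norm_sq] at this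
    push_cast at this ⊢
    linear_combination (trig S a x * conj (trig S a x) + (‖trig S a x‖ : ℂ) ^ 2) * this
  simp_rw [e] at h
  rw [intervalIntegral.integral_ofReal] at h
  have := congrArg Complex.re h
  rwa [Complex.re_ofReal_mul, Complex.ofReal_re] at this

theorem quartic_trig_le (S : Finset ℤ) (a : Coeff) :
    quartic (trig S a) ≤ 2 * Real.pi * ∑ q ∈ quads S,
      ‖a q.1‖ * ‖a q.2.1‖ * ‖a q.2.2.1‖ * ‖a q.2.2.2‖ := by
  rw [quartic_trig]
  refine mul_le_mul_of_nonneg_left ((Complex.re_le_norm _).trans ((norm_sum_le _ _).trans_eq ?_))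
    (by positivity)
  simp

/-! ### Sums over quadruples -/

theorem sum_le_sum_of_injOn {ι κ : Type*} [DecidableEq κ] {s : Finset ι} {t : Finset κ} (e : ι → κ)
    (he : Set.InjOn e s) (hst : ∀ i ∈ s, e i ∈ t) {F : κ → ℝ} (hF : ∀ k, 0 ≤ F k) :
    ∑ i ∈ s, F (e i) ≤ ∑ k ∈ t, F k := by
  rw [← Finset.sum_image he]
  exact Finset.sum_le_sum_of_subset_of_nonneg (Finset.image_subset_iff.2 hst) fun _ _ _ => hF _

theorem sum_product_three (S : Finset ℤ) (f g h : ℤ → ℝ) :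
    ∑ p ∈ S ×ˢ S ×ˢ S, f p.1 * g p.2.1 * h p.2.2 =
      (∑ n ∈ S, f n) * (∑ n ∈ S, g n) * ∑ n ∈ S, h n := by
  rw [mul_assoc, Finset.sum_mul_sum S S g h, ← Finset.sum_product', Finset.sum_mul_sum,
    ← Finset.sum_product']
  exact Finset.sum_congr rfl fun p _ => by ring

theorem sum_quads_le_of_injOn (S : Finset ℤ) (e : ℤ × ℤ × ℤ × ℤ → ℤ × ℤ × ℤ)
    (he : Set.InjOn e (quads S)) (hS : ∀ q ∈ quads S, e q ∈ S ×ˢ S ×ˢ S)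
    {f g h : ℤ → ℝ} (hf : ∀ n, 0 ≤ f n) (hg : ∀ n, 0 ≤ g n) (hh : ∀ n, 0 ≤ h n) :
    ∑ q ∈ quads S, f (e q).1 * g (e q).2.1 * h (e q).2.2 ≤
      (∑ n ∈ S, f n) * (∑ n ∈ S, g n) * ∑ n ∈ S, h n := by
  rw [← sum_product_three]
  exact sum_le_sum_of_injOn e he hS (F := fun p => f p.1 * g p.2.1 * h p.2.2)
    fun k => mul_nonneg (mul_nonneg (hf _) (hg _)) (hh _)

/-- Three frequencies of a quadruple determine the fourth, so a summand that involves only three of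
them is bounded by a free triple sum. -/
theorem sum_quads_le_one_two_three (S : Finset ℤ) {f g h : ℤ → ℝ} (hf : ∀ n, 0 ≤ f n)
    (hg : ∀ n, 0 ≤ g n) (hh : ∀ n, 0 ≤ h n) : ∑ q ∈ quads S, f q.1 * g q.2.1 * h q.2.2.1 ≤
    (∑ n ∈ S, f n) * (∑ n ∈ S, g n) * ∑ n ∈ S, h n := by
  refine sum_quads_le_of_injOn S (fun q => (q.1, q.2.1, q.2.2.1)) ?_ ?_ hf hg hh
  · rintro ⟨a, b, c, d⟩ hq ⟨a', b', c', d'⟩ hq' h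
    simp only [Finset.mem_coe, mem_quads, Prod.mk.injEq] at *
    grind
  · intro q hq; simp [mem_quads] at *; tauto

theorem sum_quads_le_one_two_four (S : Finset ℤ) {f g h : ℤ → ℝ} (hf : ∀ n, 0 ≤ f n)
    (hg : ∀ n, 0 ≤ g n) (hh : ∀ n, 0 ≤ h n) : ∑ q ∈ quads S, f q.1 * g q.2.1 * h q.2.2.2 ≤
    (∑ n ∈ S, f n) * (∑ n ∈ S, g n) * ∑ n ∈ S, h n := by
  refine sum_quads_le_of_injOn S (fun q => (q.1, q.2.1, q.2.2.2)) ?_ ?_ hf hg hh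
  · rintro ⟨a, b, c, d⟩ hq ⟨a', b', c', d'⟩ hq' h
    simp only [Finset.mem_coe, mem_quads, Prod.mk.injEq] at *
    grind
  · intro q hq; simp [mem_quads] at *; tauto

theorem sum_quads_le_one_three_four (S : Finset ℤ) {f g h : ℤ → ℝ} (hf : ∀ n, 0 ≤ f n)
    (hg : ∀ n, 0 ≤ g n) (hh : ∀ n, 0 ≤ h n) : ∑ q ∈ quads S, f q.1 * g q.2.2.1 * h q.2.2.2 ≤
    (∑ n ∈ S, f n) * (∑ n ∈ S, g n) * ∑ n ∈ S, h n := by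
  refine sum_quads_le_of_injOn S (fun q => (q.1, q.2.2.1, q.2.2.2)) ?_ ?_ hf hg hh
  · rintro ⟨a, b, c, d⟩ hq ⟨a', b', c', d'⟩ hq' h
    simp only [Finset.mem_coe, mem_quads, Prod.mk.injEq] at *
    grind
  · intro q hq; simp [mem_quads] at *; tauto

theorem sum_quads_le_two_three_four (S : Finset ℤ) {f g h : ℤ → ℝ} (hf : ∀ n, 0 ≤ f n)
    (hg : ∀ n, 0 ≤ g n) (hh : ∀ n, 0 ≤ h n) : ∑ q ∈ quads S, f q.2.1 * g q.2.2.1 * h q.2.2.2 ≤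
    (∑ n ∈ S, f n) * (∑ n ∈ S, g n) * ∑ n ∈ S, h n := by
  refine sum_quads_le_of_injOn S (fun q => (q.2.1, q.2.2.1, q.2.2.2)) ?_ ?_ hf hg hh
  · rintro ⟨a, b, c, d⟩ hq ⟨a', b', c', d'⟩ hq' h
    simp only [Finset.mem_coe, mem_quads, Prod.mk.injEq] at *
    grind
  · intro q hq; simp [mem_quads] at *; tauto

/-! ### Weights -/

theorem summable_wt_rpow {p : ℝ} (hp : p < -(1 / 2)) : Summable fun n : ℤ => wt n ^ p := by
  have h := (Real.summable_abs_int_rpow (b := -(2 * p)) (by linarith))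
  rw [← (Set.finite_singleton (0 : ℤ)).summable_compl_iff] at h ⊢
  refine Summable.of_nonneg_of_le (fun n => (Real.rpow_pos_of_pos (wt_pos _) _).le) (fun n => ?_) h
  have hn : (0 : ℝ) < |((n : ℤ) : ℝ)| := abs_pos.2 (by exact_mod_cast n.2)
  have h2 : |((n : ℤ) : ℝ)| ^ (- -(2 * p)) = (((n : ℤ) : ℝ) ^ 2) ^ p := by
    rw [neg_neg, Real.rpow_mul hn.le, ← sq_abs]
    norm_cast
  change wt n ^ p ≤ |((n : ℤ) : ℝ)| ^ (- -(2 * p))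
  rw [h2]
  refine Real.rpow_le_rpow_of_nonpos (by rw [← sq_abs]; positivity) ?_ (by linarith)
  unfold wt; linarith

theorem summable_inv_wt : Summable fun n : ℤ => (wt n)⁻¹ := by
  simpa [Real.rpow_neg_one] using summable_wt_rpow (p := -1) (by norm_num)

/-- The weight `⟨n⟩^{3/4}`. -/
def wts (n : ℤ) : ℝ := wt n ^ (3 / 8 : ℝ)

theorem wts_pos (n : ℤ) : 0 < wts n := Real.rpow_pos_of_pos (wt_pos n) _

theorem one_le_wts (n : ℤ) : 1 ≤ wts n := Real.one_le_rpow (one_le_wt n) (by norm_num)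

/-- The exponent `3/4` is large enough for this sum, which underlies `H^{3/8} ⊂ L⁴`, and small
enough for `summable_wts_div_wt`, which says that `ρ` charges `H^{3/8}`. -/
theorem summable_inv_wts_sq : Summable fun n : ℤ => (wts n)⁻¹ ^ 2 := by
  refine (summable_wt_rpow (p := -(3 / 4)) (by norm_num)).congr fun n => ?_
  rw [wts, ← Real.rpow_neg (wt_pos n).le, ← Real.rpow_natCast, ← Real.rpow_mul (wt_pos n).le]
  norm_num

theorem summable_wts_div_wt : Summable fun n : ℤ => wts n * (wt n)⁻¹ := by
  refine (summable_wt_rpow (p := -(5 / 8)) (by norm_num)).congr fun n => ?_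
  rw [wts, ← Real.rpow_neg_one, ← Real.rpow_add (wt_pos n)]
  norm_num

/-- `∑ₙ ⟨n⟩^{-3/2}`. -/
def Kσ : ℝ := ∑' n : ℤ, (wts n)⁻¹ ^ 2

theorem sum_inv_wts_sq_le (S : Finset ℤ) : ∑ n ∈ S, (wts n)⁻¹ ^ 2 ≤ Kσ :=
  summable_inv_wts_sq.sum_le_tsum _ fun _ _ => sq_nonneg _

theorem Kσ_nonneg : 0 ≤ Kσ := tsum_nonneg fun _ => sq_nonneg _

/-! ### Multilinear estimates -/

theorem sum_mul_le_of_sq_le {ι : Type*} (s : Finset ι) {f g : ι → ℝ} {A B : ℝ} (hA : 0 ≤ A)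
    (hB : 0 ≤ B) (hf : ∑ i ∈ s, f i ^ 2 ≤ A ^ 2) (hg : ∑ i ∈ s, g i ^ 2 ≤ B ^ 2) :
    ∑ i ∈ s, f i * g i ≤ A * B := by
  refine abs_le_of_sq_le_sq' ?_ (mul_nonneg hA hB) |>.2
  refine (Finset.sum_mul_sq_le_sq_mul_sq s f g).trans ?_
  rw [mul_pow]
  exact mul_le_mul hf hg (Finset.sum_nonneg fun _ _ => sq_nonneg _) (sq_nonneg _)

section Multilinear

variable (S : Finset ℤ) {u v p q : ℤ → ℝ} {U V P Q : ℝ}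

/-- Cauchy–Schwarz with `√(p q)` put into both factors: each square then depends on three
frequencies only. -/
theorem sum_quads_le_l2_l2_l1_l1 (hp : ∀ n, 0 ≤ p n) (hq : ∀ n, 0 ≤ q n)
    (hU0 : 0 ≤ U) (hV0 : 0 ≤ V)
    (hU : ∑ n ∈ S, u n ^ 2 ≤ U ^ 2) (hV : ∑ n ∈ S, v n ^ 2 ≤ V ^ 2) :
    ∑ z ∈ quads S, u z.1 * v z.2.1 * p z.2.2.1 * q z.2.2.2 ≤
      U * V * ((∑ n ∈ S, p n) * ∑ n ∈ S, q n) := by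
  set M := (∑ n ∈ S, p n) * ∑ n ∈ S, q n with hM
  have hM0 : 0 ≤ M := mul_nonneg (Finset.sum_nonneg fun _ _ => hp _)
    (Finset.sum_nonneg fun _ _ => hq _)
  have h := sum_mul_le_of_sq_le (quads S) (f := fun z => u z.1 * √(p z.2.2.1 * q z.2.2.2))
    (g := fun z => v z.2.1 * √(p z.2.2.1 * q z.2.2.2)) (A := U * √M) (B := V * √M)
    (by positivity) (by positivity) ?_ ?_
  · calc _ = _ := Finset.sum_congr rfl fun z _ => by
          rw [mul_mul_mul_comm, Real.mul_self_sqrt (mul_nonneg (hp _) (hq _))]; ring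
      _ ≤ _ := h
      _ = _ := by rw [mul_mul_mul_comm, Real.mul_self_sqrt hM0]
  · simp_rw [mul_pow, Real.sq_sqrt hM0, Real.sq_sqrt (mul_nonneg (hp _) (hq _)), ← mul_assoc]
    refine (sum_quads_le_one_three_four S (f := fun n => u n ^ 2) (fun _ => sq_nonneg _) hp
      hq).trans ?_
    rw [mul_assoc]; gcongr
  · simp_rw [mul_pow, Real.sq_sqrt hM0, Real.sq_sqrt (mul_nonneg (hp _) (hq _)), ← mul_assoc]
    refine (sum_quads_le_two_three_four S (f := fun n => v n ^ 2) (fun _ => sq_nonneg _) hp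
      hq).trans ?_
    rw [mul_assoc]; gcongr

theorem sum_quads_le_l2_l1_l1_l2 (hp : ∀ n, 0 ≤ p n) (hq : ∀ n, 0 ≤ q n)
    (hU0 : 0 ≤ U) (hV0 : 0 ≤ V)
    (hU : ∑ n ∈ S, u n ^ 2 ≤ U ^ 2) (hV : ∑ n ∈ S, v n ^ 2 ≤ V ^ 2) :
    ∑ z ∈ quads S, u z.1 * p z.2.1 * q z.2.2.1 * v z.2.2.2 ≤
      U * V * ((∑ n ∈ S, p n) * ∑ n ∈ S, q n) := by
  set M := (∑ n ∈ S, p n) * ∑ n ∈ S, q n with hM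
  have hM0 : 0 ≤ M := mul_nonneg (Finset.sum_nonneg fun _ _ => hp _)
    (Finset.sum_nonneg fun _ _ => hq _)
  have h := sum_mul_le_of_sq_le (quads S) (f := fun z => u z.1 * √(p z.2.1 * q z.2.2.1))
    (g := fun z => √(p z.2.1 * q z.2.2.1) * v z.2.2.2) (A := U * √M) (B := √M * V)
    (by positivity) (by positivity) ?_ ?_
  · calc _ = _ := Finset.sum_congr rfl fun z _ => by
          have := Real.mul_self_sqrt (mul_nonneg (hp z.2.1) (hq z.2.2.1))
          linear_combination (-(u z.1 * v z.2.2.2)) * this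
      _ ≤ _ := h
      _ = _ := by linear_combination (U * V) * Real.mul_self_sqrt hM0
  · simp_rw [mul_pow, Real.sq_sqrt hM0, Real.sq_sqrt (mul_nonneg (hp _) (hq _)), ← mul_assoc]
    refine (sum_quads_le_one_two_three S (f := fun n => u n ^ 2) (fun _ => sq_nonneg _) hp
      hq).trans ?_
    rw [mul_assoc]; gcongr
  · simp_rw [mul_pow, Real.sq_sqrt hM0, Real.sq_sqrt (mul_nonneg (hp _) (hq _))]
    refine (sum_quads_le_two_three_four S (h := fun n => v n ^ 2) hp hq
      (fun _ => sq_nonneg _)).trans ?_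
    gcongr

theorem inv_mul_inv_le_half (a b : ℝ) : a⁻¹ * b⁻¹ ≤ 1 / 2 * a⁻¹ ^ 2 + 1 / 2 * b⁻¹ ^ 2 := by
  nlinarith [sq_nonneg (a⁻¹ - b⁻¹)]

/-- Two factors in `H^{3/8}`, one in `ℓ²` and one in `ℓ¹`. -/
theorem sum_quads_le_l2_l1_wts_wts (hq : ∀ n, 0 ≤ q n) (hU0 : 0 ≤ U) (hV0 : 0 ≤ V) (hP0 : 0 ≤ P)
    (hU : ∑ n ∈ S, wts n * u n ^ 2 ≤ U ^ 2) (hV : ∑ n ∈ S, wts n * v n ^ 2 ≤ V ^ 2)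
    (hP : ∑ n ∈ S, p n ^ 2 ≤ P ^ 2) :
    ∑ z ∈ quads S, p z.1 * q z.2.1 * u z.2.2.1 * v z.2.2.2 ≤
      √Kσ * U * V * P * ∑ n ∈ S, q n := by
  set M := ∑ n ∈ S, q n with hM
  have hM0 : 0 ≤ M := Finset.sum_nonneg fun _ _ => hq _
  have w0 : ∀ n, 0 ≤ wts n := fun n => (wts_pos n).le
  have h := sum_mul_le_of_sq_le (quads S)
    (f := fun z => √(wts z.2.2.1) * u z.2.2.1 * (√(wts z.2.2.2) * v z.2.2.2) * √(q z.2.1))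
    (g := fun z => p z.1 * √(q z.2.1) * (√(wts z.2.2.1)⁻¹ * √(wts z.2.2.2)⁻¹))
    (A := U * V * √M) (B := P * √M * √Kσ)
    (by positivity) (by positivity) ?_ ?_
  · calc _ = _ := Finset.sum_congr rfl fun z _ => by
          have h1 : √(wts z.2.2.1) * √(wts z.2.2.1)⁻¹ = 1 := by
            rw [← Real.sqrt_mul (w0 _), mul_inv_cancel₀ (wts_pos _).ne', Real.sqrt_one]
          have h2 : √(wts z.2.2.2) * √(wts z.2.2.2)⁻¹ = 1 := by
            rw [← Real.sqrt_mul (w0 _), mul_inv_cancel₀ (wts_pos _).ne', Real.sqrt_one]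
          have h3 : √(q z.2.1) * √(q z.2.1) = q z.2.1 := Real.mul_self_sqrt (hq _)
          calc _ = (√(wts z.2.2.1) * √(wts z.2.2.1)⁻¹) * (√(wts z.2.2.2) * √(wts z.2.2.2)⁻¹) *
                (√(q z.2.1) * √(q z.2.1)) * (p z.1 * u z.2.2.1 * v z.2.2.2) := by
                rw [h1, h2, h3]; ring
            _ = _ := by ring
      _ ≤ _ := h
      _ = _ := by
        rw [show U * V * √M * (P * √M * √Kσ) = √Kσ * U * V * P * (√M * √M) by ring,
          Real.mul_self_sqrt hM0]
  · simp_rw [mul_pow, Real.sq_sqrt hM0, Real.sq_sqrt (hq _), Real.sq_sqrt (w0 _)]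
    calc _ = ∑ z ∈ quads S, q z.2.1 * (wts z.2.2.1 * u z.2.2.1 ^ 2) *
            (wts z.2.2.2 * v z.2.2.2 ^ 2) := Finset.sum_congr rfl fun z _ => by ring
      _ ≤ _ := sum_quads_le_two_three_four S hq (g := fun n => wts n * u n ^ 2)
          (h := fun n => wts n * v n ^ 2) (fun n => mul_nonneg (w0 _) (sq_nonneg _))
          (fun n => mul_nonneg (w0 _) (sq_nonneg _))
      _ ≤ M * U ^ 2 * V ^ 2 := mul_le_mul (mul_le_mul le_rfl hU
          (Finset.sum_nonneg fun n _ => mul_nonneg (w0 _) (sq_nonneg _)) hM0) hV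
          (Finset.sum_nonneg fun n _ => mul_nonneg (w0 _) (sq_nonneg _)) (by positivity)
      _ = _ := by ring
  · simp_rw [mul_pow, Real.sq_sqrt hM0, Real.sq_sqrt (hq _), Real.sq_sqrt Kσ_nonneg,
      Real.sq_sqrt (inv_nonneg.2 (w0 _))]
    have hPM : ∀ n, 0 ≤ p n ^ 2 := fun _ => sq_nonneg _
    have b1 := sum_quads_le_one_two_three S hPM hq (h := fun n => (wts n)⁻¹ ^ 2)
      (fun _ => sq_nonneg _)
    have b2 := sum_quads_le_one_two_four S hPM hq (h := fun n => (wts n)⁻¹ ^ 2)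
      (fun _ => sq_nonneg _)
    have b3 : (∑ n ∈ S, p n ^ 2) * M * ∑ n ∈ S, (wts n)⁻¹ ^ 2 ≤ P ^ 2 * M * Kσ :=
      mul_le_mul (mul_le_mul hP le_rfl hM0 (sq_nonneg _)) (sum_inv_wts_sq_le S)
        (Finset.sum_nonneg fun _ _ => sq_nonneg _) (by positivity)
    -- The mean inequality separates the two inverse weights, so that each term again depends on
    -- three frequencies only.
    calc _ ≤ ∑ z ∈ quads S, (1 / 2 * (p z.1 ^ 2 * q z.2.1 * (wts z.2.2.1)⁻¹ ^ 2) +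
          1 / 2 * (p z.1 ^ 2 * q z.2.1 * (wts z.2.2.2)⁻¹ ^ 2)) := by
          refine Finset.sum_le_sum fun z _ => ?_
          have := mul_le_mul_of_nonneg_left (inv_mul_inv_le_half (wts z.2.2.1) (wts z.2.2.2))
            (mul_nonneg (hPM z.1) (hq z.2.1))
          linarith
      _ ≤ _ := by
        rw [Finset.sum_add_distrib, ← Finset.mul_sum, ← Finset.mul_sum]
        linarith

/-- The variant with the two `H^{3/8}` factors on opposite sides of the relation, needed when `y`
occurs once conjugated and once not. -/
theorem sum_quads_le_wts_l2_wts_l1 (hq : ∀ n, 0 ≤ q n) (hU0 : 0 ≤ U) (hV0 : 0 ≤ V) (hP0 : 0 ≤ P)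
    (hU : ∑ n ∈ S, wts n * u n ^ 2 ≤ U ^ 2) (hV : ∑ n ∈ S, wts n * v n ^ 2 ≤ V ^ 2)
    (hP : ∑ n ∈ S, p n ^ 2 ≤ P ^ 2) :
    ∑ z ∈ quads S, u z.1 * p z.2.1 * v z.2.2.1 * q z.2.2.2 ≤
      √Kσ * U * V * P * ∑ n ∈ S, q n := by
  set M := ∑ n ∈ S, q n with hM
  have hM0 : 0 ≤ M := Finset.sum_nonneg fun _ _ => hq _
  have w0 : ∀ n, 0 ≤ wts n := fun n => (wts_pos n).le
  have h := sum_mul_le_of_sq_le (quads S)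
    (f := fun z => √(wts z.1) * u z.1 * (√(wts z.2.2.1) * v z.2.2.1) * √(q z.2.2.2))
    (g := fun z => p z.2.1 * √(q z.2.2.2) * (√(wts z.1)⁻¹ * √(wts z.2.2.1)⁻¹))
    (A := U * V * √M) (B := P * √M * √Kσ)
    (by positivity) (by positivity) ?_ ?_
  · calc _ = _ := Finset.sum_congr rfl fun z _ => by
          have h1 : √(wts z.1) * √(wts z.1)⁻¹ = 1 := by
            rw [← Real.sqrt_mul (w0 _), mul_inv_cancel₀ (wts_pos _).ne', Real.sqrt_one]
          have h2 : √(wts z.2.2.1) * √(wts z.2.2.1)⁻¹ = 1 := by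
            rw [← Real.sqrt_mul (w0 _), mul_inv_cancel₀ (wts_pos _).ne', Real.sqrt_one]
          have h3 : √(q z.2.2.2) * √(q z.2.2.2) = q z.2.2.2 := Real.mul_self_sqrt (hq _)
          calc _ = (√(wts z.1) * √(wts z.1)⁻¹) * (√(wts z.2.2.1) * √(wts z.2.2.1)⁻¹) *
                (√(q z.2.2.2) * √(q z.2.2.2)) * (u z.1 * p z.2.1 * v z.2.2.1) := by
                rw [h1, h2, h3]; ring
            _ = _ := by ring
      _ ≤ _ := h
      _ = _ := by
        rw [show U * V * √M * (P * √M * √Kσ) = √Kσ * U * V * P * (√M * √M) by ring,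
          Real.mul_self_sqrt hM0]
  · simp_rw [mul_pow, Real.sq_sqrt hM0, Real.sq_sqrt (hq _), Real.sq_sqrt (w0 _)]
    calc _ ≤ _ := sum_quads_le_one_three_four S (f := fun n => wts n * u n ^ 2)
          (g := fun n => wts n * v n ^ 2) (fun n => mul_nonneg (w0 _) (sq_nonneg _))
          (fun n => mul_nonneg (w0 _) (sq_nonneg _)) hq
      _ ≤ U ^ 2 * V ^ 2 * M := mul_le_mul (mul_le_mul hU hV
          (Finset.sum_nonneg fun n _ => mul_nonneg (w0 _) (sq_nonneg _)) (sq_nonneg _)) le_rfl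
          hM0 (by positivity)
  · simp_rw [mul_pow, Real.sq_sqrt hM0, Real.sq_sqrt (hq _), Real.sq_sqrt Kσ_nonneg,
      Real.sq_sqrt (inv_nonneg.2 (w0 _))]
    have hPM : ∀ n, 0 ≤ p n ^ 2 := fun _ => sq_nonneg _
    have b1 := sum_quads_le_one_two_four S (f := fun n => (wts n)⁻¹ ^ 2)
      (fun _ => sq_nonneg _) hPM hq
    have b2 := sum_quads_le_two_three_four S hPM (g := fun n => (wts n)⁻¹ ^ 2)
      (fun _ => sq_nonneg _) hq
    have b3 : (∑ n ∈ S, p n ^ 2) * M * ∑ n ∈ S, (wts n)⁻¹ ^ 2 ≤ P ^ 2 * M * Kσ :=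
      mul_le_mul (mul_le_mul hP le_rfl hM0 (sq_nonneg _)) (sum_inv_wts_sq_le S)
        (Finset.sum_nonneg fun _ _ => sq_nonneg _) (by positivity)
    calc _ ≤ ∑ z ∈ quads S, (1 / 2 * ((wts z.1)⁻¹ ^ 2 * p z.2.1 ^ 2 * q z.2.2.2) +
          1 / 2 * (p z.2.1 ^ 2 * (wts z.2.2.1)⁻¹ ^ 2 * q z.2.2.2)) := by
          refine Finset.sum_le_sum fun z _ => ?_
          have := mul_le_mul_of_nonneg_left (inv_mul_inv_le_half (wts z.1) (wts z.2.2.1))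
            (mul_nonneg (hPM z.2.1) (hq z.2.2.2))
          linarith
      _ ≤ _ := by
        rw [Finset.sum_add_distrib, ← Finset.mul_sum, ← Finset.mul_sum]
        linarith

/-- The embedding `H^{3/8} ⊂ L⁴`, on the Fourier side. -/
theorem sum_quads_le_wts (u : ℤ → ℝ) :
    ∑ z ∈ quads S, u z.1 * u z.2.1 * u z.2.2.1 * u z.2.2.2 ≤
      Kσ * (∑ n ∈ S, wts n * u n ^ 2) ^ 2 := by
  have w0 : ∀ n, 0 ≤ wts n := fun n => (wts_pos n).le
  set U := ∑ n ∈ S, wts n * u n ^ 2 with hU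
  have hu : ∀ n, 0 ≤ wts n * u n ^ 2 := fun n => mul_nonneg (w0 _) (sq_nonneg _)
  have hU0 : 0 ≤ U := Finset.sum_nonneg fun n _ => hu n
  have key : ∑ z ∈ quads S, (wts z.1 * u z.1 ^ 2) * (wts z.2.1 * u z.2.1 ^ 2) *
      ((wts z.2.2.1)⁻¹ * (wts z.2.2.2)⁻¹) ≤ Kσ * U ^ 2 := by
    have b1 := sum_quads_le_one_two_three S hu hu (h := fun n => (wts n)⁻¹ ^ 2)
      (fun _ => sq_nonneg _)
    have b2 := sum_quads_le_one_two_four S hu hu (h := fun n => (wts n)⁻¹ ^ 2)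
      (fun _ => sq_nonneg _)
    have b3 : U * U * ∑ n ∈ S, (wts n)⁻¹ ^ 2 ≤ U * U * Kσ :=
      mul_le_mul_of_nonneg_left (sum_inv_wts_sq_le S) (by positivity)
    calc _ ≤ ∑ z ∈ quads S, (1 / 2 * ((wts z.1 * u z.1 ^ 2) * (wts z.2.1 * u z.2.1 ^ 2) *
            (wts z.2.2.1)⁻¹ ^ 2) + 1 / 2 * ((wts z.1 * u z.1 ^ 2) * (wts z.2.1 * u z.2.1 ^ 2) *
            (wts z.2.2.2)⁻¹ ^ 2)) := by
          refine Finset.sum_le_sum fun z _ => ?_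
          have := mul_le_mul_of_nonneg_left (inv_mul_inv_le_half (wts z.2.2.1) (wts z.2.2.2))
            (mul_nonneg (hu z.1) (hu z.2.1))
          linarith
      _ ≤ _ := by
        rw [Finset.sum_add_distrib, ← Finset.mul_sum, ← Finset.mul_sum]
        linarith
  have h1 : ∀ n, √(wts n) * √(wts n)⁻¹ = 1 := fun n => by
    rw [← Real.sqrt_mul (w0 _), mul_inv_cancel₀ (wts_pos _).ne', Real.sqrt_one]
  have h := sum_mul_le_of_sq_le (quads S)
    (f := fun z => √(wts z.1) * u z.1 * (√(wts z.2.1) * u z.2.1) *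
      (√(wts z.2.2.1)⁻¹ * √(wts z.2.2.2)⁻¹))
    (g := fun z => √(wts z.2.2.1) * u z.2.2.1 * (√(wts z.2.2.2) * u z.2.2.2) *
      (√(wts z.1)⁻¹ * √(wts z.2.1)⁻¹)) (A := √Kσ * U) (B := √Kσ * U)
    (by positivity) (by positivity) ?_ ?_
  · calc _ = _ := Finset.sum_congr rfl fun z _ => by
          calc _ = (√(wts z.1) * √(wts z.1)⁻¹) * (√(wts z.2.1) * √(wts z.2.1)⁻¹) *
                (√(wts z.2.2.1) * √(wts z.2.2.1)⁻¹) * (√(wts z.2.2.2) * √(wts z.2.2.2)⁻¹) *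
                (u z.1 * u z.2.1 * u z.2.2.1 * u z.2.2.2) := by
                rw [h1, h1, h1, h1]; ring
            _ = _ := by ring
      _ ≤ _ := h
      _ = _ := by
        rw [show √Kσ * U * (√Kσ * U) = √Kσ * √Kσ * U ^ 2 by ring, Real.mul_self_sqrt Kσ_nonneg]
  · simp_rw [mul_pow, Real.sq_sqrt (w0 _), Real.sq_sqrt (inv_nonneg.2 (w0 _)),
      Real.sq_sqrt Kσ_nonneg]
    exact key
  · simp_rw [mul_pow, Real.sq_sqrt (w0 _), Real.sq_sqrt (inv_nonneg.2 (w0 _)),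
      Real.sq_sqrt Kσ_nonneg]
    -- Exchanging the two sides of the relation maps the second Cauchy–Schwarz factor to the first.
    rw [sum_quads_swap_sides S fun i j k l => wts k * u k ^ 2 * (wts l * u l ^ 2) *
      ((wts i)⁻¹ * (wts j)⁻¹)]
    exact key

end Multilinear

/-! ### Carlson's inequality -/

theorem modes_succ (N : ℕ) : modes (N + 1) =
    insert ((N : ℤ) + 1) (insert (-((N : ℤ) + 1)) (modes N)) := by
  ext n; simp [modes]; omega

theorem sum_modes_succ {M : Type*} [AddCommMonoid M] (N : ℕ) (f : ℤ → M) :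
    ∑ n ∈ modes (N + 1), f n =
      f ((N : ℤ) + 1) + (f (-((N : ℤ) + 1)) + ∑ n ∈ modes N, f n) := by
  rw [modes_succ, Finset.sum_insert, Finset.sum_insert]
  · simp [modes]
  · simp [modes]; omega

/-- The sharper bound `5/R - 4/(R + N)` telescopes: the pair `±(N + 1)` contributes at most `4/(R +
N) - 4/(R + N + 1)`. -/
theorem sum_modes_inv_le (N : ℕ) {R : ℝ} (hR : 1 ≤ R) :
    ∑ n ∈ modes N, (R ^ 2 + (n : ℝ) ^ 2)⁻¹ ≤ 5 / R := by
  have key : ∑ n ∈ modes N, (R ^ 2 + (n : ℝ) ^ 2)⁻¹ ≤ 5 / R - 4 / (R + N) := by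
    induction N with
    | zero =>
      have : modes 0 = {0} := by simp [modes]
      rw [this]
      simp only [Finset.sum_singleton, Int.cast_zero, Nat.cast_zero, add_zero]
      rw [← sub_div, ← one_div]
      norm_num
      exact inv_anti₀ (by positivity) (by nlinarith)
    | succ N ih =>
      rw [sum_modes_succ]
      push_cast
      have hpos : (0 : ℝ) ≤ N := Nat.cast_nonneg N
      have h1 : (R ^ 2 + ((N : ℝ) + 1) ^ 2)⁻¹ ≤ 2 / (R + N) - 2 / (R + (N + 1)) := by
        rw [div_sub_div _ _ (by positivity) (by positivity), inv_eq_one_div,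
          div_le_div_iff₀ (by positivity) (by positivity)]
        nlinarith [sq_nonneg (R - (N + 1))]
      have h2 : (R ^ 2 + (-((N : ℝ) + 1)) ^ 2)⁻¹ = (R ^ 2 + ((N : ℝ) + 1) ^ 2)⁻¹ := by
        rw [neg_sq]
      rw [h2]
      have e1 : 4 / (R + (N : ℝ)) = 2 * (2 / (R + N)) := by ring
      have e2 : 4 / (R + ((N : ℝ) + 1)) = 2 * (2 / (R + (N + 1))) := by ring
      rw [e1] at ih
      rw [e2]
      linarith
  have : 0 ≤ 4 / (R + (N : ℝ)) := by positivity
  linarith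

/-- Cauchy–Schwarz against the weight `R² + n²`, where `R² = H/L` balances the two resulting terms.
This is where smallness of the `L²` norm reduces the power of the `H¹` norm. -/
theorem carlson (N : ℕ) (h : ℤ → ℝ) :
    (∑ n ∈ modes N, h n) ^ 2 ≤
      10 * (√(∑ n ∈ modes N, h n ^ 2) * √(∑ n ∈ modes N, wt n * h n ^ 2)) := by
  set L := ∑ n ∈ modes N, h n ^ 2 with hL
  set H := ∑ n ∈ modes N, wt n * h n ^ 2 with hH
  have hLH : L ≤ H := Finset.sum_le_sum fun n _ => by nlinarith [one_le_wt n, sq_nonneg (h n)]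
  have L0 : 0 ≤ L := Finset.sum_nonneg fun _ _ => sq_nonneg _
  rcases L0.eq_or_lt with h0 | h0
  · have : ∀ n ∈ modes N, h n = 0 := fun n hn => by
      have := (Finset.sum_eq_zero_iff_of_nonneg fun n _ => sq_nonneg (h n)).1 h0.symm n hn
      simpa using this
    rw [Finset.sum_eq_zero this, zero_pow two_ne_zero]
    positivity
  have H0 : 0 < H := h0.trans_le hLH
  set R := √H / √L with hRdef
  have sL : 0 < √L := Real.sqrt_pos.2 h0
  have sH : 0 < √H := Real.sqrt_pos.2 H0
  have hR : 1 ≤ R := by rw [hRdef, one_le_div sL]; exact Real.sqrt_le_sqrt hLH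
  have hR0 : 0 < R := one_pos.trans_le hR
  have hRL : R ^ 2 * L = H := by
    rw [hRdef, div_pow, Real.sq_sqrt L0, Real.sq_sqrt H0.le]; field_simp
  have cs := Finset.sum_mul_sq_le_sq_mul_sq (modes N) (fun n => √(R ^ 2 + (n : ℝ) ^ 2) * h n)
    (fun n => √((R ^ 2 + (n : ℝ) ^ 2)⁻¹))
  have e1 : ∀ n : ℤ, √(R ^ 2 + (n : ℝ) ^ 2) * h n * √((R ^ 2 + (n : ℝ) ^ 2)⁻¹) = h n := by
    intro n
    have hp : (0 : ℝ) < R ^ 2 + (n : ℝ) ^ 2 := by positivity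
    rw [mul_right_comm, ← Real.sqrt_mul hp.le, mul_inv_cancel₀ hp.ne', Real.sqrt_one, one_mul]
  have e2 : ∀ n : ℤ, (√(R ^ 2 + (n : ℝ) ^ 2) * h n) ^ 2 = R ^ 2 * h n ^ 2 + (n : ℝ) ^ 2 * h n ^ 2 := by
    intro n; rw [mul_pow, Real.sq_sqrt (by positivity)]; ring
  have e3 : ∀ n : ℤ, √((R ^ 2 + (n : ℝ) ^ 2)⁻¹) ^ 2 = (R ^ 2 + (n : ℝ) ^ 2)⁻¹ := by
    intro n; rw [Real.sq_sqrt (by positivity)]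
  simp_rw [e1, e2, e3] at cs
  rw [Finset.sum_add_distrib, ← Finset.mul_sum, ← hL, hRL] at cs
  have e4 : ∑ n ∈ modes N, (n : ℝ) ^ 2 * h n ^ 2 ≤ H :=
    Finset.sum_le_sum fun n _ => mul_le_mul_of_nonneg_right (by unfold wt; linarith) (sq_nonneg _)
  calc _ ≤ _ := cs
    _ ≤ (H + H) * (5 / R) := mul_le_mul (by linarith) (sum_modes_inv_le N hR)
        (Finset.sum_nonneg fun n _ => by positivity) (by positivity)
    _ = _ := by
      rw [hRdef]
      field_simp
      rw [Real.sq_sqrt H0.le]; ring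

/-! ### The quartic form along Cameron–Martin shifts -/

/-- `∑ (n₁ + n₂) y_{n₁} y_{n₂} ȳ_{n₃}` over `n₁ + n₂ = n₃ + k`. -/
def tripleCoeff (S : Finset ℤ) (y : Coeff) (k : ℤ) : ℂ :=
  ∑ q ∈ (quads S).filter (fun q => q.2.2.2 = k),
    ((q.1 : ℂ) + q.2.1) * (y q.1 * y q.2.1 * conj (y q.2.2.1))

/-- The square of the `H⁻¹` norm of `tripleCoeff`. -/
def tripleNorm (S : Finset ℤ) (y : Coeff) : ℝ := ∑ k ∈ S, ‖tripleCoeff S y k‖ ^ 2 * (wt k)⁻¹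

/-- `∑ n₁ y_{n₁} ȳ_{n₂}` over `n₁ - n₂ = d`. -/
def pairCoeff (S : Finset ℤ) (y : Coeff) (d : ℤ) : ℂ :=
  ∑ p ∈ (S ×ˢ S).filter (fun p => p.1 - p.2 = d), (p.1 : ℂ) * (y p.1 * conj (y p.2))

/-- The differences of elements of `S`. -/
def diffs (S : Finset ℤ) : Finset ℤ := (S ×ˢ S).image fun p => p.1 - p.2

/-- The square of the `H⁻¹` norm of `pairCoeff`. -/
def pairNorm (S : Finset ℤ) (y : Coeff) : ℝ := ∑ d ∈ diffs S, ‖pairCoeff S y d‖ ^ 2 * (wt d)⁻¹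

theorem tripleNorm_nonneg (S : Finset ℤ) (y : Coeff) : 0 ≤ tripleNorm S y :=
  Finset.sum_nonneg fun _ _ => mul_nonneg (sq_nonneg _) (inv_nonneg.2 (wt_pos _).le)

theorem pairNorm_nonneg (S : Finset ℤ) (y : Coeff) : 0 ≤ pairNorm S y :=
  Finset.sum_nonneg fun _ _ => mul_nonneg (sq_nonneg _) (inv_nonneg.2 (wt_pos _).le)

/-- `∑ (1 + n²)|h_n|²`. -/
def hNorm (S : Finset ℤ) (h : Coeff) : ℝ := ∑ n ∈ S, wt n * ‖h n‖ ^ 2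

/-- `∑ ⟨n⟩^{3/4}|h_n|²`. -/
def sNorm (S : Finset ℤ) (h : Coeff) : ℝ := ∑ n ∈ S, wts n * ‖h n‖ ^ 2

/-- `∑ |h_n|²`. -/
def mNorm (S : Finset ℤ) (h : Coeff) : ℝ := ∑ n ∈ S, ‖h n‖ ^ 2

/-- `∑ |h_n|`. -/
def aNorm (S : Finset ℤ) (h : Coeff) : ℝ := ∑ n ∈ S, ‖h n‖

/-- `∑ n |h_n|²`. -/
def pSum (S : Finset ℤ) (h : Coeff) : ℝ := ∑ n ∈ S, (n : ℝ) * ‖h n‖ ^ 2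

theorem hNorm_nonneg (S : Finset ℤ) (h : Coeff) : 0 ≤ hNorm S h :=
  Finset.sum_nonneg fun _ _ => mul_nonneg (wt_pos _).le (sq_nonneg _)

theorem sNorm_nonneg (S : Finset ℤ) (h : Coeff) : 0 ≤ sNorm S h :=
  Finset.sum_nonneg fun _ _ => mul_nonneg (wts_pos _).le (sq_nonneg _)

theorem mNorm_nonneg (S : Finset ℤ) (h : Coeff) : 0 ≤ mNorm S h :=
  Finset.sum_nonneg fun _ _ => sq_nonneg _

theorem aNorm_nonneg (S : Finset ℤ) (h : Coeff) : 0 ≤ aNorm S h :=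
  Finset.sum_nonneg fun _ _ => norm_nonneg _

theorem sum_abs_mul_norm_sq_le (S : Finset ℤ) (h : Coeff) :
    ∑ n ∈ S, (|(n : ℝ)| * ‖h n‖) ^ 2 ≤ √(hNorm S h) ^ 2 := by
  rw [Real.sq_sqrt (hNorm_nonneg S h)]
  refine Finset.sum_le_sum fun n _ => ?_
  rw [mul_pow, sq_abs]
  exact mul_le_mul_of_nonneg_right (by unfold wt; linarith) (sq_nonneg _)

theorem sum_norm_sq_le (S : Finset ℤ) (h : Coeff) :
    ∑ n ∈ S, ‖h n‖ ^ 2 ≤ √(mNorm S h) ^ 2 := by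
  rw [Real.sq_sqrt (mNorm_nonneg S h)]; exact le_rfl

theorem sum_wts_norm_sq_le (S : Finset ℤ) (h : Coeff) :
    ∑ n ∈ S, wts n * ‖h n‖ ^ 2 ≤ √(sNorm S h) ^ 2 := by
  rw [Real.sq_sqrt (sNorm_nonneg S h)]; exact le_rfl

theorem qform_triple (S : Finset ℤ) (y h : Coeff) :
    qform S y y y h = ∑ k ∈ S, tripleCoeff S y k * conj (h k) := by
  unfold qform tripleCoeff
  rw [← Finset.sum_fiberwise_of_maps_to (s := quads S) (t := S) (g := fun q => q.2.2.2)
    (fun q hq => (mem_quads.1 hq).1.2.2.2)]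
  refine Finset.sum_congr rfl fun k _ => ?_
  rw [Finset.sum_mul]
  refine Finset.sum_congr rfl fun q hq => ?_
  rw [(Finset.mem_filter.1 hq).2]
  ring

/-- Duality of `H⁻¹` and `H¹` in the frequency of `h`. With three factors `y` no absolute-value
estimate is used: cancellations inside `tripleCoeff` must survive for its moments to be bounded. -/
theorem norm_qform_triple_le (S : Finset ℤ) (y h : Coeff) :
    ‖qform S y y y h‖ ≤ √(tripleNorm S y) * √(hNorm S h) := by
  rw [qform_triple]
  refine (norm_sum_le _ _).trans ?_
  have w0 : ∀ n, 0 ≤ wt n := fun n => (wt_pos n).le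
  have := sum_mul_le_of_sq_le S (f := fun k => ‖tripleCoeff S y k‖ * √(wt k)⁻¹)
    (g := fun k => √(wt k) * ‖h k‖) (Real.sqrt_nonneg (tripleNorm S y))
    (Real.sqrt_nonneg (hNorm S h)) ?_ ?_
  · refine (Finset.sum_congr rfl fun k _ => ?_).trans_le this
    have h1 : √(wt k) * √(wt k)⁻¹ = 1 := by
      rw [← Real.sqrt_mul (w0 _), mul_inv_cancel₀ (wt_pos _).ne', Real.sqrt_one]
    rw [norm_mul, RCLike.norm_conj]
    linear_combination (-(‖tripleCoeff S y k‖ * ‖h k‖)) * h1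
  · simp_rw [mul_pow, Real.sq_sqrt (inv_nonneg.2 (w0 _)), Real.sq_sqrt (tripleNorm_nonneg S y)]
    exact le_rfl
  · simp_rw [mul_pow, Real.sq_sqrt (w0 _), Real.sq_sqrt (hNorm_nonneg S h)]
    exact le_rfl

/-- The relation reads `n₁ - n₃ = n₄ - n₂`, so the two factors `y` can be summed first at a fixed
difference. -/
theorem sum_quads_eq_sum_pairCoeff (S : Finset ℤ) (y h : Coeff) :
    ∑ q ∈ quads S, (q.1 : ℂ) * (y q.1 * h q.2.1 * conj (y q.2.2.1) * conj (h q.2.2.2)) =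
      ∑ p ∈ S ×ˢ S, h p.1 * conj (h p.2) * pairCoeff S y (p.2 - p.1) := by
  unfold pairCoeff
  simp_rw [Finset.mul_sum]
  rw [Finset.sum_sigma']
  refine Finset.sum_nbij' (fun q => ⟨(q.2.1, q.2.2.2), (q.1, q.2.2.1)⟩)
    (fun z => (z.2.1, z.1.1, z.2.2, z.1.2)) ?_ ?_ ?_ ?_ ?_
  · intro q hq
    rw [mem_quads] at hq
    simp only [Finset.mem_sigma, Finset.mem_product, Finset.mem_filter]
    refine ⟨⟨hq.1.2.1, hq.1.2.2.2⟩, ⟨hq.1.1, hq.1.2.2.1⟩, by linarith [hq.2]⟩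
  · intro z hz
    simp only [Finset.mem_sigma, Finset.mem_product, Finset.mem_filter] at hz
    rw [mem_quads]
    exact ⟨⟨hz.2.1.1, hz.1.1, hz.2.1.2, hz.1.2⟩, by linarith [hz.2.2]⟩
  · intro q _; rfl
  · intro z _; rfl
  · intro q _; simp only; ring

theorem sqrt_wt_sub_le (k l : ℤ) : √(wt (l - k)) ≤ 2 * (√(wt k) + √(wt l)) := by
  rw [Real.sqrt_le_left (by positivity)]
  have h1 := Real.sq_sqrt (wt_pos k).le
  have h2 := Real.sq_sqrt (wt_pos l).le
  have h3 : 0 ≤ √(wt k) * √(wt l) := by positivity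
  have h4 : wt (l - k) ≤ 2 * wt k + 2 * wt l := by
    unfold wt; push_cast; nlinarith [sq_nonneg ((l : ℝ) + k)]
  nlinarith [wt_pos k, wt_pos l]

/-- Duality of `H⁻¹` and `H¹` again, now against the product of `h` and its conjugate. The weight of
the difference passes to one factor `h` by `sqrt_wt_sub_le`, and the other factor is taken in `ℓ¹`.
-/
theorem norm_sum_pairCoeff_le (S : Finset ℤ) (y h : Coeff) :
    ‖∑ p ∈ S ×ˢ S, h p.1 * conj (h p.2) * pairCoeff S y (p.2 - p.1)‖ ≤
      4 * (aNorm S h * √(hNorm S h) * √(pairNorm S y)) := by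
  set Z : ℤ → ℝ := fun d => ‖pairCoeff S y d‖ * √(wt d)⁻¹ with hZ
  have w0 : ∀ n, 0 ≤ wt n := fun n => (wt_pos n).le
  have Z0 : ∀ d, 0 ≤ Z d := fun d => by positivity
  clear_value Z
  have a0 := aNorm_nonneg S h
  have hmem : ∀ p ∈ S ×ˢ S, p.2 - p.1 ∈ diffs S := fun p hp => by
    simp only [Finset.mem_product] at hp
    exact Finset.mem_image.2 ⟨(p.2, p.1), by simp [hp], rfl⟩
  have Zsum : ∑ d ∈ diffs S, Z d ^ 2 = pairNorm S y := by
    simp_rw [hZ, mul_pow, Real.sq_sqrt (inv_nonneg.2 (w0 _))]; rfl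
  have hsum1 : ∑ p ∈ S ×ˢ S, Z (p.2 - p.1) ^ 2 * ‖h p.2‖ ≤ pairNorm S y * aNorm S h := by
    rw [← Zsum, aNorm, Finset.sum_mul_sum, ← Finset.sum_product']
    refine sum_le_sum_of_injOn (s := S ×ˢ S) (t := diffs S ×ˢ S)
      (fun p : ℤ × ℤ => (p.2 - p.1, p.2)) ?_ ?_
      (F := fun p : ℤ × ℤ => Z p.1 ^ 2 * ‖h p.2‖) (fun k => by positivity)
    · rintro ⟨a, b⟩ _ ⟨c, d⟩ _ hh
      simp only [Prod.mk.injEq] at hh ⊢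
      omega
    · intro p hp; exact Finset.mem_product.2 ⟨hmem p hp, (Finset.mem_product.1 hp).2⟩
  have hsum2 : ∑ p ∈ S ×ˢ S, Z (p.2 - p.1) ^ 2 * ‖h p.1‖ ≤ pairNorm S y * aNorm S h := by
    rw [← Zsum, aNorm, Finset.sum_mul_sum, ← Finset.sum_product']
    refine sum_le_sum_of_injOn (s := S ×ˢ S) (t := diffs S ×ˢ S)
      (fun p : ℤ × ℤ => (p.2 - p.1, p.1)) ?_ ?_
      (F := fun p : ℤ × ℤ => Z p.1 ^ 2 * ‖h p.2‖) (fun k => by positivity)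
    · rintro ⟨a, b⟩ _ ⟨c, d⟩ _ hh
      simp only [Prod.mk.injEq] at hh ⊢
      omega
    · intro p hp; exact Finset.mem_product.2 ⟨hmem p hp, (Finset.mem_product.1 hp).1⟩
  have B1 : ∑ p ∈ S ×ˢ S, √(wt p.1) * ‖h p.1‖ * ‖h p.2‖ * Z (p.2 - p.1) ≤
      aNorm S h * √(hNorm S h) * √(pairNorm S y) := by
    have := sum_mul_le_of_sq_le (S ×ˢ S) (f := fun p => √(wt p.1) * ‖h p.1‖ * √‖h p.2‖)
      (g := fun p => Z (p.2 - p.1) * √‖h p.2‖) (A := √(hNorm S h) * √(aNorm S h))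
      (B := √(pairNorm S y) * √(aNorm S h)) (by positivity) (by positivity) ?_ ?_
    · calc _ = _ := Finset.sum_congr rfl fun p _ => by
            linear_combination (-(√(wt p.1) * ‖h p.1‖ * Z (p.2 - p.1))) *
              Real.mul_self_sqrt (norm_nonneg (h p.2))
        _ ≤ _ := this
        _ = _ := by
          linear_combination (√(hNorm S h) * √(pairNorm S y)) * Real.mul_self_sqrt a0
    · simp_rw [mul_pow, Real.sq_sqrt (w0 _), Real.sq_sqrt (hNorm_nonneg S h), Real.sq_sqrt a0,
        Real.sq_sqrt (norm_nonneg _)]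
      rw [hNorm, aNorm, Finset.sum_mul_sum, ← Finset.sum_product']
    · simp_rw [mul_pow, Real.sq_sqrt (pairNorm_nonneg S y), Real.sq_sqrt a0,
        Real.sq_sqrt (norm_nonneg _)]
      exact hsum1
  have B2 : ∑ p ∈ S ×ˢ S, √(wt p.2) * ‖h p.1‖ * ‖h p.2‖ * Z (p.2 - p.1) ≤
      aNorm S h * √(hNorm S h) * √(pairNorm S y) := by
    have := sum_mul_le_of_sq_le (S ×ˢ S) (f := fun p => √‖h p.1‖ * (√(wt p.2) * ‖h p.2‖))
      (g := fun p => Z (p.2 - p.1) * √‖h p.1‖) (A := √(aNorm S h) * √(hNorm S h))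
      (B := √(pairNorm S y) * √(aNorm S h)) (by positivity) (by positivity) ?_ ?_
    · calc _ = _ := Finset.sum_congr rfl fun p _ => by
            linear_combination (-(√(wt p.2) * ‖h p.2‖ * Z (p.2 - p.1))) *
              Real.mul_self_sqrt (norm_nonneg (h p.1))
        _ ≤ _ := this
        _ = _ := by
          linear_combination (√(hNorm S h) * √(pairNorm S y)) * Real.mul_self_sqrt a0
    · simp_rw [mul_pow, Real.sq_sqrt (w0 _), Real.sq_sqrt (hNorm_nonneg S h), Real.sq_sqrt a0,
        Real.sq_sqrt (norm_nonneg _)]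
      rw [hNorm, aNorm, Finset.sum_mul_sum, ← Finset.sum_product']
    · simp_rw [mul_pow, Real.sq_sqrt (pairNorm_nonneg S y), Real.sq_sqrt a0,
        Real.sq_sqrt (norm_nonneg _)]
      exact hsum2
  refine (norm_sum_le _ _).trans ?_
  calc _ ≤ ∑ p ∈ S ×ˢ S, (2 * (√(wt p.1) * ‖h p.1‖ * ‖h p.2‖ * Z (p.2 - p.1)) +
        2 * (√(wt p.2) * ‖h p.1‖ * ‖h p.2‖ * Z (p.2 - p.1))) := by
        refine Finset.sum_le_sum fun p _ => ?_
        have h1 : ‖pairCoeff S y (p.2 - p.1)‖ = √(wt (p.2 - p.1)) * Z (p.2 - p.1) := by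
          have : √(wt (p.2 - p.1)) * √(wt (p.2 - p.1))⁻¹ = 1 := by
            rw [← Real.sqrt_mul (w0 _), mul_inv_cancel₀ (wt_pos _).ne', Real.sqrt_one]
          simp only [hZ]
          linear_combination (-‖pairCoeff S y (p.2 - p.1)‖) * this
        rw [norm_mul, norm_mul, RCLike.norm_conj, h1]
        have := mul_le_mul_of_nonneg_left (sqrt_wt_sub_le p.1 p.2)
          (mul_nonneg (mul_nonneg (norm_nonneg (h p.1)) (norm_nonneg (h p.2))) (Z0 (p.2 - p.1)))
        linarith
    _ ≤ _ := by
      rw [Finset.sum_add_distrib, ← Finset.mul_sum, ← Finset.mul_sum]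
      linarith

theorem norm_qform_le (S : Finset ℤ) (a b c d : Coeff) : ‖qform S a b c d‖ ≤
    ∑ q ∈ quads S, |(q.1 : ℝ)| * ‖a q.1‖ * ‖b q.2.1‖ * ‖c q.2.2.1‖ * ‖d q.2.2.2‖ +
    ∑ q ∈ quads S, ‖a q.1‖ * (|(q.2.1 : ℝ)| * ‖b q.2.1‖) * ‖c q.2.2.1‖ * ‖d q.2.2.2‖ := by
  rw [← Finset.sum_add_distrib]
  refine (norm_sum_le _ _).trans (Finset.sum_le_sum fun q _ => ?_)
  simp only [norm_mul, RCLike.norm_conj]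
  have : ‖(q.1 : ℂ) + q.2.1‖ ≤ |(q.1 : ℝ)| + |(q.2.1 : ℝ)| := by
    refine (norm_add_le _ _).trans_eq ?_
    rw [Complex.norm_intCast, Complex.norm_intCast]
  have h2 := mul_le_mul_of_nonneg_right this
    (by positivity : 0 ≤ ‖a q.1‖ * ‖b q.2.1‖ * ‖c q.2.2.1‖ * ‖d q.2.2.2‖)
  linarith

theorem norm_qform_le_of_same (S : Finset ℤ) (h c d : Coeff) : ‖qform S h h c d‖ ≤
    2 * ∑ q ∈ quads S, |(q.1 : ℝ)| * ‖h q.1‖ * ‖h q.2.1‖ * ‖c q.2.2.1‖ * ‖d q.2.2.2‖ := by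
  refine (norm_qform_le S h h c d).trans_eq ?_
  rw [two_mul]
  congr 1
  rw [sum_quads_swap_left S fun i j k l => ‖h i‖ * (|(j : ℝ)| * ‖h j‖) * ‖c k‖ * ‖d l‖]
  exact Finset.sum_congr rfl fun q _ => by ring

theorem norm_qform_hhhh_le (S : Finset ℤ) (h : Coeff) : ‖qform S h h h h‖ ≤
    2 * (√(hNorm S h) * √(mNorm S h) * aNorm S h ^ 2) := by
  refine (norm_qform_le_of_same S h h h).trans (mul_le_mul_of_nonneg_left ?_ zero_le_two)
  rw [sq]
  exact sum_quads_le_l2_l2_l1_l1 S (u := fun n => |(n : ℝ)| * ‖h n‖) (v := fun n => ‖h n‖)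
    (p := fun n => ‖h n‖) (q := fun n => ‖h n‖) (fun _ => norm_nonneg _) (fun _ => norm_nonneg _)
    (Real.sqrt_nonneg _) (Real.sqrt_nonneg _) (sum_abs_mul_norm_sq_le S h) (sum_norm_sq_le S h)

theorem norm_qform_hhhy_le (S : Finset ℤ) (y h : Coeff) : ‖qform S h h h y‖ ≤
    2 * (√(hNorm S h) * √(mNorm S y) * aNorm S h ^ 2) := by
  refine (norm_qform_le_of_same S h h y).trans (mul_le_mul_of_nonneg_left ?_ zero_le_two)
  rw [sq]
  exact sum_quads_le_l2_l1_l1_l2 S (u := fun n => |(n : ℝ)| * ‖h n‖) (v := fun n => ‖y n‖)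
    (p := fun n => ‖h n‖) (q := fun n => ‖h n‖) (fun _ => norm_nonneg _) (fun _ => norm_nonneg _)
    (Real.sqrt_nonneg _) (Real.sqrt_nonneg _) (sum_abs_mul_norm_sq_le S h) (sum_norm_sq_le S y)

/-- The weight is read off the pair `h`, `h`, so `y` carries no derivative and `H^{3/8}` suffices
for it. -/
theorem norm_qform_hhyy_le (S : Finset ℤ) (y h : Coeff) : ‖qform S h h y y‖ ≤
    2 * (√Kσ * sNorm S y * √(hNorm S h) * aNorm S h) := by
  refine (norm_qform_le_of_same S h y y).trans (mul_le_mul_of_nonneg_left ?_ zero_le_two)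
  have := sum_quads_le_l2_l1_wts_wts S (p := fun n => |(n : ℝ)| * ‖h n‖) (q := fun n => ‖h n‖)
    (u := fun n => ‖y n‖) (v := fun n => ‖y n‖) (fun _ => norm_nonneg _)
    (Real.sqrt_nonneg _) (Real.sqrt_nonneg _) (Real.sqrt_nonneg _) (sum_wts_norm_sq_le S y)
    (sum_wts_norm_sq_le S y) (sum_abs_mul_norm_sq_le S h)
  rwa [mul_assoc √Kσ, Real.mul_self_sqrt (sNorm_nonneg S y)] at this

/-- Each side of the relation contains one `y`, so half of the weight falls on `y` whichever side is
chosen. That half goes to `pairCoeff`; the half falling on `h` is estimated as before. -/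
theorem norm_qform_yhyh_le (S : Finset ℤ) (y h : Coeff) : ‖qform S y h y h‖ ≤
    4 * (aNorm S h * √(hNorm S h) * √(pairNorm S y)) +
      √Kσ * sNorm S y * √(hNorm S h) * aNorm S h := by
  have e : qform S y h y h =
      ∑ q ∈ quads S, (q.1 : ℂ) * (y q.1 * h q.2.1 * conj (y q.2.2.1) * conj (h q.2.2.2)) +
      ∑ q ∈ quads S, (q.2.1 : ℂ) * (y q.1 * h q.2.1 * conj (y q.2.2.1) * conj (h q.2.2.2)) := by
    rw [qform, ← Finset.sum_add_distrib]
    exact Finset.sum_congr rfl fun q _ => by ring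
  rw [e]
  refine (norm_add_le _ _).trans (add_le_add ?_ ?_)
  · rw [sum_quads_eq_sum_pairCoeff]; exact norm_sum_pairCoeff_le S y h
  · have := sum_quads_le_wts_l2_wts_l1 S (p := fun n => |(n : ℝ)| * ‖h n‖) (q := fun n => ‖h n‖)
      (u := fun n => ‖y n‖) (v := fun n => ‖y n‖) (fun _ => norm_nonneg _)
      (Real.sqrt_nonneg _) (Real.sqrt_nonneg _) (Real.sqrt_nonneg _) (sum_wts_norm_sq_le S y)
      (sum_wts_norm_sq_le S y) (sum_abs_mul_norm_sq_le S h)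
    rw [mul_assoc √Kσ, Real.mul_self_sqrt (sNorm_nonneg S y)] at this
    refine (norm_sum_le _ _).trans ((Finset.sum_congr rfl fun q _ => ?_).trans_le this)
    simp only [norm_mul, RCLike.norm_conj, Complex.norm_intCast]
    ring

/-- The sixteen terms collapse to nine by the symmetry within each pair. -/
theorem qform_add_expand (S : Finset ℤ) (y h : Coeff) :
    qform S (y + h) (y + h) (y + h) (y + h) = qform S y y y y +
      (2 * qform S y y y h + 2 * qform S y h y y) + (qform S y y h h + qform S h h y y) +
      4 * qform S y h y h + (2 * qform S h h h y + 2 * qform S h y h h) + qform S h h h h := by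
  have e1 : 2 * qform S y y y h = qform S y y y h + qform S y y h y := by
    rw [qform_swap_right S y y h y]; ring
  have e2 : 2 * qform S y h y y = qform S y h y y + qform S h y y y := by
    rw [qform_swap_left S h y y y]; ring
  have e3 : 4 * qform S y h y h = qform S y h y h + qform S y h h y + qform S h y y h +
      qform S h y h y := by
    rw [qform_swap_left S h y h y, qform_swap_right S y h h y, qform_swap_left S h y y h]; ring
  have e4 : 2 * qform S h h h y = qform S h h h y + qform S h h y h := by
    rw [qform_swap_right S h h y h]; ring
  have e5 : 2 * qform S h y h h = qform S h y h h + qform S y h h h := by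
    rw [qform_swap_left S y h h h]; ring
  rw [e1, e2, e3, e4, e5]
  simp only [qform, ← Finset.sum_add_distrib]
  refine Finset.sum_congr rfl fun q _ => ?_
  simp only [Pi.add_apply, map_add]
  ring

theorem norm_qform_conj (S : Finset ℤ) (a b c d : Coeff) :
    ‖qform S a b c d‖ = ‖qform S c d a b‖ := by
  rw [← qform_conj, RCLike.norm_conj]

/-- The terms are grouped by size: with `t⁴` the squared `H¹` norm of `h` and its `ℓ¹` norm of order
`t`, they have orders `0`, `2`, `3` and `4` in `t`. -/
theorem norm_qform_add_le (S : Finset ℤ) (y h : Coeff) :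
    ‖qform S (y + h) (y + h) (y + h) (y + h)‖ ≤ ‖qform S y y y y‖ +
      4 * (√(tripleNorm S y) * √(hNorm S h)) +
      (8 * (√Kσ * sNorm S y) + 16 * √(pairNorm S y)) * (√(hNorm S h) * aNorm S h) +
      (8 * √(mNorm S y) + 2 * √(mNorm S h)) * (√(hNorm S h) * aNorm S h ^ 2) := by
  have t1 := norm_qform_triple_le S y h
  have t2 : ‖qform S y h y y‖ ≤ √(tripleNorm S y) * √(hNorm S h) := by
    rw [norm_qform_conj]; exact t1
  have t3 := norm_qform_hhyy_le S y h
  have t4 : ‖qform S y y h h‖ ≤ 2 * (√Kσ * sNorm S y * √(hNorm S h) * aNorm S h) := by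
    rw [norm_qform_conj]; exact t3
  have t5 := norm_qform_yhyh_le S y h
  have t6 := norm_qform_hhhy_le S y h
  have t7 : ‖qform S h y h h‖ ≤ 2 * (√(hNorm S h) * √(mNorm S y) * aNorm S h ^ 2) := by
    rw [norm_qform_conj]; exact t6
  have t8 := norm_qform_hhhh_le S h
  rw [qform_add_expand]
  have tri : ∀ a b c d e f g k l : ℂ,
      ‖a + (2 * b + 2 * c) + (d + e) + 4 * f + (2 * g + 2 * k) + l‖ ≤
        ‖a‖ + (2 * ‖b‖ + 2 * ‖c‖) + (‖d‖ + ‖e‖) + 4 * ‖f‖ + (2 * ‖g‖ + 2 * ‖k‖) + ‖l‖ := by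
    intro a b c d e f g k l
    have n2 : ∀ z : ℂ, ‖2 * z‖ = 2 * ‖z‖ := fun z => by simp
    have n4 : ∀ z : ℂ, ‖4 * z‖ = 4 * ‖z‖ := fun z => by simp
    rw [← n2 b, ← n2 c, ← n4 f, ← n2 g, ← n2 k]
    refine (norm_add_le _ _).trans (add_le_add ?_ le_rfl)
    refine (norm_add_le _ _).trans (add_le_add ?_ (norm_add_le _ _))
    refine (norm_add_le _ _).trans (add_le_add ?_ le_rfl)
    refine (norm_add_le _ _).trans (add_le_add ?_ (norm_add_le _ _))
    exact (norm_add_le _ _).trans (add_le_add le_rfl (norm_add_le _ _))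
  refine (tri _ _ _ _ _ _ _ _ _).trans ?_
  linarith

/-! ### The remaining terms of the energy along shifts -/

theorem trig_add (S : Finset ℤ) (a b : Coeff) (x : ℝ) :
    trig S (a + b) x = trig S a x + trig S b x := by
  simp [trig, add_mul, Finset.sum_add_distrib]

theorem quartic_nonneg (f : ℝ → ℂ) : 0 ≤ quartic f :=
  intervalIntegral.integral_nonneg Real.two_pi_pos.le fun _ _ => by positivity

theorem quartic_trig_add_le (S : Finset ℤ) (a b : Coeff) :
    quartic (trig S (a + b)) ≤ 8 * (quartic (trig S a) + quartic (trig S b)) := by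
  unfold quartic
  rw [← intervalIntegral.integral_add (Continuous.intervalIntegrable (by fun_prop) _ _)
    (Continuous.intervalIntegrable (by fun_prop) _ _), ← intervalIntegral.integral_const_mul]
  refine intervalIntegral.integral_mono_on Real.two_pi_pos.le
    (Continuous.intervalIntegrable (by fun_prop) _ _)
    (Continuous.intervalIntegrable (by fun_prop) _ _) fun x _ => ?_
  rw [trig_add]
  calc _ ≤ (‖trig S a x‖ + ‖trig S b x‖) ^ 4 :=
        pow_le_pow_left₀ (norm_nonneg _) (norm_add_le _ _) 4
    _ ≤ _ := by
      have := add_pow_le (norm_nonneg (trig S a x)) (norm_nonneg (trig S b x)) 4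
      norm_num at this
      exact this

theorem quartic_trig_le_sNorm (S : Finset ℤ) (a : Coeff) :
    quartic (trig S a) ≤ 2 * Real.pi * (Kσ * sNorm S a ^ 2) :=
  (quartic_trig_le S a).trans
    (mul_le_mul_of_nonneg_left (sum_quads_le_wts S fun n => ‖a n‖) Real.two_pi_pos.le)

theorem quartic_trig_le_mNorm (S : Finset ℤ) (a : Coeff) :
    quartic (trig S a) ≤ 2 * Real.pi * (mNorm S a * aNorm S a ^ 2) := by
  refine (quartic_trig_le S a).trans (mul_le_mul_of_nonneg_left ?_ Real.two_pi_pos.le)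
  have := sum_quads_le_l2_l2_l1_l1 S (u := fun n => ‖a n‖) (v := fun n => ‖a n‖)
    (p := fun n => ‖a n‖) (q := fun n => ‖a n‖) (fun _ => norm_nonneg _) (fun _ => norm_nonneg _)
    (Real.sqrt_nonneg _) (Real.sqrt_nonneg _) (sum_norm_sq_le S a) (sum_norm_sq_le S a)
  rwa [Real.mul_self_sqrt (mNorm_nonneg S a), ← sq] at this

theorem mNorm_sub_le (S : Finset ℤ) (a b : Coeff) :
    mNorm S (a - b) ≤ 2 * mNorm S a + 2 * mNorm S b := by
  unfold mNorm
  rw [Finset.mul_sum, Finset.mul_sum, ← Finset.sum_add_distrib]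
  refine Finset.sum_le_sum fun n _ => ?_
  have h1 : ‖(a - b) n‖ ≤ ‖a n‖ + ‖b n‖ := norm_sub_le _ _
  nlinarith [norm_nonneg ((a - b) n), sq_nonneg (‖a n‖ - ‖b n‖)]

theorem abs_pSum_add_le (S : Finset ℤ) (y h : Coeff) :
    |pSum S (y + h)| ≤ |pSum S y| + 2 * (√(hNorm S h) * √(mNorm S y)) +
      √(hNorm S h) * √(mNorm S h) := by
  have b1 := sum_mul_le_of_sq_le S (f := fun n => |(n : ℝ)| * ‖h n‖) (g := fun n => ‖y n‖)
    (Real.sqrt_nonneg _) (Real.sqrt_nonneg _) (sum_abs_mul_norm_sq_le S h) (sum_norm_sq_le S y)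
  have b2 := sum_mul_le_of_sq_le S (f := fun n => |(n : ℝ)| * ‖h n‖) (g := fun n => ‖h n‖)
    (Real.sqrt_nonneg _) (Real.sqrt_nonneg _) (sum_abs_mul_norm_sq_le S h) (sum_norm_sq_le S h)
  have e : pSum S (y + h) = pSum S y + ∑ n ∈ S, (n : ℝ) * (‖y n + h n‖ ^ 2 - ‖y n‖ ^ 2) := by
    rw [pSum, pSum, ← Finset.sum_add_distrib]
    exact Finset.sum_congr rfl fun n _ => by simp only [Pi.add_apply]; ring
  rw [e, add_assoc]
  refine (abs_add_le _ _).trans (add_le_add le_rfl ?_)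
  calc _ ≤ ∑ n ∈ S, (2 * (|(n : ℝ)| * ‖h n‖ * ‖y n‖) + |(n : ℝ)| * ‖h n‖ * ‖h n‖) := by
        refine (Finset.abs_sum_le_sum_abs _ _).trans (Finset.sum_le_sum fun n _ => ?_)
        rw [abs_mul]
        have : |‖y n + h n‖ ^ 2 - ‖y n‖ ^ 2| ≤ 2 * (‖h n‖ * ‖y n‖) + ‖h n‖ * ‖h n‖ := by
          have h1 := norm_add_le (y n) (h n)
          have h2 := norm_sub_le (y n + h n) (h n)
          rw [add_sub_cancel_right] at h2
          have := norm_nonneg (y n)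
          have := norm_nonneg (h n)
          have := norm_nonneg (y n + h n)
          rw [abs_le]
          constructor <;> nlinarith
        have := mul_le_mul_of_nonneg_left this (abs_nonneg (n : ℝ))
        linarith
    _ ≤ _ := by
      rw [Finset.sum_add_distrib, ← Finset.mul_sum]
      linarith

/-- Young's inequality, split at `t = 16 C`: above it the first term wins, below it `t³ ≤ 4096 C³`.
-/
theorem mul_cube_le (C t : ℝ) (hC : 0 ≤ C) (ht : 0 ≤ t) :
    C * t ^ 3 ≤ t ^ 4 / 16 + 4096 * C ^ 4 := by
  rcases le_total t (16 * C) with h | h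
  · have : t ^ 3 ≤ (16 * C) ^ 3 := pow_le_pow_left₀ ht h 3
    nlinarith [pow_nonneg ht 4]
  · have : 0 ≤ t ^ 3 * (t - 16 * C) := mul_nonneg (by positivity) (by linarith)
    nlinarith [pow_nonneg hC 4]

/-- The bound on `y` needed to control `𝒩(y + h)` by the Cameron–Martin norm of `h`. -/
structure IsGood (S : Finset ℤ) (b A : ℝ) (y : Coeff) : Prop where
  mass_le : mNorm S y ≤ b ^ 2
  form_le : ‖qform S y y y y‖ ≤ A
  triple_le : √(tripleNorm S y) ≤ A
  pair_le : √(pairNorm S y) ≤ A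
  wts_le : sNorm S y ≤ A
  mom_le : |pSum S y| ≤ A

theorem neg_energyN_eq (N : ℕ) (a : Coeff) :
    -energyN N a = -(Real.pi / 2 * (qform (modes N) a a a a).re) +
      1 / 2 * (mNorm (modes N) a * quartic (trig (modes N) a)) +
      4 * Real.pi * (mNorm (modes N) a * pSum (modes N) a) -
      2 * Real.pi * mNorm (modes N) a ^ 3 := by
  have := Real.pi_pos
  unfold energyN energyExpr
  rw [trunc_eq_trig, mass_trig, momentum_trig, cubic_trig]
  unfold mNorm pSum
  field_simp
  ring

-- All estimates become polynomial in `t = ‖h‖_{H¹}^{1/2}`. Only the quartic form reaches degree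
-- four, with a coefficient proportional to `b²`; lower degrees are absorbed with constants
-- depending on `A` and `b`, but not on `N`.
set_option maxHeartbeats 1000000 in
theorem exists_neg_energyN_le {b A : ℝ} (hb : 0 < b) (hb' : b ≤ 1 / 60) (hA : 0 ≤ A) :
    ∃ C : ℝ, ∀ (N : ℕ) (y h : Coeff), IsGood (modes N) b A y → mNorm (modes N) (y + h) ≤ b ^ 2 →
      -energyN N (y + h) ≤ hNorm (modes N) h / 4 + C := by
  -- Both `y` and `y + h` have `L²` norm at most `b`, hence `h` at most `2b`, and Carlson's
  -- inequality gives an `ℓ¹` norm of at most `κ t` with `κ² = 10 · 2b`.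
  set κ := √(20 * b) with hκ
  have hκ2 : κ ^ 2 = 20 * b := Real.sq_sqrt (by positivity)
  have κ0 : 0 ≤ κ := Real.sqrt_nonneg _
  have K0 := Kσ_nonneg
  have pi0 := Real.pi_pos
  set C₃ := Real.pi / 2 * ((8 * (√Kσ * A) + 16 * A) * κ) with hC3
  set C₂ := Real.pi / 2 * (4 * A) + 8 * Real.pi * b ^ 2 * (80 * b ^ 3) +
    4 * Real.pi * b ^ 2 * (4 * b) with hC2
  set C₀ := Real.pi / 2 * A + 8 * Real.pi * b ^ 2 * (Kσ * A ^ 2) + 4 * Real.pi * b ^ 2 * A with hC0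
  have hC3' : 0 ≤ C₃ := by positivity
  refine ⟨C₀ + 4 * C₂ ^ 2 + 4096 * C₃ ^ 4, fun N y h hy hf => ?_⟩
  set S := modes N with hS
  set H := hNorm S h with hH
  have H0 : 0 ≤ H := hNorm_nonneg S h
  set t := √√H with ht
  have t0 : 0 ≤ t := Real.sqrt_nonneg _
  have ht2 : √H = t ^ 2 := (Real.sq_sqrt (Real.sqrt_nonneg _)).symm
  have ht4 : H = t ^ 4 := by
    rw [show t ^ 4 = (t ^ 2) ^ 2 by ring, ← ht2, Real.sq_sqrt H0]
  have hmy : √(mNorm S y) ≤ b := by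
    rw [Real.sqrt_le_left hb.le]; exact hy.mass_le
  have hmh' : mNorm S h ≤ 4 * b ^ 2 := by
    have := mNorm_sub_le S (y + h) y
    rw [add_sub_cancel_left] at this
    linarith [hy.mass_le]
  have hmh : √(mNorm S h) ≤ 2 * b := by
    rw [Real.sqrt_le_left (by positivity)]; linarith
  have ha0 := aNorm_nonneg S h
  have hl2 : aNorm S h ^ 2 ≤ 20 * b * t ^ 2 := by
    refine (carlson N fun n => ‖h n‖).trans ?_
    have : √(mNorm S h) * √H ≤ 2 * b * t ^ 2 := by
      rw [ht2]; exact mul_le_mul_of_nonneg_right hmh (by positivity)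
    calc _ = 10 * (√(mNorm S h) * √H) := rfl
      _ ≤ _ := by linarith
  have hl : aNorm S h ≤ κ * t := by
    refine abs_le_of_sq_le_sq' ?_ (by positivity) |>.2
    rw [mul_pow, hκ2]; exact hl2
  -- the quadrilinear form
  have hq : ‖qform S (y + h) (y + h) (y + h) (y + h)‖ ≤ A + 4 * A * t ^ 2 +
      (8 * (√Kσ * A) + 16 * A) * κ * t ^ 3 + 240 * b ^ 2 * t ^ 4 := by
    refine (norm_qform_add_le S y h).trans ?_
    rw [← hH, ht2]
    have s1 : √(tripleNorm S y) * t ^ 2 ≤ A * t ^ 2 :=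
      mul_le_mul_of_nonneg_right hy.triple_le (by positivity)
    have s2 : (8 * (√Kσ * sNorm S y) + 16 * √(pairNorm S y)) * (t ^ 2 * aNorm S h) ≤
        (8 * (√Kσ * A) + 16 * A) * (t ^ 2 * (κ * t)) := by
      have := hy.wts_le
      have := hy.pair_le
      gcongr
    have s3 : (8 * √(mNorm S y) + 2 * √(mNorm S h)) * (t ^ 2 * aNorm S h ^ 2) ≤
        (8 * b + 2 * (2 * b)) * (t ^ 2 * (20 * b * t ^ 2)) := by
      gcongr
    have := hy.form_le
    linarith
  -- the quartic term
  have hquart : quartic (trig S (y + h)) ≤ 16 * Real.pi * (Kσ * A ^ 2 + 80 * b ^ 3 * t ^ 2) := by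
    have q1 := quartic_trig_add_le S y h
    have q2 : quartic (trig S y) ≤ 2 * Real.pi * (Kσ * A ^ 2) :=
      (quartic_trig_le_sNorm S y).trans (by
        have := hy.wts_le
        have := sNorm_nonneg S y
        gcongr)
    have q3 : quartic (trig S h) ≤ 2 * Real.pi * ((4 * b ^ 2) * (20 * b * t ^ 2)) :=
      (quartic_trig_le_mNorm S h).trans (by gcongr)
    linarith
  have hp : |pSum S (y + h)| ≤ A + 4 * b * t ^ 2 := by
    refine (abs_pSum_add_le S y h).trans ?_
    rw [← hH, ht2]
    have := hy.mom_le
    have s1 : t ^ 2 * √(mNorm S y) ≤ t ^ 2 * b := by gcongr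
    have s2 : t ^ 2 * √(mNorm S h) ≤ t ^ 2 * (2 * b) := by gcongr
    linarith
  set m := mNorm S (y + h) with hm
  have m0 : 0 ≤ m := mNorm_nonneg _ _
  set q := quartic (trig S (y + h)) with hqd
  have q0 : 0 ≤ q := quartic_nonneg _
  set P := pSum S (y + h) with hP
  set Q := qform S (y + h) (y + h) (y + h) (y + h) with hQ
  have e : -energyN N (y + h) = -(Real.pi / 2 * Q.re) + 1 / 2 * (m * q) + 4 * Real.pi * (m * P) -
      2 * Real.pi * m ^ 3 :=
    neg_energyN_eq N (y + h)
  clear_value m q P Q t κ C₀ C₂ C₃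
  have i1 : -(Real.pi / 2 * Q.re) ≤ Real.pi / 2 * (A + 4 * A * t ^ 2 +
      (8 * (√Kσ * A) + 16 * A) * κ * t ^ 3 + 240 * b ^ 2 * t ^ 4) := by
    have := (neg_le_abs Q.re).trans ((Complex.abs_re_le_norm Q).trans hq)
    have := mul_le_mul_of_nonneg_left this (by positivity : 0 ≤ Real.pi / 2)
    linarith
  have i2 : m * q ≤ b ^ 2 * (16 * Real.pi * (Kσ * A ^ 2 + 80 * b ^ 3 * t ^ 2)) := by gcongr
  have i3 : m * P ≤ b ^ 2 * (A + 4 * b * t ^ 2) := by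
    have := (le_abs_self P).trans hp
    calc m * P ≤ m * (A + 4 * b * t ^ 2) := mul_le_mul_of_nonneg_left this m0
      _ ≤ _ := by gcongr
  have i3' := mul_le_mul_of_nonneg_left i3 (by positivity : 0 ≤ 4 * Real.pi)
  -- The sextic term has the favourable sign and is dropped.
  have i4 : 0 ≤ 2 * Real.pi * m ^ 3 := by positivity
  -- The role of `b ≤ 1/60`: it makes `120 π b² ≤ 1/8`. The cubic and quadratic terms take `1/16`
  -- each, for a total of `1/4`.
  have i5 : Real.pi / 2 * (240 * b ^ 2 * t ^ 4) ≤ t ^ 4 / 8 := by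
    have hb2 : b ^ 2 ≤ (1 / 60) ^ 2 := pow_le_pow_left₀ hb.le hb' 2
    have : Real.pi * b ^ 2 ≤ 3.15 * (1 / 60) ^ 2 := by
      have := Real.pi_lt_d2
      gcongr
    have t4 : 0 ≤ t ^ 4 := by positivity
    have := mul_le_mul_of_nonneg_right this t4
    linarith
  have i6 := mul_cube_le C₃ t hC3' t0
  have i7 : C₂ * t ^ 2 ≤ t ^ 4 / 16 + 4 * C₂ ^ 2 := by
    nlinarith [sq_nonneg (t ^ 2 / 4 - 2 * C₂)]
  have hsum : -energyN N (y + h) ≤ C₀ + C₂ * t ^ 2 + C₃ * t ^ 3 +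
      Real.pi / 2 * (240 * b ^ 2 * t ^ 4) := by
    rw [e, hC0, hC2, hC3]
    linarith
  rw [ht4]
  linarith

/-! ### The law of a single mode -/

instance : IsProbabilityMeasure wiener := by unfold wiener; infer_instance

theorem measurePreserving_withDensity {α β : Type*} [MeasurableSpace α] [MeasurableSpace β]
    {μ : Measure α} {ν : Measure β} {T : α → β} (hT : MeasurePreserving T μ ν) {f : β → ℝ≥0∞}
    (hf : Measurable f) :
    MeasurePreserving T (μ.withDensity fun x => f (T x)) (ν.withDensity f) := by
  refine ⟨hT.measurable, ?_⟩
  ext s hs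
  rw [Measure.map_apply hT.measurable hs, withDensity_apply _ (hT.measurable hs),
    withDensity_apply _ hs, hT.setLIntegral_comp_preimage hs hf]

/-- The density of `modeLaw n`. -/
def modePDF (n : ℤ) (z : ℂ) : ℝ := wt n / (2 * Real.pi) * Real.exp (-(1 / 2) * (wt n * ‖z‖ ^ 2))

theorem modePDF_pos (n : ℤ) (z : ℂ) : 0 < modePDF n z := by
  have := wt_pos n
  have := Real.pi_pos
  unfold modePDF; positivity

@[fun_prop]
theorem measurable_modePDF (n : ℤ) : Measurable (modePDF n) := by
  unfold modePDF; fun_prop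

theorem modeLaw_eq_withDensity (n : ℤ) :
    modeLaw n = volume.withDensity fun z => ENNReal.ofReal (modePDF n z) := by
  have hv : ((1 + (n.natAbs : ℝ≥0) ^ 2)⁻¹ : ℝ≥0) ≠ 0 := by positivity
  have hv' : (((1 + (n.natAbs : ℝ≥0) ^ 2)⁻¹ : ℝ≥0) : ℝ) = (wt n)⁻¹ := by
    simp [wt, Nat.cast_natAbs]
  have hT := (Complex.volume_preserving_equiv_real_prod.symm Complex.measurableEquivRealProd)
  have := (measurePreserving_withDensity hT
    (f := fun z => ENNReal.ofReal (modePDF n z)) (by fun_prop)).map_eq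
  rw [← this, modeLaw, gaussianReal_of_var_ne_zero _ hv,
    prod_withDensity (measurable_gaussianPDF _ _) (measurable_gaussianPDF _ _)]
  congr 1
  change Measure.withDensity volume _ = _
  congr 1
  funext p
  have w := wt_pos n
  have pi0 := Real.pi_pos
  simp only [gaussianPDF, gaussianPDFReal, hv', sub_zero]
  rw [← ENNReal.ofReal_mul (by positivity), mul_mul_mul_comm, ← Real.exp_add, modePDF]
  congr 2
  · rw [← mul_inv, Real.mul_self_sqrt (by positivity)]; field_simp
  · congr 1
    rw [← Complex.normSq_eq_norm_sq, Complex.normSq_apply]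
    simp [Complex.measurableEquivRealProd]
    field_simp
    ring

/-- The density depends on `‖z‖` only. This invariance is the source of all orthogonality relations
for products of modes. -/
theorem measurePreserving_rotate_modeLaw (n : ℤ) {u : ℂ} (hu : ‖u‖ = 1) :
    MeasurePreserving (fun z => u * z) (modeLaw n) (modeLaw n) := by
  have hT : MeasurePreserving (fun z : ℂ => u * z) volume volume := by
    have := (rotation ⟨u, by simp [Submonoid.unitSphere, hu]⟩).measurePreserving
    exact this
  have := measurePreserving_withDensity hT (f := fun z => ENNReal.ofReal (modePDF n z))
    (by fun_prop)
  rw [modeLaw_eq_withDensity]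
  simpa [modePDF, hu] using this

theorem modeLaw_eq_map (n : ℤ) :
    modeLaw n = (modeLaw 0).map fun z => (((√(wt n))⁻¹ : ℝ) : ℂ) * z := by
  set c : ℝ := (√(wt n))⁻¹ with hc
  have h1 : gaussianReal 0 ((1 + (n.natAbs : ℝ≥0) ^ 2)⁻¹) = (gaussianReal 0 1).map (c * ·) := by
    rw [gaussianReal_map_const_mul]
    congr 1
    · simp
    · ext
      have h2 : ((√(wt n))⁻¹) ^ 2 = (wt n)⁻¹ := by rw [inv_pow, Real.sq_sqrt (wt_pos n).le]
      simp only [hc, NNReal.coe_mul, NNReal.coe_mk, h2]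
      simp [wt, Nat.cast_natAbs]
  unfold modeLaw
  rw [h1, Measure.map_prod_map _ _ (by fun_prop) (by fun_prop), Measure.map_map
    (MeasurableEquiv.measurable _) (by fun_prop), Measure.map_map (by fun_prop)
    (MeasurableEquiv.measurable _)]
  simp only [Int.natAbs_zero, Nat.cast_zero, ne_eq, OfNat.ofNat_ne_zero, not_false_eq_true,
    zero_pow, add_zero, inv_one]
  congr 1
  funext p
  apply Complex.ext <;> simp [Complex.measurableEquivRealProd]

theorem memLp_id_modeLaw_zero {p : ℝ≥0∞} (hp : p ≠ ⊤) : MemLp id p (modeLaw 0) := by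
  have hT : MeasurePreserving Complex.measurableEquivRealProd.symm
    ((gaussianReal 0 (1 + ((0 : ℤ).natAbs : ℝ≥0) ^ 2)⁻¹).prod
    (gaussianReal 0 (1 + ((0 : ℤ).natAbs : ℝ≥0) ^ 2)⁻¹)) (modeLaw 0) :=
    ⟨MeasurableEquiv.measurable _, rfl⟩
  rw [← hT.map_eq, memLp_map_measure_iff (by fun_prop) (MeasurableEquiv.measurable _).aemeasurable]
  have h1 := (memLp_id_gaussianReal' (μ := 0) (v := (1 + ((0 : ℤ).natAbs : ℝ≥0) ^ 2)⁻¹) p hp)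
  have h2 := h1.comp_measurePreserving (measurePreserving_fst (ν := gaussianReal 0
    (1 + ((0 : ℤ).natAbs : ℝ≥0) ^ 2)⁻¹))
  have h3 := h1.comp_measurePreserving (measurePreserving_snd (μ := gaussianReal 0
    (1 + ((0 : ℤ).natAbs : ℝ≥0) ^ 2)⁻¹))
  refine MemLp.mono' (h2.norm.add h3.norm)
    (MeasurableEquiv.measurable _).aestronglyMeasurable (ae_of_all _ fun p => ?_)
  refine (Complex.norm_le_abs_re_add_abs_im _).trans ?_
  simp [Complex.measurableEquivRealProd]

/-- All modes are rescalings of the zeroth, so moment bounds for that one are uniform in `n`. -/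
theorem measurePreserving_scaled (n : ℤ) :
    MeasurePreserving (fun a : Coeff => ((√(wt n) : ℝ) : ℂ) * a n) wiener (modeLaw 0) := by
  refine ⟨by fun_prop, ?_⟩
  have h1 := (measurePreserving_eval_infinitePi modeLaw n).map_eq
  have h2 : (fun a : Coeff => ((√(wt n) : ℝ) : ℂ) * a n) =
      (fun z => ((√(wt n) : ℝ) : ℂ) * z) ∘ Function.eval n := rfl
  rw [h2, ← Measure.map_map (by fun_prop) (by fun_prop), wiener, h1, modeLaw_eq_map n,
    Measure.map_map (by fun_prop) (by fun_prop)]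
  have h3 : ((fun z => ((√(wt n) : ℝ) : ℂ) * z) ∘ fun z => (((√(wt n))⁻¹ : ℝ) : ℂ) * z) = id := by
    funext z
    have : √(wt n) ≠ 0 := (Real.sqrt_pos.2 (wt_pos n)).ne'
    have : ((√(wt n) : ℝ) : ℂ) ≠ 0 := by exact_mod_cast this
    simp [this]
  rw [h3, Measure.map_id]

/-! ### Functions with all moments -/

/-- All moments are finite. -/
def AllLp {E : Type*} [NormedAddCommGroup E] (f : Coeff → E) : Prop :=
  ∀ p : ℝ≥0∞, p ≠ ⊤ → MemLp f p wiener

namespace AllLp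

theorem coord (n : ℤ) : AllLp fun a : Coeff => a n := by
  intro p hp
  have h := ((memLp_id_modeLaw_zero hp).comp_measurePreserving
    (measurePreserving_scaled n)).const_mul (((√(wt n))⁻¹ : ℝ) : ℂ)
  refine h.ae_eq (ae_of_all _ fun a => ?_)
  have : √(wt n) ≠ 0 := (Real.sqrt_pos.2 (wt_pos n)).ne'
  have : ((√(wt n) : ℝ) : ℂ) ≠ 0 := by exact_mod_cast this
  simp [this]

theorem const {E : Type*} [NormedAddCommGroup E] (c : E) : AllLp fun _ : Coeff => c :=
  fun _ _ => memLp_const c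

theorem add {E : Type*} [NormedAddCommGroup E] {f g : Coeff → E} (hf : AllLp f) (hg : AllLp g) :
    AllLp fun a => f a + g a := fun p hp => (hf p hp).add (hg p hp)

theorem sub {E : Type*} [NormedAddCommGroup E] {f g : Coeff → E} (hf : AllLp f) (hg : AllLp g) :
    AllLp fun a => f a - g a := fun p hp => (hf p hp).sub (hg p hp)

theorem sum {E ι : Type*} [NormedAddCommGroup E] {f : ι → Coeff → E} (s : Finset ι)
    (hf : ∀ i ∈ s, AllLp (f i)) : AllLp fun a => ∑ i ∈ s, f i a :=
  fun p hp => memLp_finsetSum s fun i hi => hf i hi p hp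

theorem norm {E : Type*} [NormedAddCommGroup E] {f : Coeff → E} (hf : AllLp f) :
    AllLp fun a => ‖f a‖ := fun p hp => (hf p hp).norm

theorem star {f : Coeff → ℂ} (hf : AllLp f) : AllLp fun a => conj (f a) :=
  fun p hp => (hf p hp).star

theorem re {f : Coeff → ℂ} (hf : AllLp f) : AllLp fun a => (f a).re :=
  fun p hp => (hf p hp).re

theorem mul {R : Type*} [NormedRing R] {f g : Coeff → R} (hf : AllLp f) (hg : AllLp g) :
    AllLp fun a => f a * g a := by
  intro p hp
  have : ENNReal.HolderTriple (2 * p) (2 * p) p := ⟨by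
    rw [ENNReal.mul_inv (by simp) (by simp), ← add_mul, ENNReal.inv_two_add_inv_two, one_mul]⟩
  exact (hg (2 * p) (ENNReal.mul_ne_top (by simp) hp)).mul'
    (hf (2 * p) (ENNReal.mul_ne_top (by simp) hp))

theorem pow {R : Type*} [NormedRing R] {f : Coeff → R} (hf : AllLp f) (k : ℕ) :
    AllLp fun a => f a ^ k := by
  induction k with
  | zero => simpa using const (1 : R)
  | succ k ih => simpa [pow_succ] using ih.mul hf

theorem const_mul {R : Type*} [NormedRing R] {f : Coeff → R} (c : R) (hf : AllLp f) :
    AllLp fun a => c * f a := (const c).mul hf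

theorem integrable {E : Type*} [NormedAddCommGroup E] {f : Coeff → E} (hf : AllLp f) :
    Integrable f wiener := memLp_one_iff_integrable.1 (hf 1 (by simp))

theorem norm_sq {E : Type*} [NormedAddCommGroup E] {f : Coeff → E} (hf : AllLp f) :
    AllLp fun a => ‖f a‖ ^ 2 := hf.norm.pow 2

end AllLp

/-- A bound for the eighth moment of a normalized mode. -/
def momentBound : ℝ := ∫ z, ‖z‖ ^ 8 ∂modeLaw 0 + 1

theorem one_le_momentBound : 1 ≤ momentBound := by
  have : 0 ≤ ∫ z, ‖z‖ ^ 8 ∂modeLaw 0 := integral_nonneg fun _ => by positivity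
  unfold momentBound; linarith

/-- The normalized square `(1 + n²)|v̂ₙ|²`. -/
def nsq (n : ℤ) (a : Coeff) : ℝ := wt n * ‖a n‖ ^ 2

theorem nsq_nonneg (n : ℤ) (a : Coeff) : 0 ≤ nsq n a := mul_nonneg (wt_pos n).le (sq_nonneg _)

theorem norm_sq_eq_nsq (n : ℤ) (a : Coeff) : ‖a n‖ ^ 2 = (wt n)⁻¹ * nsq n a := by
  have := (wt_pos n).ne'
  unfold nsq; field_simp

theorem AllLp.nsq (n : ℤ) : AllLp (nsq n) := (AllLp.coord n).norm_sq.const_mul _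

theorem integral_nsq_pow_four_le (n : ℤ) : ∫ a, nsq n a ^ 4 ∂wiener ≤ momentBound := by
  have e : ∀ a : Coeff, nsq n a ^ 4 = ‖((√(wt n) : ℝ) : ℂ) * a n‖ ^ 8 := by
    intro a
    rw [norm_mul, Complex.norm_real, Real.norm_of_nonneg (Real.sqrt_nonneg _), nsq, mul_pow,
      mul_pow, show √(wt n) ^ 8 = (√(wt n) ^ 2) ^ 4 by ring, Real.sq_sqrt (wt_pos n).le]
    ring
  simp_rw [e]
  rw [← integral_map (φ := fun a : Coeff => ((√(wt n) : ℝ) : ℂ) * a n)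
    (f := fun z : ℂ => ‖z‖ ^ 8) (measurePreserving_scaled n).measurable.aemeasurable
    (by fun_prop), (measurePreserving_scaled n).map_eq]
  unfold momentBound; linarith

theorem mul_four_le (x y z w : ℝ) :
    x * y * z * w ≤ (x ^ 4 + y ^ 4 + z ^ 4 + w ^ 4) / 4 := by
  nlinarith [sq_nonneg (x * y - z * w), sq_nonneg (x ^ 2 - y ^ 2), sq_nonneg (z ^ 2 - w ^ 2)]

/-- The mean inequality makes independence superfluous, and coinciding indices are covered as well.
-/
theorem integral_mul_four_le {x y z w : Coeff → ℝ} (hx : AllLp x) (hy : AllLp y) (hz : AllLp z)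
    (hw : AllLp w) {C : ℝ} (hx4 : ∫ a, x a ^ 4 ∂wiener ≤ C) (hy4 : ∫ a, y a ^ 4 ∂wiener ≤ C)
    (hz4 : ∫ a, z a ^ 4 ∂wiener ≤ C) (hw4 : ∫ a, w a ^ 4 ∂wiener ≤ C) :
    ∫ a, x a * y a * z a * w a ∂wiener ≤ C := by
  have h2 := (hx.pow 4).add (hy.pow 4)
  have h3 := h2.add (hz.pow 4)
  have h4 := h3.add (hw.pow 4)
  calc _ ≤ ∫ a, (x a ^ 4 + y a ^ 4 + z a ^ 4 + w a ^ 4) / 4 ∂wiener :=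
        integral_mono (((hx.mul hy).mul hz).mul hw).integrable (h4.integrable.div_const 4)
          fun a => mul_four_le _ _ _ _
    _ = (∫ a, x a ^ 4 ∂wiener + ∫ a, y a ^ 4 ∂wiener + ∫ a, z a ^ 4 ∂wiener +
          ∫ a, w a ^ 4 ∂wiener) / 4 := by
        rw [integral_div, integral_add h3.integrable (hw.pow 4).integrable,
          integral_add h2.integrable (hz.pow 4).integrable,
          integral_add (hx.pow 4).integrable (hy.pow 4).integrable]
    _ ≤ _ := by linarith

/-- The summand `1` in `momentBound` lets constants replace missing factors in
`integral_mul_four_le`. -/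
theorem integral_one_pow_four_le : ∫ _a, (1 : ℝ) ^ 4 ∂wiener ≤ momentBound := by
  simpa using one_le_momentBound

theorem integral_nsq_four_le (i j k l : ℤ) :
    ∫ a, nsq i a * nsq j a * nsq k a * nsq l a ∂wiener ≤ momentBound :=
  integral_mul_four_le (AllLp.nsq i) (AllLp.nsq j) (AllLp.nsq k) (AllLp.nsq l)
    (integral_nsq_pow_four_le _) (integral_nsq_pow_four_le _) (integral_nsq_pow_four_le _)
    (integral_nsq_pow_four_le _)

theorem integral_nsq_three_le (i j k : ℤ) :
    ∫ a, nsq i a * nsq j a * nsq k a ∂wiener ≤ momentBound := by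
  simpa using integral_mul_four_le (AllLp.nsq i) (AllLp.nsq j) (AllLp.nsq k) (AllLp.const 1)
    (integral_nsq_pow_four_le _) (integral_nsq_pow_four_le _) (integral_nsq_pow_four_le _)
    integral_one_pow_four_le

theorem integral_nsq_two_le (i j : ℤ) :
    ∫ a, nsq i a * nsq j a ∂wiener ≤ momentBound := by
  simpa using integral_mul_four_le (AllLp.nsq i) (AllLp.nsq j) (AllLp.const 1) (AllLp.const 1)
    (integral_nsq_pow_four_le _) (integral_nsq_pow_four_le _) integral_one_pow_four_le
    integral_one_pow_four_le

theorem integral_nsq_le (i : ℤ) : ∫ a, nsq i a ∂wiener ≤ momentBound := by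
  simpa using integral_mul_four_le (AllLp.nsq i) (AllLp.const 1) (AllLp.const 1) (AllLp.const 1)
    (integral_nsq_pow_four_le _) integral_one_pow_four_le integral_one_pow_four_le
    integral_one_pow_four_le

/-! ### Charges -/

/-- Multiplication of the `n`-th coefficient by `u`. -/
def rot (n : ℤ) (u : ℂ) (a : Coeff) : Coeff := fun m => (if m = n then u else 1) * a m

theorem measurePreserving_rot (n : ℤ) {u : ℂ} (hu : ‖u‖ = 1) :
    MeasurePreserving (rot n u) wiener wiener := by
  refine ⟨by unfold rot; fun_prop, ?_⟩
  have := Measure.infinitePi_map_pi modeLaw (f := fun m z => (if m = n then u else 1) * z)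
    (fun m => by fun_prop)
  unfold wiener
  refine this.trans ?_
  congr 1
  funext m
  exact (measurePreserving_rotate_modeLaw m (by split_ifs <;> simp [hu])).map_eq

/-- `f` is homogeneous of degree `c n` under rotations of the `n`-th coefficient. -/
structure HasCharge (f : Coeff → ℂ) (c : ℤ → ℤ) : Prop where
  allLp : AllLp f
  rot : ∀ n (u : ℂ), ‖u‖ = 1 → ∀ a, f (rot n u a) = u ^ c n * f a

namespace HasCharge

theorem coord (k : ℤ) : HasCharge (fun a => a k) fun n => if k = n then 1 else 0 := by
  refine ⟨AllLp.coord k, fun n u _ a => ?_⟩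
  simp only [WeightedWiener.rot]
  split_ifs <;> simp

theorem mul {f g : Coeff → ℂ} {c d : ℤ → ℤ} (hf : HasCharge f c) (hg : HasCharge g d) :
    HasCharge (fun a => f a * g a) fun n => c n + d n := by
  refine ⟨hf.allLp.mul hg.allLp, fun n u hu a => ?_⟩
  have : u ≠ 0 := by rintro rfl; simp at hu
  rw [hf.rot n u hu, hg.rot n u hu, zpow_add₀ this]; ring

theorem star {f : Coeff → ℂ} {c : ℤ → ℤ} (hf : HasCharge f c) :
    HasCharge (fun a => conj (f a)) fun n => -c n := by
  refine ⟨hf.allLp.star, fun n u hu a => ?_⟩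
  rw [hf.rot n u hu, map_mul, map_zpow₀, zpow_neg, ← inv_zpow, Complex.inv_eq_conj hu]

theorem const_mul {f : Coeff → ℂ} {c : ℤ → ℤ} (z : ℂ) (hf : HasCharge f c) :
    HasCharge (fun a => z * f a) c := by
  refine ⟨hf.allLp.const_mul z, fun n u hu a => ?_⟩
  rw [hf.rot n u hu]; ring

/-- At a mode where the charges differ by `k ≠ 0`, rotation by `exp(iπ/k)` preserves `ρ` and
multiplies the integrand by `-1`. -/
theorem integral_mul_conj_eq_zero {f g : Coeff → ℂ} {c d : ℤ → ℤ} (hf : HasCharge f c)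
    (hg : HasCharge g d) (h : c ≠ d) :
    ∫ a, f a * (starRingEnd ℂ) (g a) ∂wiener = 0 := by
  obtain ⟨n, hn⟩ := Function.ne_iff.1 h
  have hF := hf.mul hg.star
  set k : ℤ := c n + -d n with hk
  have hk0 : (k : ℂ) ≠ 0 := by
    have : k ≠ 0 := by omega
    exact_mod_cast this
  set u : ℂ := Complex.exp ((Real.pi / k : ℝ) * Complex.I) with hu
  have hu1 : ‖u‖ = 1 := Complex.norm_exp_ofReal_mul_I _
  have huk : u ^ k = -1 := by
    rw [hu, ← Complex.exp_int_mul, ← Complex.exp_pi_mul_I]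
    congr 1
    push_cast
    field_simp
  have hmp := measurePreserving_rot n hu1
  have e1 : ∫ a, f a * (starRingEnd ℂ) (g a) ∂wiener =
      ∫ a, f (WeightedWiener.rot n u a) * (starRingEnd ℂ) (g (WeightedWiener.rot n u a)) ∂wiener := by
    conv_lhs => rw [← hmp.map_eq]
    rw [integral_map hmp.measurable.aemeasurable]
    rw [hmp.map_eq]
    exact hF.allLp.integrable.aestronglyMeasurable
  simp_rw [hF.rot n u hu1] at e1
  rw [integral_const_mul, ← hk, huk] at e1
  linear_combination (1 / 2 : ℂ) * e1

end HasCharge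

/-- Almost orthogonality: expanding the square, terms of different charge drop out, at most `K`
terms share a charge, and the surviving products are bounded by half sums of squares. -/
theorem integral_norm_sq_sum_le {ι : Type*} [DecidableEq ι] (T : Finset ι) (f : ι → Coeff → ℂ)
    (c : ι → ℤ → ℤ) (hf : ∀ t ∈ T, HasCharge (f t) (c t)) (K : ℕ)
    (hK : ∀ t ∈ T, ∃ s : Finset ι, s.card ≤ K ∧ ∀ t' ∈ T, c t' = c t → t' ∈ s) :
    ∫ a, ‖∑ t ∈ T, f t a‖ ^ 2 ∂wiener ≤ K * ∑ t ∈ T, ∫ a, ‖f t a‖ ^ 2 ∂wiener := by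
  classical
  have hfint : ∀ t ∈ T, ∀ s ∈ T, AllLp fun a => f t a * conj (f s a) := fun t ht s hs =>
    (hf t ht).allLp.mul (hf s hs).allLp.star
  set e : ι → ℝ := fun t => ∫ a, ‖f t a‖ ^ 2 ∂wiener with he
  have e0 : ∀ t, 0 ≤ e t := fun t => integral_nonneg fun _ => sq_nonneg _
  have h1 : ∀ a, ‖∑ t ∈ T, f t a‖ ^ 2 = ∑ t ∈ T, ∑ s ∈ T, (f t a * conj (f s a)).re := by
    intro a
    have := Complex.mul_conj (∑ t ∈ T, f t a)
    rw [Complex.normSq_eq_norm_sq, map_sum, Finset.sum_mul_sum] at this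
    have := congrArg Complex.re this
    rw [Complex.ofReal_re] at this
    rw [← this]
    simp only [Complex.re_sum]
  simp_rw [h1]
  rw [integral_finsetSum _ fun t ht => integrable_finsetSum _ fun s hs => (hfint t ht s hs).re.integrable]
  have h2 : ∀ t ∈ T, ∀ s ∈ T, ∫ a, (f t a * conj (f s a)).re ∂wiener ≤
      if c s = c t then (e t + e s) / 2 else 0 := by
    intro t ht s hs
    split_ifs with hcs
    · have : (e t + e s) / 2 = ∫ a, (‖f t a‖ ^ 2 + ‖f s a‖ ^ 2) / 2 ∂wiener := by
        rw [integral_div, integral_add (hf t ht).allLp.norm_sq.integrable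
          (hf s hs).allLp.norm_sq.integrable]
      rw [this]
      refine integral_mono (hfint t ht s hs).re.integrable
        (((hf t ht).allLp.norm_sq.integrable.add
          (hf s hs).allLp.norm_sq.integrable).div_const 2) fun a => ?_
      have h3 := Complex.re_le_norm (f t a * conj (f s a))
      rw [norm_mul, RCLike.norm_conj] at h3
      have := sq_nonneg (‖f t a‖ - ‖f s a‖)
      nlinarith
    · have h3 := (hf t ht).integral_mul_conj_eq_zero (hf s hs) (Ne.symm hcs)
      have h4 := integral_re (𝕜 := ℂ) (hfint t ht s hs).integrable
      simp only [RCLike.re_to_complex] at h4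
      rw [h4, h3]; simp
  calc _ ≤ ∑ t ∈ T, ∑ s ∈ T, if c s = c t then (e t + e s) / 2 else 0 := by
        refine Finset.sum_le_sum fun t ht => ?_
        rw [integral_finsetSum _ fun s hs => (hfint t ht s hs).re.integrable]
        exact Finset.sum_le_sum fun s hs => h2 t ht s hs
    _ = ∑ t ∈ T, ∑ s ∈ T, if c s = c t then e t else 0 := by
        have h5 : ∑ t ∈ T, ∑ s ∈ T, (if c s = c t then e s else 0) =
            ∑ t ∈ T, ∑ s ∈ T, if c s = c t then e t else 0 := by
          rw [Finset.sum_comm]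
          simp only [eq_comm]
        have h6 : ∀ t s, (if c s = c t then (e t + e s) / 2 else 0) =
            1 / 2 * (if c s = c t then e t else 0) + 1 / 2 * (if c s = c t then e s else 0) := by
          intro t s; split_ifs <;> ring
        simp_rw [h6, Finset.sum_add_distrib, ← Finset.mul_sum]
        rw [h5]; ring
    _ ≤ ∑ t ∈ T, K * e t := by
        refine Finset.sum_le_sum fun t ht => ?_
        rw [← Finset.sum_filter, Finset.sum_const, nsmul_eq_mul]
        obtain ⟨s, hs, hs'⟩ := hK t ht
        refine mul_le_mul_of_nonneg_right ?_ (e0 t)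
        have : (T.filter fun t' => c t' = c t).card ≤ s.card := Finset.card_le_card fun t' ht' =>
          hs' t' (Finset.mem_filter.1 ht').1 (Finset.mem_filter.1 ht').2
        exact_mod_cast this.trans hs
    _ = _ := by rw [Finset.mul_sum]

/-! ### Off-diagonal and diagonal parts -/

/-- The quadruples without pairings. -/
def wick (S : Finset ℤ) : Finset (ℤ × ℤ × ℤ × ℤ) :=
  (quads S).filter fun q => q.2.2.1 ≠ q.1 ∧ q.2.2.1 ≠ q.2.1

theorem wick_mono {S T : Finset ℤ} (h : S ⊆ T) : wick S ⊆ wick T := by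
  intro q hq
  simp only [wick, Finset.mem_filter, mem_quads] at hq ⊢
  exact ⟨⟨⟨h hq.1.1.1, h hq.1.1.2.1, h hq.1.1.2.2.1, h hq.1.1.2.2.2⟩, hq.1.2⟩, hq.2⟩

/-- Inclusion–exclusion: if `n₃ = n₁` or `n₃ = n₂`, the relation forces `n₄` to be the other
frequency, and both happen exactly when all four coincide. -/
theorem sum_quads_eq_wick_add {M : Type*} [AddCommGroup M] (S : Finset ℤ)
    (F : ℤ × ℤ × ℤ × ℤ → M) :
    ∑ q ∈ quads S, F q = ∑ q ∈ wick S, F q + ∑ p ∈ S ×ˢ S, F (p.1, p.2, p.1, p.2) +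
      ∑ p ∈ S ×ˢ S, F (p.1, p.2, p.2, p.1) - ∑ n ∈ S, F (n, n, n, n) := by
  have e1 : ∑ p ∈ S ×ˢ S, F (p.1, p.2, p.1, p.2) =
      ∑ q ∈ (quads S).filter fun q => q.2.2.1 = q.1, F q := by
    refine Finset.sum_nbij' (fun p => (p.1, p.2, p.1, p.2)) (fun q => (q.1, q.2.1)) ?_ ?_ ?_ ?_ ?_
    · intro p hp; simp only [Finset.mem_filter, mem_quads, Finset.mem_product] at hp ⊢; simp [hp]
    · intro q hq; simp only [Finset.mem_filter, mem_quads, Finset.mem_product] at hq ⊢; simp [hq]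
    · intro p _; rfl
    · rintro ⟨a, b, c, d⟩ hq
      simp only [Finset.mem_filter, mem_quads, Prod.mk.injEq] at hq ⊢
      obtain ⟨⟨_, h1⟩, h2⟩ := hq
      refine ⟨?_, ?_, ?_, ?_⟩ <;> first | trivial | rfl | omega
    · intro p _; rfl
  have e2 : ∑ p ∈ S ×ˢ S, F (p.1, p.2, p.2, p.1) =
      ∑ q ∈ (quads S).filter fun q => q.2.2.1 = q.2.1, F q := by
    refine Finset.sum_nbij' (fun p => (p.1, p.2, p.2, p.1)) (fun q => (q.1, q.2.1)) ?_ ?_ ?_ ?_ ?_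
    · intro p hp
      simp only [Finset.mem_filter, mem_quads, Finset.mem_product] at hp ⊢; simp [hp, add_comm]
    · intro q hq; simp only [Finset.mem_filter, mem_quads, Finset.mem_product] at hq ⊢; simp [hq]
    · intro p _; rfl
    · rintro ⟨a, b, c, d⟩ hq
      simp only [Finset.mem_filter, mem_quads, Prod.mk.injEq] at hq ⊢
      obtain ⟨⟨_, h1⟩, h2⟩ := hq
      refine ⟨?_, ?_, ?_, ?_⟩ <;> first | trivial | rfl | omega
    · intro p _; rfl
  have e3 : ∑ n ∈ S, F (n, n, n, n) =
      ∑ q ∈ (quads S).filter fun q => q.2.2.1 = q.1 ∧ q.2.2.1 = q.2.1, F q := by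
    refine Finset.sum_nbij' (fun n => (n, n, n, n)) (fun q => q.1) ?_ ?_ ?_ ?_ ?_
    · intro p hp; simp only [Finset.mem_filter, mem_quads] at hp ⊢; simp [hp]
    · intro q hq; simp only [Finset.mem_filter, mem_quads] at hq ⊢; simp [hq]
    · intro p _; rfl
    · rintro ⟨a, b, c, d⟩ hq
      simp only [Finset.mem_filter, mem_quads, Prod.mk.injEq] at hq ⊢
      obtain ⟨⟨_, h1⟩, h2⟩ := hq
      refine ⟨?_, ?_, ?_, ?_⟩ <;> first | trivial | rfl | omega
    · intro p _; rfl
  rw [e1, e2, e3, wick]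
  simp only [Finset.sum_filter]
  rw [← Finset.sum_add_distrib, ← Finset.sum_add_distrib, ← Finset.sum_sub_distrib]
  refine Finset.sum_congr rfl fun q _ => ?_
  by_cases h1 : q.2.2.1 = q.1 <;> by_cases h2 : q.2.2.1 = q.2.1 <;> simp [h1, h2]

/-- The off-diagonal part of `qform`. -/
def wickForm (S : Finset ℤ) (a : Coeff) : ℂ :=
  ∑ q ∈ wick S, ((q.1 : ℂ) + q.2.1) * (a q.1 * a q.2.1 * conj (a q.2.2.1) * conj (a q.2.2.2))

/-- The off-diagonal part of `tripleCoeff`. -/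
def wickTriple (S : Finset ℤ) (a : Coeff) (k : ℤ) : ℂ :=
  ∑ q ∈ (wick S).filter (fun q => q.2.2.2 = k),
    ((q.1 : ℂ) + q.2.1) * (a q.1 * a q.2.1 * conj (a q.2.2.1))

theorem mul_conj_eq (z : ℂ) : z * conj z = (‖z‖ : ℂ) ^ 2 := by
  rw [Complex.mul_conj, Complex.normSq_eq_norm_sq]; push_cast; rfl

/-- The paired terms have charge zero, so rotations give no cancellation among them. They add up to
momentum times mass and a diagonal sum, which are treated separately. -/
theorem qform_eq_wickForm_add (S : Finset ℤ) (a : Coeff) :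
    qform S a a a a = wickForm S a +
      ((4 * (pSum S a * mNorm S a) - 2 * ∑ n ∈ S, (n : ℝ) * ‖a n‖ ^ 4 : ℝ) : ℂ) := by
  rw [qform, sum_quads_eq_wick_add, ← wickForm]
  have h1 : ∑ p ∈ S ×ˢ S, ((p.1 : ℂ) + p.2) * (a p.1 * a p.2 * conj (a p.1) * conj (a p.2)) =
      ((2 * (pSum S a * mNorm S a) : ℝ) : ℂ) := by
    have : ∀ p : ℤ × ℤ, ((p.1 : ℂ) + p.2) * (a p.1 * a p.2 * conj (a p.1) * conj (a p.2)) =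
        ((((p.1 : ℝ) * ‖a p.1‖ ^ 2) * ‖a p.2‖ ^ 2 + ‖a p.1‖ ^ 2 * ((p.2 : ℝ) * ‖a p.2‖ ^ 2) : ℝ) :
          ℂ) := by
      intro p
      push_cast
      rw [← mul_conj_eq, ← mul_conj_eq]; ring
    simp_rw [this]
    rw [← Complex.ofReal_sum, Finset.sum_add_distrib, Finset.sum_product, Finset.sum_product]
    simp only
    rw [← Finset.sum_mul_sum, ← Finset.sum_mul_sum, pSum, mNorm]
    congr 1; ring
  have h2 : ∑ p ∈ S ×ˢ S, ((p.1 : ℂ) + p.2) * (a p.1 * a p.2 * conj (a p.2) * conj (a p.1)) =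
      ((2 * (pSum S a * mNorm S a) : ℝ) : ℂ) := by
    rw [← h1]; exact Finset.sum_congr rfl fun p _ => by ring
  have h3 : ∑ n ∈ S, ((n : ℂ) + n) * (a n * a n * conj (a n) * conj (a n)) =
      ((2 * ∑ n ∈ S, (n : ℝ) * ‖a n‖ ^ 4 : ℝ) : ℂ) := by
    push_cast
    rw [Finset.mul_sum]
    refine Finset.sum_congr rfl fun n _ => ?_
    rw [show (‖a n‖ : ℂ) ^ 4 = (‖a n‖ : ℂ) ^ 2 * (‖a n‖ : ℂ) ^ 2 by ring, ← mul_conj_eq]; ring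
  rw [h1, h2, h3]
  push_cast; ring

/-- For `k` in `S`, the paired terms are a real multiple of `a k` that grows at most linearly in
`k`. In `H⁻¹` this growth is compensated, and only mass and momentum enter. -/
theorem tripleCoeff_eq_wickTriple_add (S : Finset ℤ) (a : Coeff) {k : ℤ} (hk : k ∈ S) :
    tripleCoeff S a k = wickTriple S a k +
      ((2 * (pSum S a + k * mNorm S a) - 2 * k * ‖a k‖ ^ 2 : ℝ) : ℂ) * a k := by
  have h0 : tripleCoeff S a k = ∑ q ∈ quads S, if q.2.2.2 = k then
      ((q.1 : ℂ) + q.2.1) * (a q.1 * a q.2.1 * conj (a q.2.2.1)) else 0 := by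
    rw [tripleCoeff, Finset.sum_filter]
  have hw : wickTriple S a k = ∑ q ∈ wick S, if q.2.2.2 = k then
      ((q.1 : ℂ) + q.2.1) * (a q.1 * a q.2.1 * conj (a q.2.2.1)) else 0 := by
    rw [wickTriple, Finset.sum_filter]
  have key : ∑ n ∈ S, ((n : ℂ) + k) * ((a n * conj (a n)) * a k) =
      ((pSum S a + k * mNorm S a : ℝ) : ℂ) * a k := by
    push_cast [pSum, mNorm]
    rw [Finset.mul_sum, ← Finset.sum_add_distrib, Finset.sum_mul]
    exact Finset.sum_congr rfl fun n _ => by rw [mul_conj_eq]; ring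
  rw [h0, sum_quads_eq_wick_add, ← hw]
  have h1 : ∑ p ∈ S ×ˢ S, (if p.2 = k then ((p.1 : ℂ) + p.2) * (a p.1 * a p.2 * conj (a p.1))
      else 0) = ((pSum S a + k * mNorm S a : ℝ) : ℂ) * a k := by
    rw [Finset.sum_product, ← key]
    refine Finset.sum_congr rfl fun n _ => ?_
    simp only [Finset.sum_ite_eq', hk, if_true]
    ring
  have h2 : ∑ p ∈ S ×ˢ S, (if p.1 = k then ((p.1 : ℂ) + p.2) * (a p.1 * a p.2 * conj (a p.2))
      else 0) = ((pSum S a + k * mNorm S a : ℝ) : ℂ) * a k := by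
    rw [Finset.sum_product_right, ← key]
    refine Finset.sum_congr rfl fun n _ => ?_
    simp only [Finset.sum_ite_eq', hk, if_true]
    ring
  have h3 : ∑ n ∈ S, (if n = k then ((n : ℂ) + n) * (a n * a n * conj (a n)) else 0) =
      ((2 * k * ‖a k‖ ^ 2 : ℝ) : ℂ) * a k := by
    simp only [Finset.sum_ite_eq', hk, if_true]
    push_cast
    rw [← mul_conj_eq]; ring
  rw [h1, h2, h3]
  push_cast; ring

/-- The difference zero is the one without orthogonality between its terms; it is controlled through
the momentum instead. -/
theorem pairCoeff_zero (S : Finset ℤ) (a : Coeff) : pairCoeff S a 0 = (pSum S a : ℂ) := by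
  rw [pairCoeff, Finset.sum_filter, Finset.sum_product]
  push_cast [pSum]
  refine Finset.sum_congr rfl fun n hn => ?_
  rw [Finset.sum_eq_single n]
  · simp [mul_conj_eq]
  · intro m _ hm; simp [sub_eq_zero, hm.symm]
  · intro h; exact absurd hn h

/-! ### Charges and second moments of the off-diagonal sums -/

/-- The charge of `a_{n₁} a_{n₂} ā_{n₃} ā_{n₄}`. -/
def quadCharge (q : ℤ × ℤ × ℤ × ℤ) (n : ℤ) : ℤ :=
  (((if q.1 = n then 1 else 0) + (if q.2.1 = n then 1 else 0)) +
    -(if q.2.2.1 = n then 1 else 0)) + -(if q.2.2.2 = n then 1 else 0)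

theorem hasCharge_quad (q : ℤ × ℤ × ℤ × ℤ) :
    HasCharge (fun a => a q.1 * a q.2.1 * conj (a q.2.2.1) * conj (a q.2.2.2)) (quadCharge q) :=
  (((HasCharge.coord q.1).mul (HasCharge.coord q.2.1)).mul (HasCharge.coord q.2.2.1).star).mul
    (HasCharge.coord q.2.2.2).star

/-- Without pairings nothing cancels between the two sides, so the charge recovers the unordered
pairs `{n₁, n₂}` and `{n₃, n₄}`. This leaves four quadruples for each charge. -/
theorem eq_of_quadCharge_eq {i j k l i' j' k' l' : ℤ} (h1 : i + j = k + l) (h2 : k ≠ i)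
    (h3 : k ≠ j) (h1' : i' + j' = k' + l') (h2' : k' ≠ i') (h3' : k' ≠ j')
    (h : quadCharge (i', j', k', l') = quadCharge (i, j, k, l)) :
    ((i' = i ∧ j' = j) ∨ (i' = j ∧ j' = i)) ∧ ((k' = k ∧ l' = l) ∨ (k' = l ∧ l' = k)) := by
  have a1 := congrFun h i'
  have a2 := congrFun h j'
  have a3 := congrFun h k'
  have a4 := congrFun h l'
  simp only [quadCharge] at a1 a2 a3 a4
  have hi : i' = i ∨ i' = j := by grind
  have hj : j' = i ∨ j' = j := by grind
  have hk : k' = k ∨ k' = l := by grind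
  have hl : l' = k ∨ l' = l := by grind
  clear a1 a2 a3 a4 h
  omega

theorem exists_card_le_four {S : Finset ℤ} (q : ℤ × ℤ × ℤ × ℤ) (hq : q ∈ wick S) :
    ∃ s : Finset (ℤ × ℤ × ℤ × ℤ), s.card ≤ 4 ∧
      ∀ q' ∈ wick S, quadCharge q' = quadCharge q → q' ∈ s := by
  obtain ⟨i, j, k, l⟩ := q
  refine ⟨{(i, j, k, l), (j, i, k, l), (i, j, l, k), (j, i, l, k)}, Finset.card_le_four, ?_⟩
  rintro ⟨i', j', k', l'⟩ hq' h
  simp only [wick, Finset.mem_filter, mem_quads] at hq hq'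
  have := eq_of_quadCharge_eq hq.1.2 hq.2.1 hq.2.2 hq'.1.2 hq'.2.1 hq'.2.2 h
  simp only [Finset.mem_insert, Finset.mem_singleton, Prod.mk.injEq]
  tauto

/-- The weight of a quadruple. -/
def quadWeight (q : ℤ × ℤ × ℤ × ℤ) : ℝ :=
  ((q.1 : ℝ) + q.2.1) ^ 2 * ((wt q.1)⁻¹ * (wt q.2.1)⁻¹ * (wt q.2.2.1)⁻¹ * (wt q.2.2.2)⁻¹)

theorem quadWeight_nonneg (q : ℤ × ℤ × ℤ × ℤ) : 0 ≤ quadWeight q := by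
  have := fun n => (wt_pos n).le
  exact mul_nonneg (sq_nonneg _) (mul_nonneg (mul_nonneg (mul_nonneg (inv_nonneg.2 (this _))
    (inv_nonneg.2 (this _))) (inv_nonneg.2 (this _))) (inv_nonneg.2 (this _)))

/-- `∑ₙ ⟨n⟩^{-2}`. -/
def K₁ : ℝ := ∑' n : ℤ, (wt n)⁻¹

theorem inv_wt_nonneg (n : ℤ) : 0 ≤ (wt n)⁻¹ := inv_nonneg.2 (wt_pos n).le

theorem sum_inv_wt_le (S : Finset ℤ) : ∑ n ∈ S, (wt n)⁻¹ ≤ K₁ :=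
  summable_inv_wt.sum_le_tsum _ fun n _ => inv_wt_nonneg n

theorem K₁_nonneg : 0 ≤ K₁ := tsum_nonneg inv_wt_nonneg

theorem sq_mul_inv_wt_le (n : ℤ) : (n : ℝ) ^ 2 * (wt n)⁻¹ ≤ 1 := by
  rw [← div_eq_mul_inv, div_le_one (wt_pos n)]; unfold wt; linarith

/-- The square of the derivative weight cancels one of the four inverse weights; three remain, and
each frequency sum converges. -/
theorem sum_wick_quadWeight_le (S : Finset ℤ) : ∑ q ∈ wick S, quadWeight q ≤ 4 * K₁ ^ 3 := by
  have i0 := inv_wt_nonneg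
  have hS : (∑ n ∈ S, (wt n)⁻¹) * (∑ n ∈ S, (wt n)⁻¹) * (∑ n ∈ S, (wt n)⁻¹) ≤ K₁ ^ 3 := by
    have h0 : 0 ≤ ∑ n ∈ S, (wt n)⁻¹ := Finset.sum_nonneg fun n _ => i0 n
    calc _ = (∑ n ∈ S, (wt n)⁻¹) ^ 3 := by ring
      _ ≤ _ := pow_le_pow_left₀ h0 (sum_inv_wt_le S) 3
  calc _ ≤ ∑ q ∈ quads S, quadWeight q :=
        Finset.sum_le_sum_of_subset_of_nonneg (Finset.filter_subset _ _) fun q _ _ =>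
          quadWeight_nonneg q
    _ ≤ ∑ q ∈ quads S, (2 * ((wt q.2.1)⁻¹ * (wt q.2.2.1)⁻¹ * (wt q.2.2.2)⁻¹) +
          2 * ((wt q.1)⁻¹ * (wt q.2.2.1)⁻¹ * (wt q.2.2.2)⁻¹)) := by
        refine Finset.sum_le_sum fun q _ => ?_
        unfold quadWeight
        have h1 : ((q.1 : ℝ) + q.2.1) ^ 2 ≤ 2 * (q.1 : ℝ) ^ 2 + 2 * (q.2.1 : ℝ) ^ 2 := by
          nlinarith [sq_nonneg ((q.1 : ℝ) - q.2.1)]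
        have h2 : ((q.1 : ℝ) + q.2.1) ^ 2 * ((wt q.1)⁻¹ * (wt q.2.1)⁻¹) ≤
            2 * (wt q.2.1)⁻¹ + 2 * (wt q.1)⁻¹ := by
          have := mul_le_mul_of_nonneg_right h1 (mul_nonneg (i0 q.1) (i0 q.2.1))
          have a1 := mul_le_mul_of_nonneg_right (sq_mul_inv_wt_le q.1) (i0 q.2.1)
          have a2 := mul_le_mul_of_nonneg_right (sq_mul_inv_wt_le q.2.1) (i0 q.1)
          linarith
        have := mul_le_mul_of_nonneg_right h2 (mul_nonneg (i0 q.2.2.1) (i0 q.2.2.2))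
        linarith
    _ ≤ _ := by
        rw [Finset.sum_add_distrib, ← Finset.mul_sum, ← Finset.mul_sum]
        have b1 := sum_quads_le_two_three_four S i0 i0 i0
        have b2 := sum_quads_le_one_three_four S i0 i0 i0
        linarith

theorem integral_norm_sq_quad_le (q : ℤ × ℤ × ℤ × ℤ) :
    ∫ a, ‖((q.1 : ℂ) + q.2.1) * (a q.1 * a q.2.1 * conj (a q.2.2.1) * conj (a q.2.2.2))‖ ^ 2
      ∂wiener ≤ momentBound * quadWeight q := by
  have e : ∀ a : Coeff,
      ‖((q.1 : ℂ) + q.2.1) * (a q.1 * a q.2.1 * conj (a q.2.2.1) * conj (a q.2.2.2))‖ ^ 2 =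
      quadWeight q * (nsq q.1 a * nsq q.2.1 a * nsq q.2.2.1 a * nsq q.2.2.2 a) := by
    intro a
    have h1 : ‖(q.1 : ℂ) + q.2.1‖ ^ 2 = ((q.1 : ℝ) + q.2.1) ^ 2 := by
      have : (q.1 : ℂ) + q.2.1 = (((q.1 : ℝ) + q.2.1 : ℝ) : ℂ) := by push_cast; rfl
      rw [this, Complex.norm_real, Real.norm_eq_abs, sq_abs]
    simp only [norm_mul, RCLike.norm_conj, mul_pow, h1, norm_sq_eq_nsq, quadWeight]
    ring
  simp_rw [e]
  rw [integral_const_mul, mul_comm]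
  exact mul_le_mul_of_nonneg_right (integral_nsq_four_le _ _ _ _) (quadWeight_nonneg q)

/-- The bound is an increment of a bounded monotone sequence, the form in which `SqCauchy` asks for
it. -/
theorem integral_norm_sq_wick_sub_le {S T : Finset ℤ} (h : S ⊆ T) :
    ∫ a, ‖wickForm T a - wickForm S a‖ ^ 2 ∂wiener ≤
      4 * momentBound * (∑ q ∈ wick T, quadWeight q - ∑ q ∈ wick S, quadWeight q) := by
  have e : ∀ a, wickForm T a - wickForm S a = ∑ q ∈ wick T \ wick S,
      ((q.1 : ℂ) + q.2.1) * (a q.1 * a q.2.1 * conj (a q.2.2.1) * conj (a q.2.2.2)) := by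
    intro a
    rw [wickForm, wickForm, ← Finset.sum_sdiff (wick_mono h)]
    ring
  simp_rw [e]
  rw [← Finset.sum_sdiff (wick_mono h), add_sub_cancel_right]
  refine (integral_norm_sq_sum_le (wick T \ wick S) _ quadCharge
    (fun q _ => (hasCharge_quad q).const_mul _) 4 ?_).trans ?_
  · intro q hq
    obtain ⟨s, hs, hs'⟩ := exists_card_le_four q (Finset.mem_sdiff.1 hq).1
    exact ⟨s, hs, fun q' hq' => hs' q' (Finset.mem_sdiff.1 hq').1⟩
  · push_cast
    rw [mul_assoc]
    refine mul_le_mul_of_nonneg_left ?_ (by norm_num)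
    rw [Finset.mul_sum]
    exact Finset.sum_le_sum fun q _ => integral_norm_sq_quad_le q

theorem integral_norm_sq_triple_le (q : ℤ × ℤ × ℤ × ℤ) :
    (∫ a, ‖((q.1 : ℂ) + q.2.1) * (a q.1 * a q.2.1 * conj (a q.2.2.1))‖ ^ 2 ∂wiener) *
      (wt q.2.2.2)⁻¹ ≤ momentBound * quadWeight q := by
  have e : ∀ a : Coeff,
      ‖((q.1 : ℂ) + q.2.1) * (a q.1 * a q.2.1 * conj (a q.2.2.1))‖ ^ 2 =
      ((q.1 : ℝ) + q.2.1) ^ 2 * ((wt q.1)⁻¹ * (wt q.2.1)⁻¹ * (wt q.2.2.1)⁻¹) *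
        (nsq q.1 a * nsq q.2.1 a * nsq q.2.2.1 a) := by
    intro a
    have h1 : ‖(q.1 : ℂ) + q.2.1‖ ^ 2 = ((q.1 : ℝ) + q.2.1) ^ 2 := by
      have : (q.1 : ℂ) + q.2.1 = (((q.1 : ℝ) + q.2.1 : ℝ) : ℂ) := by push_cast; rfl
      rw [this, Complex.norm_real, Real.norm_eq_abs, sq_abs]
    simp only [norm_mul, RCLike.norm_conj, mul_pow, h1, norm_sq_eq_nsq]
    ring
  simp_rw [e]
  rw [integral_const_mul]
  have := mul_le_mul_of_nonneg_left (integral_nsq_three_le q.1 q.2.1 q.2.2.1) (quadWeight_nonneg q)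
  unfold quadWeight at this ⊢
  linarith

/-- The factor `(wt k)⁻¹` of the `H⁻¹` norm replaces the second moment of the missing fourth mode,
so the sum over `k` is the one in `sum_wick_quadWeight_le`. -/
theorem integral_wickTriple_le (S : Finset ℤ) :
    ∫ a, ∑ k ∈ S, ‖wickTriple S a k‖ ^ 2 * (wt k)⁻¹ ∂wiener ≤ 16 * momentBound * K₁ ^ 3 := by
  have hch : ∀ q : ℤ × ℤ × ℤ × ℤ, HasCharge
      (fun a => ((q.1 : ℂ) + q.2.1) * (a q.1 * a q.2.1 * conj (a q.2.2.1)))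
      (fun n => ((if q.1 = n then 1 else 0) + (if q.2.1 = n then 1 else 0)) +
        -(if q.2.2.1 = n then 1 else 0)) := fun q =>
    (((HasCharge.coord q.1).mul (HasCharge.coord q.2.1)).mul (HasCharge.coord q.2.2.1).star).const_mul _
  have hW : ∀ k, AllLp fun a => wickTriple S a k := fun k =>
    AllLp.sum _ fun q _ => (hch q).allLp
  rw [integral_finsetSum _ fun k _ => (hW k).norm_sq.integrable.mul_const _]
  have h1 : ∀ k ∈ S, ∫ a, ‖wickTriple S a k‖ ^ 2 * (wt k)⁻¹ ∂wiener ≤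
      ∑ q ∈ (wick S).filter (fun q => q.2.2.2 = k), 4 * (momentBound * quadWeight q) := by
    intro k _
    rw [integral_mul_const]
    have := integral_norm_sq_sum_le ((wick S).filter fun q => q.2.2.2 = k)
      (fun q a => ((q.1 : ℂ) + q.2.1) * (a q.1 * a q.2.1 * conj (a q.2.2.1))) _
      (fun q _ => hch q) 4 ?_
    · refine (mul_le_mul_of_nonneg_right this (inv_wt_nonneg k)).trans ?_
      push_cast
      rw [mul_assoc, Finset.sum_mul, Finset.mul_sum]
      refine Finset.sum_le_sum fun q hq => ?_
      have := integral_norm_sq_triple_le q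
      rw [(Finset.mem_filter.1 hq).2] at this
      linarith
    · intro q hq
      obtain ⟨s, hs, hs'⟩ := exists_card_le_four q (Finset.mem_filter.1 hq).1
      -- At fixed `k` the charges of triples and of quadruples differ by a common term, so the count
      -- by four carries over.
      refine ⟨s, hs, fun q' hq' hc => hs' q' (Finset.mem_filter.1 hq').1 ?_⟩
      funext n
      have := congrFun hc n
      simp only [quadCharge, (Finset.mem_filter.1 hq).2, (Finset.mem_filter.1 hq').2] at this ⊢
      rw [this]
  refine (Finset.sum_le_sum h1).trans ?_
  rw [Finset.sum_fiberwise_of_maps_to (s := wick S) (t := S) (g := fun q : ℤ × ℤ × ℤ × ℤ => q.2.2.2)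
    (f := fun q => 4 * (momentBound * quadWeight q))
    (fun q hq => (mem_quads.1 (Finset.mem_filter.1 hq).1).1.2.2.2)]
  rw [← Finset.mul_sum, ← Finset.mul_sum]
  have := mul_le_mul_of_nonneg_left (sum_wick_quadWeight_le S)
    (zero_le_one.trans one_le_momentBound)
  linarith

/-- For `d ≠ 0` distinct pairs have distinct charges, so the terms are orthogonal. -/
theorem integral_norm_sq_pairCoeff_le (S : Finset ℤ) {d : ℤ} (hd : d ≠ 0) :
    ∫ a, ‖pairCoeff S a d‖ ^ 2 ∂wiener ≤ momentBound * K₁ := by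
  have hch : ∀ p : ℤ × ℤ, HasCharge (fun a => (p.1 : ℂ) * (a p.1 * conj (a p.2)))
      (fun n => (if p.1 = n then 1 else 0) + -(if p.2 = n then 1 else 0)) := fun p =>
    ((HasCharge.coord p.1).mul (HasCharge.coord p.2).star).const_mul _
  have := integral_norm_sq_sum_le ((S ×ˢ S).filter fun p => p.1 - p.2 = d)
      (fun p a => (p.1 : ℂ) * (a p.1 * conj (a p.2))) _ (fun q _ => hch q) 1 ?_
  · refine this.trans ?_
    push_cast
    rw [one_mul]
    calc _ ≤ ∑ p ∈ (S ×ˢ S).filter (fun p => p.1 - p.2 = d), momentBound * (wt p.2)⁻¹ := by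
          refine Finset.sum_le_sum fun p _ => ?_
          have e : ∀ a : Coeff, ‖(p.1 : ℂ) * (a p.1 * conj (a p.2))‖ ^ 2 =
              ((p.1 : ℝ) ^ 2 * (wt p.1)⁻¹) * (wt p.2)⁻¹ * (nsq p.1 a * nsq p.2 a) := by
            intro a
            simp only [norm_mul, RCLike.norm_conj, mul_pow, norm_sq_eq_nsq, Complex.norm_intCast,
              sq_abs]
            ring
          simp_rw [e]
          rw [integral_const_mul, mul_comm]
          have m0 := zero_le_one.trans one_le_momentBound
          have i0 := inv_wt_nonneg p.2
          have j0 := mul_nonneg (sq_nonneg (p.1 : ℝ)) (inv_wt_nonneg p.1)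
          have h1 := mul_le_mul_of_nonneg_right (sq_mul_inv_wt_le p.1) i0
          rw [one_mul] at h1
          exact mul_le_mul (integral_nsq_two_le _ _) h1 (mul_nonneg j0 i0) m0
      _ ≤ _ := by
          rw [← Finset.mul_sum]
          refine mul_le_mul_of_nonneg_left ?_ (zero_le_one.trans one_le_momentBound)
          refine le_trans ?_ (sum_inv_wt_le S)
          refine sum_le_sum_of_injOn (t := S) (fun p : ℤ × ℤ => p.2) ?_ ?_
            (F := fun n => (wt n)⁻¹) inv_wt_nonneg
          · rintro ⟨a, b⟩ hp ⟨c, e⟩ hp' h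
            simp only [Finset.coe_filter, Finset.mem_product, Set.mem_ofPred_eq] at hp hp' h
            simp only [Prod.mk.injEq]
            omega
          · intro p hp
            exact (Finset.mem_product.1 (Finset.mem_filter.1 hp).1).2
  · rintro ⟨a, b⟩ hp
    refine ⟨{(a, b)}, by simp, ?_⟩
    rintro ⟨a', b'⟩ hp' hc
    simp only [Finset.mem_filter, Finset.mem_product] at hp hp'
    simp only [Finset.mem_singleton, Prod.mk.injEq]
    have h1 := congrFun hc a'
    have h2 := congrFun hc b'
    simp only at h1 h2
    grind

theorem integral_offDiag_pairNorm_le (S : Finset ℤ) :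
    ∫ a, ∑ d ∈ (diffs S).erase 0, ‖pairCoeff S a d‖ ^ 2 * (wt d)⁻¹ ∂wiener ≤
      momentBound * K₁ ^ 2 := by
  have hA : ∀ d, AllLp fun a => pairCoeff S a d := fun d => AllLp.sum _ fun p _ =>
    ((AllLp.coord p.1).mul (AllLp.coord p.2).star).const_mul _
  rw [integral_finsetSum _ fun k _ => (hA k).norm_sq.integrable.mul_const _]
  have m0 := zero_le_one.trans one_le_momentBound
  calc _ ≤ ∑ d ∈ (diffs S).erase 0, momentBound * K₁ * (wt d)⁻¹ := by
        refine Finset.sum_le_sum fun d hd => ?_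
        rw [integral_mul_const]
        exact mul_le_mul_of_nonneg_right (integral_norm_sq_pairCoeff_le S (Finset.ne_of_mem_erase hd))
          (inv_wt_nonneg d)
    _ ≤ _ := by
        rw [← Finset.mul_sum, sq, ← mul_assoc]
        exact mul_le_mul_of_nonneg_left (sum_inv_wt_le _) (mul_nonneg m0 K₁_nonneg)

/-! ### Sequences with square-summable increments -/

/-- The increments of `Q` are controlled in `L²(dρ)` by those of a bounded monotone sequence. -/
structure SqCauchy (Q : ℕ → Coeff → ℝ) : Prop where
  allLp : ∀ N, AllLp (Q N)
  bound : ∃ (S : ℕ → ℝ) (C : ℝ), (∀ N, S N ≤ C) ∧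
    ∀ K N, K ≤ N → ∫ a, (Q N a - Q K a) ^ 2 ∂wiener ≤ S N - S K

theorem integral_sq_add_le {f g : Coeff → ℝ} (hf : AllLp f) (hg : AllLp g) :
    ∫ a, (f a + g a) ^ 2 ∂wiener ≤ 2 * ∫ a, f a ^ 2 ∂wiener + 2 * ∫ a, g a ^ 2 ∂wiener := by
  rw [← integral_const_mul, ← integral_const_mul,
    ← integral_add ((hf.pow 2).integrable.const_mul 2) ((hg.pow 2).integrable.const_mul 2)]
  refine integral_mono ((hf.add hg).pow 2).integrable
    (((hf.pow 2).integrable.const_mul 2).add ((hg.pow 2).integrable.const_mul 2)) fun a => ?_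
  change (f a + g a) ^ 2 ≤ 2 * f a ^ 2 + 2 * g a ^ 2
  nlinarith [sq_nonneg (f a - g a)]

namespace SqCauchy

theorem add {P Q : ℕ → Coeff → ℝ} (hP : SqCauchy P) (hQ : SqCauchy Q) :
    SqCauchy fun N a => P N a + Q N a := by
  obtain ⟨S, C, hC, hS⟩ := hP.bound
  obtain ⟨T, D, hD, hT⟩ := hQ.bound
  refine ⟨fun N => (hP.allLp N).add (hQ.allLp N), fun N => 2 * S N + 2 * T N, 2 * C + 2 * D,
    fun N => by linarith [hC N, hD N], fun K N hKN => ?_⟩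
  have := integral_sq_add_le ((hP.allLp N).sub (hP.allLp K)) ((hQ.allLp N).sub (hQ.allLp K))
  have e : ∀ a, P N a + Q N a - (P K a + Q K a) = P N a - P K a + (Q N a - Q K a) :=
    fun a => by ring
  simp_rw [e]
  linarith [hS K N hKN, hT K N hKN]

theorem const_mul {Q : ℕ → Coeff → ℝ} (c : ℝ) (hQ : SqCauchy Q) :
    SqCauchy fun N a => c * Q N a := by
  obtain ⟨T, D, hD, hT⟩ := hQ.bound
  refine ⟨fun N => (hQ.allLp N).const_mul c, fun N => c ^ 2 * T N, c ^ 2 * D,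
    fun N => mul_le_mul_of_nonneg_left (hD N) (sq_nonneg c), fun K N hKN => ?_⟩
  have e : ∀ a, (c * Q N a - c * Q K a) ^ 2 = c ^ 2 * (Q N a - Q K a) ^ 2 := fun a => by ring
  simp_rw [e]
  rw [integral_const_mul, ← mul_sub]
  exact mul_le_mul_of_nonneg_left (hT K N hKN) (sq_nonneg c)

theorem exists_integral_sq_le {Q : ℕ → Coeff → ℝ} (hQ : SqCauchy Q) :
    ∃ C, ∀ N, ∫ a, Q N a ^ 2 ∂wiener ≤ C := by
  obtain ⟨T, D, hD, hT⟩ := hQ.bound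
  refine ⟨2 * ∫ a, Q 0 a ^ 2 ∂wiener + 2 * (D - T 0), fun N => ?_⟩
  have := integral_sq_add_le (hQ.allLp 0) ((hQ.allLp N).sub (hQ.allLp 0))
  simp only [add_sub_cancel] at this
  linarith [hT 0 N (Nat.zero_le N), hD N]

/-- A bounded monotone sequence is Cauchy and dominates the squared `L²` distances, so completeness
of `L²` applies. -/
theorem exists_limit {Q : ℕ → Coeff → ℝ} (hQ : SqCauchy Q) :
    ∃ f : Coeff → ℝ, MemLp f 2 wiener ∧ Measurable f ∧ TendstoL2 Q f := by
  obtain ⟨T, D, hD, hT⟩ := hQ.bound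
  have hm := fun N => hQ.allLp N 2 (by simp)
  have hmono : Monotone T := fun K N h => by
    have h0 : 0 ≤ ∫ a, (Q N a - Q K a) ^ 2 ∂wiener := integral_nonneg fun a => sq_nonneg _
    linarith [hT K N h]
  have hc : CauchySeq T :=
    (tendsto_atTop_ciSup hmono ⟨D, by rintro _ ⟨N, rfl⟩; exact hD N⟩).cauchySeq
  have hd : ∀ K N, K ≤ N → dist ((hm N).toLp (Q N)) ((hm K).toLp (Q K)) ≤ √(T N - T K) := by
    intro K N h
    rw [dist_eq_norm, ← MemLp.toLp_sub, Lp.norm_toLp, MemLp.eLpNorm_eq_integral_rpow_norm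
      (by simp) (by simp) ((hm N).sub (hm K))]
    rw [ENNReal.toReal_ofReal (by positivity), Real.sqrt_eq_rpow]
    simp only [ENNReal.toReal_ofNat, one_div, Pi.sub_apply, Real.norm_eq_abs]
    have e : ∀ a, |Q N a - Q K a| ^ (2 : ℝ) = (Q N a - Q K a) ^ 2 := fun a => by
      rw [Real.rpow_ofNat, sq_abs]
    simp_rw [e]
    exact Real.rpow_le_rpow (integral_nonneg fun a => sq_nonneg _) (hT K N h) (by norm_num)
  have hcs : CauchySeq fun N => (hm N).toLp (Q N) := by
    rw [Metric.cauchySeq_iff'] at hc ⊢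
    intro ε hε
    obtain ⟨N, hN⟩ := hc (ε ^ 2) (by positivity)
    refine ⟨N, fun n hn => (hd N n hn).trans_lt ?_⟩
    rw [Real.sqrt_lt' hε]
    exact (le_abs_self _).trans_lt (hN n hn)
  obtain ⟨F, hF⟩ := cauchySeq_tendsto_of_complete hcs
  have hFm := (Lp.aestronglyMeasurable F)
  refine ⟨hFm.mk F, (Lp.memLp F).ae_eq hFm.ae_eq_mk, hFm.stronglyMeasurable_mk.measurable, ?_⟩
  have hF' : (((Lp.memLp F).ae_eq hFm.ae_eq_mk).toLp (hFm.mk F)) = F := by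
    rw [MemLp.toLp_congr ((Lp.memLp F).ae_eq hFm.ae_eq_mk) (Lp.memLp F) hFm.ae_eq_mk.symm,
      Lp.toLp_coeFn]
  rw [← hF'] at hF
  exact (Lp.tendsto_Lp_iff_tendsto_eLpNorm'' Q hm _ _).1 hF

theorem tendstoL2_limL2 {Q : ℕ → Coeff → ℝ} (hQ : SqCauchy Q) : TendstoL2 Q (limL2 Q) := by
  have h : ∃ f : Coeff → ℝ, Measurable f ∧ TendstoL2 Q f :=
    let ⟨f, _, h⟩ := hQ.exists_limit; ⟨f, h⟩
  rw [limL2, dif_pos h]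
  exact h.choose_spec.2

end SqCauchy

theorem measurable_limL2 (Q : ℕ → Coeff → ℝ) : Measurable (limL2 Q) := by
  unfold limL2
  split_ifs with h
  · exact h.choose_spec.1
  · exact measurable_zero

/-! ### The momentum -/

/-- Exchange of the coefficients with indices `± (k + 1)`. -/
def flip (k : ℕ) (a : Coeff) : Coeff := fun n => a (Equiv.swap ((k : ℤ) + 1) (-((k : ℤ) + 1)) n)

theorem modeLaw_neg (n : ℤ) : modeLaw (-n) = modeLaw n := by simp [modeLaw]

theorem swap_neg_eq (m n : ℤ) : Equiv.swap m (-m) n = n ∨ Equiv.swap m (-m) n = -n := by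
  rw [Equiv.swap_apply_def]
  split_ifs <;> grind

theorem measurePreserving_flip (k : ℕ) : MeasurePreserving (flip k) wiener wiener := by
  refine ⟨by unfold flip; fun_prop, ?_⟩
  have := Measure.map_infinitePi_infinitePi_of_inj (P := modeLaw)
    (Equiv.swap ((k : ℤ) + 1) (-((k : ℤ) + 1))).injective
  unfold wiener
  refine this.trans ?_
  congr 1
  funext n
  rcases swap_neg_eq ((k : ℤ) + 1) n with h | h <;> rw [h]
  exact modeLaw_neg n

/-- The contribution of the frequencies `± (k + 1)` to the momentum. -/
def dip (k : ℕ) (a : Coeff) : ℝ :=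
  ((k : ℝ) + 1) * (‖a ((k : ℤ) + 1)‖ ^ 2 - ‖a (-((k : ℤ) + 1))‖ ^ 2)

theorem pSum_modes (N : ℕ) (a : Coeff) : pSum (modes N) a = ∑ k ∈ Finset.range N, dip k a := by
  unfold pSum
  induction N with
  | zero => simp [modes]
  | succ N ih =>
    rw [sum_modes_succ, ih, Finset.sum_range_succ, dip]
    push_cast; ring

theorem dip_flip_self (k : ℕ) (a : Coeff) : dip k (flip k a) = -dip k a := by
  simp only [dip, flip, Equiv.swap_apply_left, Equiv.swap_apply_right]
  ring

theorem dip_flip_of_ne {j k : ℕ} (h : j ≠ k) (a : Coeff) : dip j (flip k a) = dip j a := by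
  simp only [dip, flip]
  rw [Equiv.swap_apply_of_ne_of_ne (by omega) (by omega),
    Equiv.swap_apply_of_ne_of_ne (by omega) (by omega)]

theorem AllLp.dip (k : ℕ) : AllLp (dip k) :=
  ((AllLp.coord _).norm_sq.sub (AllLp.coord _).norm_sq).const_mul _

theorem AllLp.mNorm (S : Finset ℤ) : AllLp (mNorm S) := AllLp.sum _ fun n _ => (AllLp.coord n).norm_sq

theorem mNorm_flip {S : Finset ℤ} (hS : ∀ n ∈ S, -n ∈ S) (k : ℕ) (a : Coeff) :
    mNorm S (flip k a) = mNorm S a := by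
  have hS' : ∀ n ∈ S, Equiv.swap ((k : ℤ) + 1) (-((k : ℤ) + 1)) n ∈ S := by
    intro n hn
    rcases swap_neg_eq ((k : ℤ) + 1) n with h | h <;> rw [h]
    exacts [hn, hS n hn]
  refine Finset.sum_equiv (Equiv.swap ((k : ℤ) + 1) (-((k : ℤ) + 1))) (fun n => ⟨hS' n, fun h => ?_⟩)
    fun n _ => rfl
  simpa using hS' _ h

theorem wt_neg (n : ℤ) : wt (-n) = wt n := by simp [wt]

theorem integral_sq_dip_mul_le (k : ℕ) {m : Coeff → ℝ} (hm : AllLp m) {c : ℝ}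
    (hc : ∀ n, ∫ a, (nsq n a * m a) ^ 2 ∂wiener ≤ c) :
    ∫ a, (dip k a * m a) ^ 2 ∂wiener ≤ 4 * c * (wt ((k : ℤ) + 1))⁻¹ := by
  set n : ℤ := (k : ℤ) + 1 with hn
  have hX := fun i => ((AllLp.nsq i).mul hm).pow 2
  have hpt : ∀ a, (dip k a * m a) ^ 2 ≤
      (wt n)⁻¹ * (2 * (nsq n a * m a) ^ 2 + 2 * (nsq (-n) a * m a) ^ 2) := by
    intro a
    have e : dip k a * m a = (n : ℝ) * (wt n)⁻¹ * (nsq n a * m a - nsq (-n) a * m a) := by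
      rw [dip, norm_sq_eq_nsq, norm_sq_eq_nsq, ← hn, wt_neg, hn]; push_cast; ring
    rw [e, mul_pow]
    have h1 : ((n : ℝ) * (wt n)⁻¹) ^ 2 ≤ (wt n)⁻¹ := by
      have := mul_le_mul_of_nonneg_right (sq_mul_inv_wt_le n) (inv_wt_nonneg n)
      linarith
    refine mul_le_mul h1 ?_ (sq_nonneg _) (inv_wt_nonneg n)
    nlinarith [sq_nonneg (nsq n a * m a + nsq (-n) a * m a)]
  refine (integral_mono (((AllLp.dip k).mul hm).pow 2).integrable
    ((((hX n).const_mul 2).add ((hX (-n)).const_mul 2)).const_mul _).integrable hpt).trans ?_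
  rw [integral_const_mul, integral_add ((hX n).const_mul 2).integrable
    ((hX (-n)).const_mul 2).integrable, integral_const_mul, integral_const_mul, mul_comm]
  exact mul_le_mul_of_nonneg_right (by linarith [hc n, hc (-n)]) (inv_wt_nonneg n)

/-- The flip `k` preserves `ρ` and `m`, changes the sign of `dip k` and fixes the other dipoles, so
all cross terms vanish. A factor `m` invariant under every flip is allowed for the sake of the mass.
-/
theorem integral_sq_sum_dip_mul_le (J : Finset ℕ) {m : Coeff → ℝ} (hm : AllLp m)
    (hs : ∀ k a, m (flip k a) = m a) {c : ℝ} (hc : ∀ n, ∫ a, (nsq n a * m a) ^ 2 ∂wiener ≤ c) :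
    ∫ a, ((∑ k ∈ J, dip k a) * m a) ^ 2 ∂wiener ≤
      4 * c * ∑ k ∈ J, (wt ((k : ℤ) + 1))⁻¹ := by
  have hD := fun k => (AllLp.dip k).mul hm
  have e : ∀ a, ((∑ k ∈ J, dip k a) * m a) ^ 2 =
      ∑ k ∈ J, ∑ j ∈ J, (dip k a * m a) * (dip j a * m a) := by
    intro a
    rw [sq, Finset.sum_mul, Finset.sum_mul_sum]
  simp_rw [e]
  rw [integral_finsetSum _ fun k _ => integrable_finsetSum _ fun j _ => ((hD k).mul (hD j)).integrable,
    Finset.mul_sum]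
  refine Finset.sum_le_sum fun k hk => ?_
  rw [integral_finsetSum _ fun j _ => ((hD k).mul (hD j)).integrable, Finset.sum_eq_single k]
  · simp_rw [← sq]
    exact integral_sq_dip_mul_le k hm hc
  · intro j _ hj
    have hmp := measurePreserving_flip k
    have h1 : ∫ a, dip k a * m a * (dip j a * m a) ∂wiener =
        ∫ a, dip k (flip k a) * m (flip k a) * (dip j (flip k a) * m (flip k a)) ∂wiener := by
      conv_lhs => rw [← hmp.map_eq]
      rw [integral_map hmp.measurable.aemeasurable]
      rw [hmp.map_eq]
      exact ((hD k).mul (hD j)).integrable.aestronglyMeasurable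
    simp_rw [dip_flip_self, dip_flip_of_ne hj, hs, neg_mul] at h1
    rw [integral_neg] at h1
    linarith
  · intro h; exact absurd hk h

/-! ### Convergence of the momentum and of the paired terms -/

/-- `∑_{1 ≤ n ≤ N} ⟨n⟩^{-2}`. -/
def halfSum (N : ℕ) : ℝ := ∑ k ∈ Finset.range N, (wt ((k : ℤ) + 1))⁻¹

theorem sum_modes_inv_wt (N : ℕ) : ∑ n ∈ modes N, (wt n)⁻¹ = 1 + 2 * halfSum N := by
  induction N with
  | zero => simp [modes, halfSum, wt]
  | succ N ih =>
    rw [sum_modes_succ, ih, halfSum, halfSum, Finset.sum_range_succ, wt_neg]; ring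

theorem one_add_two_mul_halfSum_le (N : ℕ) : 1 + 2 * halfSum N ≤ K₁ :=
  sum_modes_inv_wt N ▸ sum_inv_wt_le _

theorem halfSum_nonneg (N : ℕ) : 0 ≤ halfSum N := Finset.sum_nonneg fun _ _ => inv_wt_nonneg _

theorem sum_Ico_inv_wt {K N : ℕ} (h : K ≤ N) :
    ∑ k ∈ Finset.Ico K N, (wt ((k : ℤ) + 1))⁻¹ = halfSum N - halfSum K :=
  Finset.sum_Ico_eq_sub _ h

theorem halfSum_mono : Monotone halfSum := fun K N h => by
  have : 0 ≤ ∑ k ∈ Finset.Ico K N, (wt ((k : ℤ) + 1))⁻¹ :=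
    Finset.sum_nonneg fun _ _ => inv_wt_nonneg _
  rw [sum_Ico_inv_wt h] at this
  linarith

theorem integral_sq_nsq_mul_mNorm_le (S : Finset ℤ) (n : ℤ) :
    ∫ a, (nsq n a * mNorm S a) ^ 2 ∂wiener ≤ momentBound * (∑ i ∈ S, (wt i)⁻¹) ^ 2 := by
  have e : ∀ a, (nsq n a * mNorm S a) ^ 2 = ∑ i ∈ S, ∑ j ∈ S,
      (wt i)⁻¹ * (wt j)⁻¹ * (nsq n a * nsq n a * nsq i a * nsq j a) := by
    intro a
    rw [mNorm, mul_pow, sq (∑ i ∈ S, _), Finset.sum_mul_sum, Finset.mul_sum]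
    refine Finset.sum_congr rfl fun i _ => ?_
    rw [Finset.mul_sum]
    exact Finset.sum_congr rfl fun j _ => by rw [norm_sq_eq_nsq, norm_sq_eq_nsq]; ring
  have hI : ∀ i j : ℤ, AllLp fun a => (wt i)⁻¹ * (wt j)⁻¹ * (nsq n a * nsq n a * nsq i a * nsq j a) :=
    fun i j => ((((AllLp.nsq n).mul (AllLp.nsq n)).mul (AllLp.nsq i)).mul (AllLp.nsq j)).const_mul _
  simp_rw [e]
  rw [integral_finsetSum _ fun i _ => integrable_finsetSum _ fun j _ => (hI i j).integrable, sq,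
    Finset.sum_mul_sum, Finset.mul_sum]
  refine Finset.sum_le_sum fun i _ => ?_
  rw [integral_finsetSum _ fun j _ => (hI i j).integrable, Finset.mul_sum]
  refine Finset.sum_le_sum fun j _ => ?_
  rw [integral_const_mul, mul_comm]
  exact mul_le_mul_of_nonneg_right (integral_nsq_four_le _ _ _ _)
    (mul_nonneg (inv_wt_nonneg i) (inv_wt_nonneg j))

theorem modes_mono {K N : ℕ} (h : K ≤ N) : modes K ⊆ modes N :=
  Finset.Icc_subset_Icc (by omega) (by omega)

theorem neg_mem_modes {N : ℕ} {n : ℤ} (h : n ∈ modes N) : -n ∈ modes N := by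
  simp only [modes, Finset.mem_Icc] at h ⊢; omega

theorem sqCauchy_pSum : SqCauchy fun N a => pSum (modes N) a := by
  refine ⟨fun N => AllLp.sum _ fun n _ => (AllLp.coord n).norm_sq.const_mul _,
    fun N => 4 * momentBound * halfSum N, 4 * momentBound * K₁, fun N => ?_, fun K N h => ?_⟩
  · have := one_le_momentBound
    exact mul_le_mul_of_nonneg_left (by linarith [one_add_two_mul_halfSum_le N, halfSum_nonneg N])
      (by linarith)
  · have := integral_sq_sum_dip_mul_le (Finset.Ico K N) (AllLp.const 1) (fun _ _ => rfl)
      (c := momentBound) (fun n => by simpa [sq] using integral_nsq_two_le n n)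
    simp only [mul_one, sum_Ico_inv_wt h, Finset.sum_Ico_eq_sub _ h, mul_sub] at this
    simpa only [pSum_modes] using this

theorem mNorm_sub_eq {S T : Finset ℤ} (h : S ⊆ T) (a : Coeff) :
    mNorm T a - mNorm S a = mNorm (T \ S) a := by
  rw [mNorm, mNorm, mNorm, ← Finset.sum_sdiff h]; ring

/-- The difference is `(P_N - P_K) M_N + P_K (M_N - M_K)`. The mass over a symmetric set of
frequencies is invariant under flips, so the dipoles are orthogonal in both products. -/
theorem sqCauchy_pSum_mul_mNorm : SqCauchy fun N a => pSum (modes N) a * mNorm (modes N) a := by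
  have hp := fun N => sqCauchy_pSum.allLp N
  have m1 := one_le_momentBound
  have m0 : 0 ≤ momentBound := by linarith
  refine ⟨fun N => (hp N).mul (AllLp.mNorm _),
    fun N => 40 * momentBound * K₁ ^ 2 * halfSum N, 40 * momentBound * K₁ ^ 2 * K₁, fun N => ?_,
    fun K N h => ?_⟩
  · exact mul_le_mul_of_nonneg_left (by linarith [one_add_two_mul_halfSum_le N, halfSum_nonneg N])
      (by positivity)
  · have h1 := integral_sq_sum_dip_mul_le (Finset.Ico K N) (AllLp.mNorm (modes N))
      (fun k a => mNorm_flip (fun n hn => neg_mem_modes hn) k a)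
      (integral_sq_nsq_mul_mNorm_le (modes N))
    have h2 := integral_sq_sum_dip_mul_le (Finset.range K) (AllLp.mNorm (modes N \ modes K))
      (fun k a => mNorm_flip (fun n hn => Finset.mem_sdiff.2
        ⟨neg_mem_modes (Finset.mem_sdiff.1 hn).1, fun hn' => (Finset.mem_sdiff.1 hn).2 (by
          simpa using neg_mem_modes hn')⟩) k a)
      (integral_sq_nsq_mul_mNorm_le (modes N \ modes K))
    have hd : ∑ i ∈ modes N \ modes K, (wt i)⁻¹ = 2 * (halfSum N - halfSum K) := by
      have := Finset.sum_sdiff (modes_mono h) (f := fun i => (wt i)⁻¹)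
      rw [sum_modes_inv_wt, sum_modes_inv_wt] at this
      linarith
    rw [sum_Ico_inv_wt h, sum_modes_inv_wt] at h1
    rw [hd, ← halfSum] at h2
    have hsum := integral_sq_add_le
      ((AllLp.sum (Finset.Ico K N) fun k _ => AllLp.dip k).mul (AllLp.mNorm (modes N)))
      ((AllLp.sum (Finset.range K) fun k _ => AllLp.dip k).mul (AllLp.mNorm (modes N \ modes K)))
    have e : ∀ a, pSum (modes N) a * mNorm (modes N) a - pSum (modes K) a * mNorm (modes K) a =
        (∑ k ∈ Finset.Ico K N, dip k a) * mNorm (modes N) a +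
          (∑ k ∈ Finset.range K, dip k a) * mNorm (modes N \ modes K) a := by
      intro a
      rw [pSum_modes, pSum_modes, Finset.sum_Ico_eq_sub _ h, ← mNorm_sub_eq (modes_mono h)]; ring
    simp_rw [e]
    refine hsum.trans ((add_le_add (mul_le_mul_of_nonneg_left h1 zero_le_two)
      (mul_le_mul_of_nonneg_left h2 zero_le_two)).trans ?_)
    have a1 := one_add_two_mul_halfSum_le N
    have a2 := one_add_two_mul_halfSum_le K
    have a3 := halfSum_nonneg N
    have a4 := halfSum_nonneg K
    have a5 := halfSum_mono h
    set x := halfSum N - halfSum K with hx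
    have x0 : 0 ≤ x := by linarith
    have b1 : (1 + 2 * halfSum N) ^ 2 ≤ K₁ ^ 2 := pow_le_pow_left₀ (by linarith) a1 2
    have b2 : x * halfSum K ≤ K₁ ^ 2 := by
      rw [sq]; exact mul_le_mul (by linarith) (by linarith) a4 K₁_nonneg
    have c1 := mul_le_mul_of_nonneg_left b1 (mul_nonneg m0 x0)
    have c2 := mul_le_mul_of_nonneg_left b2 (mul_nonneg m0 x0)
    calc _ = 8 * (momentBound * x * (1 + 2 * halfSum N) ^ 2) +
          32 * (momentBound * x * (x * halfSum K)) := by ring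
      _ ≤ 8 * (momentBound * x * K₁ ^ 2) + 32 * (momentBound * x * K₁ ^ 2) := by linarith
      _ = _ := by rw [hx]; ring

theorem sqCauchy_diag : SqCauchy fun N a => ∑ n ∈ modes N, (n : ℝ) * ‖a n‖ ^ 4 := by
  have hA : ∀ S : Finset ℤ, AllLp fun a => ∑ n ∈ S, (n : ℝ) * ‖a n‖ ^ 4 := fun S =>
    AllLp.sum _ fun n _ => ((AllLp.coord n).norm.pow 4).const_mul _
  have m1 := one_le_momentBound
  have m0 : 0 ≤ momentBound := by linarith
  refine ⟨fun N => hA _, fun N => momentBound * K₁ * ∑ n ∈ modes N, (wt n)⁻¹,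
    momentBound * K₁ * K₁, fun N => ?_, fun K N h => ?_⟩
  · exact mul_le_mul_of_nonneg_left (sum_inv_wt_le _) (mul_nonneg m0 K₁_nonneg)
  · have e : ∀ a : Coeff, ∑ n ∈ modes N, (n : ℝ) * ‖a n‖ ^ 4 - ∑ n ∈ modes K, (n : ℝ) * ‖a n‖ ^ 4 =
        ∑ n ∈ modes N \ modes K, (n : ℝ) * ‖a n‖ ^ 4 := by
      intro a; rw [← Finset.sum_sdiff (modes_mono h)]; ring
    simp_rw [e]
    set T := modes N \ modes K
    rw [← Finset.sum_sdiff (modes_mono h), mul_add, add_sub_cancel_right]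
    -- No cancellation is needed here: Cauchy–Schwarz against `(wt n)⁻¹` already leaves a summable
    -- sequence of moments.
    have hpt : ∀ a : Coeff, (∑ n ∈ T, (n : ℝ) * ‖a n‖ ^ 4) ^ 2 ≤
        K₁ * ∑ n ∈ T, (wt n)⁻¹ * (nsq n a * nsq n a * nsq n a * nsq n a) := by
      intro a
      have h1 : ∀ n : ℤ, (n : ℝ) * ‖a n‖ ^ 4 =
          √((wt n)⁻¹) * (√(wt n) * ((n : ℝ) * ‖a n‖ ^ 4)) := by
        intro n
        rw [← mul_assoc, ← Real.sqrt_mul (inv_wt_nonneg n), inv_mul_cancel₀ (wt_pos n).ne',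
          Real.sqrt_one, one_mul]
      rw [Finset.sum_congr rfl fun n _ => h1 n]
      refine (Finset.sum_mul_sq_le_sq_mul_sq _ _ _).trans ?_
      simp_rw [mul_pow, Real.sq_sqrt (inv_wt_nonneg _), Real.sq_sqrt (wt_pos _).le]
      refine mul_le_mul (sum_inv_wt_le T) (Finset.sum_le_sum fun n _ => ?_)
        (Finset.sum_nonneg fun n _ => mul_nonneg (wt_pos n).le (by positivity)) K₁_nonneg
      have h2 : wt n * ((n : ℝ) ^ 2 * (‖a n‖ ^ 4) ^ 2) =
          ((n : ℝ) ^ 2 * (wt n)⁻¹) * ((wt n)⁻¹ ^ 2 * nsq n a ^ 4) := by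
        have : ‖a n‖ ^ 4 = (‖a n‖ ^ 2) ^ 2 := by ring
        have w := (wt_pos n).ne'
        rw [this, norm_sq_eq_nsq]; field_simp
      have h3 : (wt n)⁻¹ ^ 2 ≤ (wt n)⁻¹ := by
        have := inv_le_one_of_one_le₀ (one_le_wt n)
        nlinarith [inv_wt_nonneg n]
      have h4 : 0 ≤ nsq n a ^ 4 := pow_nonneg (nsq_nonneg n a) 4
      rw [h2]
      calc _ ≤ 1 * ((wt n)⁻¹ ^ 2 * nsq n a ^ 4) :=
            mul_le_mul_of_nonneg_right (sq_mul_inv_wt_le n) (by positivity)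
        _ ≤ (wt n)⁻¹ * nsq n a ^ 4 := by
            rw [one_mul]; exact mul_le_mul_of_nonneg_right h3 h4
        _ = _ := by ring
    have hI : ∀ n, AllLp fun a => (wt n)⁻¹ * (nsq n a * nsq n a * nsq n a * nsq n a) := fun n =>
      ((((AllLp.nsq n).mul (AllLp.nsq n)).mul (AllLp.nsq n)).mul (AllLp.nsq n)).const_mul _
    refine (integral_mono ((hA T).pow 2).integrable
      ((AllLp.sum T fun n _ => hI n).const_mul _).integrable hpt).trans ?_
    rw [integral_const_mul, integral_finsetSum _ fun n _ => (hI n).integrable,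
      mul_comm momentBound, mul_assoc]
    refine mul_le_mul_of_nonneg_left ?_ K₁_nonneg
    rw [Finset.mul_sum]
    refine Finset.sum_le_sum fun n _ => ?_
    rw [integral_const_mul, mul_comm]
    exact mul_le_mul_of_nonneg_right (integral_nsq_four_le _ _ _ _) (inv_wt_nonneg n)

theorem sqCauchy_wickForm_re : SqCauchy fun N a => (wickForm (modes N) a).re := by
  have hA : ∀ S : Finset ℤ, AllLp fun a => wickForm S a := fun S =>
    AllLp.sum _ fun q _ => ((hasCharge_quad q).const_mul _).allLp
  have m1 := one_le_momentBound
  refine ⟨fun N => (hA _).re, fun N => 4 * momentBound * ∑ q ∈ wick (modes N), quadWeight q,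
    4 * momentBound * (4 * K₁ ^ 3), fun N => ?_, fun K N h => ?_⟩
  · exact mul_le_mul_of_nonneg_left (sum_wick_quadWeight_le _) (by linarith)
  · rw [← mul_sub]
    refine le_trans ?_ (integral_norm_sq_wick_sub_le (modes_mono h))
    refine integral_mono (((hA _).re.sub (hA _).re).pow 2).integrable
      ((hA _).sub (hA _)).norm_sq.integrable fun a => ?_
    change ((wickForm (modes N) a).re - (wickForm (modes K) a).re) ^ 2 ≤ _
    rw [← Complex.sub_re, ← sq_abs]
    exact pow_le_pow_left₀ (abs_nonneg _) (Complex.abs_re_le_norm _) 2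

theorem sqCauchy_momentum : SqCauchy fun N a => momentum (trunc N a) := by
  have := sqCauchy_pSum.const_mul (-(2 * Real.pi))
  convert this using 3 with N a
  rw [trunc_eq_trig, momentum_trig, ← pSum]; ring

theorem sqCauchy_cubic : SqCauchy fun N a => cubic (trunc N a) := by
  have := ((sqCauchy_wickForm_re.add (sqCauchy_pSum_mul_mNorm.const_mul 4)).add
    (sqCauchy_diag.const_mul (-2))).const_mul (-Real.pi)
  convert this using 3 with N a
  rw [trunc_eq_trig, cubic_trig, qform_eq_wickForm_add, Complex.add_re, Complex.ofReal_re]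
  ring

/-! ### Measurability -/

@[fun_prop]
theorem measurable_qform (S : Finset ℤ) : Measurable fun a : Coeff => qform S a a a a := by
  unfold qform
  refine Finset.measurable_sum _ fun q _ => ?_
  fun_prop

@[fun_prop]
theorem measurable_mNorm (S : Finset ℤ) : Measurable (mNorm S) := by
  unfold mNorm
  fun_prop

@[fun_prop]
theorem measurable_pSum (S : Finset ℤ) : Measurable (pSum S) := by
  unfold pSum
  fun_prop

@[fun_prop]
theorem measurable_sNorm (S : Finset ℤ) : Measurable (sNorm S) := by
  unfold sNorm
  fun_prop

@[fun_prop]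
theorem measurable_tripleNorm (S : Finset ℤ) : Measurable (tripleNorm S) := by
  unfold tripleNorm tripleCoeff
  fun_prop

@[fun_prop]
theorem measurable_pairNorm (S : Finset ℤ) : Measurable (pairNorm S) := by
  unfold pairNorm pairCoeff
  fun_prop

@[fun_prop]
theorem measurable_quartic_trig (S : Finset ℤ) : Measurable fun a => quartic (trig S a) := by
  simp_rw [quartic_trig]
  have : Measurable fun a : Coeff => ∑ q ∈ quads S,
      a q.1 * a q.2.1 * conj (a q.2.2.1) * conj (a q.2.2.2) := by
    refine Finset.measurable_sum _ fun q _ => ?_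
    fun_prop
  fun_prop

@[fun_prop]
theorem measurable_energyN (N : ℕ) : Measurable (energyN N) := by
  have h : energyN N = fun a => -(-(Real.pi / 2 * (qform (modes N) a a a a).re) +
      1 / 2 * (mNorm (modes N) a * quartic (trig (modes N) a)) +
      4 * Real.pi * (mNorm (modes N) a * pSum (modes N) a) -
      2 * Real.pi * mNorm (modes N) a ^ 3) := by
    funext a; rw [← neg_energyN_eq, neg_neg]
  rw [h]
  fun_prop

theorem l2norm_trig_le_iff (S : Finset ℤ) (a : Coeff) {B : ℝ} (hB : 0 ≤ B) :
    l2norm (trig S a) ≤ B ↔ mNorm S a ≤ (B / √(2 * Real.pi)) ^ 2 := by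
  have hp : 0 < 2 * Real.pi := by positivity
  rw [l2norm, Real.sqrt_le_left hB, mass_trig, ← mNorm, div_pow, Real.sq_sqrt hp.le, le_div_iff₀ hp,
    mul_comm]

@[fun_prop]
theorem measurable_RN {B : ℝ} (hB : 0 ≤ B) (N : ℕ) : Measurable (RN B N) := by
  unfold RN
  simp_rw [trunc_eq_trig, l2norm_trig_le_iff _ _ hB]
  exact Measurable.ite (measurableSet_le (by fun_prop) measurable_const) (by fun_prop) (by fun_prop)

@[fun_prop]
theorem measurable_embed (N : ℕ) : Measurable (embed N) := by
  refine measurable_pi_lambda _ fun n => ?_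
  unfold embed
  by_cases h : n ∈ modes N <;> simp only [h, dite_true, dite_false] <;> fun_prop

theorem measurableSet_isGood (S : Finset ℤ) (b A : ℝ) : MeasurableSet {y | IsGood S b A y} := by
  have : {y | IsGood S b A y} = {y | mNorm S y ≤ b ^ 2} ∩ {y | ‖qform S y y y y‖ ≤ A} ∩
      {y | √(tripleNorm S y) ≤ A} ∩ {y | √(pairNorm S y) ≤ A} ∩ {y | sNorm S y ≤ A} ∩
      {y | |pSum S y| ≤ A} := by
    ext y
    constructor
    · rintro ⟨h1, h2, h3, h4, h5, h6⟩; exact ⟨⟨⟨⟨⟨h1, h2⟩, h3⟩, h4⟩, h5⟩, h6⟩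
    · rintro ⟨⟨⟨⟨⟨h1, h2⟩, h3⟩, h4⟩, h5⟩, h6⟩; exact ⟨h1, h2, h3, h4, h5, h6⟩
  rw [this]
  refine (((((measurableSet_le ?_ measurable_const).inter (measurableSet_le ?_ measurable_const)).inter
    (measurableSet_le ?_ measurable_const)).inter (measurableSet_le ?_ measurable_const)).inter
    (measurableSet_le ?_ measurable_const)).inter (measurableSet_le ?_ measurable_const) <;> fun_prop

/-! ### Dependence on finitely many coefficients -/

section Congr

variable {S : Finset ℤ} {a b : Coeff}

theorem mNorm_congr (h : ∀ n ∈ S, a n = b n) : mNorm S a = mNorm S b :=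
  Finset.sum_congr rfl fun n hn => by rw [h n hn]

theorem pSum_congr (h : ∀ n ∈ S, a n = b n) : pSum S a = pSum S b :=
  Finset.sum_congr rfl fun n hn => by rw [h n hn]

theorem sNorm_congr (h : ∀ n ∈ S, a n = b n) : sNorm S a = sNorm S b :=
  Finset.sum_congr rfl fun n hn => by rw [h n hn]

theorem qform_congr (h : ∀ n ∈ S, a n = b n) : qform S a a a a = qform S b b b b :=
  Finset.sum_congr rfl fun q hq => by
    obtain ⟨⟨h1, h2, h3, h4⟩, _⟩ := mem_quads.1 hq
    rw [h _ h1, h _ h2, h _ h3, h _ h4]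

theorem tripleNorm_congr (h : ∀ n ∈ S, a n = b n) : tripleNorm S a = tripleNorm S b := by
  refine Finset.sum_congr rfl fun k _ => ?_
  congr 3
  refine Finset.sum_congr rfl fun q hq => ?_
  obtain ⟨⟨h1, h2, h3, h4⟩, _⟩ := mem_quads.1 (Finset.mem_filter.1 hq).1
  rw [h _ h1, h _ h2, h _ h3]

theorem pairNorm_congr (h : ∀ n ∈ S, a n = b n) : pairNorm S a = pairNorm S b := by
  refine Finset.sum_congr rfl fun k _ => ?_
  congr 3
  refine Finset.sum_congr rfl fun q hq => ?_
  obtain ⟨h1, h2⟩ := Finset.mem_product.1 (Finset.mem_filter.1 hq).1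
  rw [h _ h1, h _ h2]

theorem IsGood.congr {c A : ℝ} (h : ∀ n ∈ S, a n = b n) (ha : IsGood S c A a) : IsGood S c A b :=
  ⟨mNorm_congr h ▸ ha.mass_le, qform_congr h ▸ ha.form_le, tripleNorm_congr h ▸ ha.triple_le,
    pairNorm_congr h ▸ ha.pair_le, sNorm_congr h ▸ ha.wts_le, pSum_congr h ▸ ha.mom_le⟩

end Congr

theorem trunc_congr {N : ℕ} {a b : Coeff} (h : ∀ n ∈ modes N, a n = b n) :
    trunc N a = trunc N b := by
  funext x
  exact Finset.sum_congr rfl fun n hn => by rw [h n hn]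

theorem RN_congr {N : ℕ} {a b : Coeff} (h : ∀ n ∈ modes N, a n = b n) (B : ℝ) :
    RN B N a = RN B N b := by
  simp only [RN, energyN, trunc_congr h]

theorem embed_apply {N : ℕ} {n : ℤ} (hn : n ∈ modes N) (w : modes N → ℂ) :
    embed N w n = w ⟨n, hn⟩ := dif_pos hn

/-- The projection `P_N` on coefficients. -/
def cut (N : ℕ) (a : Coeff) : Coeff := embed N ((modes N).restrict a)

theorem cut_apply {N : ℕ} {n : ℤ} (hn : n ∈ modes N) (a : Coeff) : cut N a n = a n :=
  embed_apply hn _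

/-! ### The small ball probability -/

theorem modeLaw_closedBall_pos (n : ℤ) {r : ℝ} (hr : 0 < r) :
    0 < modeLaw n (Metric.closedBall 0 r) := by
  have hac : (volume : Measure ℂ) ≪ modeLaw n := by
    rw [modeLaw_eq_withDensity]
    refine withDensity_absolutelyContinuous' (by fun_prop) (ae_of_all _ fun z => ?_)
    simpa using modePDF_pos n z
  refine pos_iff_ne_zero.2 fun h => ?_
  exact (Metric.measure_closedBall_pos volume (0 : ℂ) hr).ne' (hac h)

/-- The ball contains a product of discs, each of positive measure for its mode. -/
theorem wiener_mNorm_le_pos (S : Finset ℤ) {c : ℝ} (hc : 0 < c) :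
    0 < wiener {a | mNorm S a ≤ c} := by
  set r : ℝ := √(c / (S.card + 1)) with hr
  have hr0 : 0 < r := Real.sqrt_pos.2 (by positivity)
  have h1 : wiener (Set.pi S fun _ => Metric.closedBall (0 : ℂ) r) =
      ∏ n ∈ S, modeLaw n (Metric.closedBall 0 r) :=
    Measure.infinitePi_pi _ fun n _ => measurableSet_closedBall
  have h2 : 0 < wiener (Set.pi S fun _ => Metric.closedBall (0 : ℂ) r) := by
    rw [h1, pos_iff_ne_zero, Finset.prod_ne_zero_iff]
    exact fun n _ => (modeLaw_closedBall_pos n hr0).ne'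
  refine h2.trans_le (measure_mono fun a ha => ?_)
  have h3 : ∀ n ∈ S, ‖a n‖ ^ 2 ≤ c / (S.card + 1) := by
    intro n hn
    have : ‖a n‖ ≤ r := by simpa using ha n hn
    calc ‖a n‖ ^ 2 ≤ r ^ 2 := pow_le_pow_left₀ (norm_nonneg _) this 2
      _ = _ := Real.sq_sqrt (by positivity)
  refine (Finset.sum_le_card_nsmul S _ _ h3).trans ?_
  rw [nsmul_eq_mul, mul_div_assoc', div_le_iff₀ (by positivity)]
  nlinarith

theorem integral_mNorm_le (S : Finset ℤ) :
    ∫ a, mNorm S a ∂wiener ≤ momentBound * ∑ n ∈ S, (wt n)⁻¹ := by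
  unfold mNorm
  rw [integral_finsetSum _ fun n _ => (AllLp.coord n).norm_sq.integrable, Finset.mul_sum]
  refine Finset.sum_le_sum fun n _ => ?_
  simp_rw [norm_sq_eq_nsq]
  rw [integral_const_mul, mul_comm]
  exact mul_le_mul_of_nonneg_right (integral_nsq_le n) (inv_wt_nonneg n)

theorem indep_mNorm {S T : Finset ℤ} (h : Disjoint S T) :
    IndepFun (mNorm S) (mNorm T) wiener := by
  have h0 : iIndepFun (fun (n : ℤ) (a : Coeff) => a n) wiener :=
    iIndepFun_infinitePi (P := modeLaw) (X := fun _ z => z) (fun _ => by fun_prop)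
  have h1 := h0.indepFun_finset S T h fun n => by fun_prop
  have h2 := h1.comp (φ := fun w : S → ℂ => ∑ n, ‖w n‖ ^ 2) (ψ := fun w : T → ℂ => ∑ n, ‖w n‖ ^ 2)
    (by fun_prop) (by fun_prop)
  convert h2 using 1 <;> funext a
  · exact (Finset.sum_coe_sort S fun n => ‖a n‖ ^ 2).symm
  · exact (Finset.sum_coe_sort T fun n => ‖a n‖ ^ 2).symm

theorem mul_measure_lt_le {X : Coeff → ℝ} (hX : Integrable X wiener) (h0 : ∀ a, 0 ≤ X a) {C c : ℝ}
    (hC : ∫ a, X a ∂wiener ≤ C) (hc : 0 < c) :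
    wiener {a | c < X a} ≤ ENNReal.ofReal (C / c) := by
  have h1 := mul_meas_ge_le_integral_of_nonneg (ae_of_all _ h0) hX c
  have h2 : wiener.real {a | c ≤ X a} ≤ C / c := by
    rw [le_div_iff₀ hc]; linarith
  calc wiener {a | c < X a} ≤ wiener {a | c ≤ X a} :=
        measure_mono fun a (ha : c < X a) => (le_of_lt ha : c ≤ X a)
    _ = ENNReal.ofReal (wiener.real {a | c ≤ X a}) := (ofReal_measureReal).symm
    _ ≤ _ := ENNReal.ofReal_le_ofReal h2

/-- Beyond some `M` the expected mass is below `c/4`, so by Markov's inequality the tail has mass at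
most `c/2` with probability at least one half. The finitely many lower modes are independent of it,
and their small ball has positive probability. -/
theorem exists_le_wiener_mNorm_le {c : ℝ} (hc : 0 < c) :
    ∃ p : ℝ≥0∞, 0 < p ∧ ∀ N, p ≤ wiener {a | mNorm (modes N) a ≤ c} := by
  have m1 := one_le_momentBound
  have hU : Tendsto modes atTop atTop := by
    refine Filter.tendsto_atTop_finset_of_monotone (fun _ _ h => modes_mono h) fun n => ?_
    exact ⟨n.natAbs, by simp only [modes, Finset.mem_Icc]; omega⟩
  have hT := summable_inv_wt.hasSum.comp hU
  have hT' := hT.eventually (lt_mem_nhds (a := K₁ - c / (4 * momentBound))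
    (by have : 0 < c / (4 * momentBound) := by positivity
        unfold K₁; linarith))
  obtain ⟨M, hM⟩ := hT'.exists
  simp only [Function.comp] at hM
  refine ⟨wiener {a | mNorm (modes M) a ≤ c / 2} * ENNReal.ofReal (1 / 2),
    ENNReal.mul_pos (wiener_mNorm_le_pos _ (by positivity)).ne' (by simp), fun N => ?_⟩
  set S := modes (max N M) with hS
  have hMS : modes M ⊆ S := modes_mono (le_max_right _ _)
  have hNS : modes N ⊆ S := modes_mono (le_max_left _ _)
  have htail : ENNReal.ofReal (1 / 2) ≤ wiener {a | mNorm (S \ modes M) a ≤ c / 2} := by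
    have h1 : ∫ a, mNorm (S \ modes M) a ∂wiener ≤ c / 4 := by
      refine (integral_mNorm_le _).trans ?_
      have h2 := Finset.sum_sdiff hMS (f := fun n => (wt n)⁻¹)
      have h3 := sum_inv_wt_le S
      have h4 : ∑ n ∈ S \ modes M, (wt n)⁻¹ ≤ c / (4 * momentBound) := by linarith
      calc _ ≤ momentBound * (c / (4 * momentBound)) :=
            mul_le_mul_of_nonneg_left h4 (by linarith)
        _ = _ := by field_simp
    have h2 := mul_measure_lt_le (AllLp.mNorm (S \ modes M)).integrable
      (fun a => mNorm_nonneg _ a) h1 (half_pos hc)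
    have h3 : {a | mNorm (S \ modes M) a ≤ c / 2} = {a | c / 2 < mNorm (S \ modes M) a}ᶜ := by
      ext a; simp
    rw [h3, prob_compl_eq_one_sub (measurableSet_lt measurable_const (by fun_prop))]
    refine le_trans ?_ (tsub_le_tsub_left h2 1)
    rw [← ENNReal.ofReal_one, ← ENNReal.ofReal_sub _ (by positivity)]
    refine ENNReal.ofReal_le_ofReal (le_of_eq ?_)
    field_simp; norm_num
  have hind := (indep_mNorm (Finset.disjoint_sdiff (s := modes M) (t := S))).measure_inter_preimage_eq_mul
    (Set.Iic (c / 2)) (Set.Iic (c / 2)) measurableSet_Iic measurableSet_Iic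
  calc _ ≤ wiener (mNorm (modes M) ⁻¹' Set.Iic (c / 2)) *
        wiener (mNorm (S \ modes M) ⁻¹' Set.Iic (c / 2)) := mul_le_mul_right htail _
    _ = _ := hind.symm
    _ ≤ _ := by
      refine measure_mono fun a ha => ?_
      have h1 : mNorm (modes M) a ≤ c / 2 := ha.1
      have h2 : mNorm (S \ modes M) a ≤ c / 2 := ha.2
      have h3 := mNorm_sub_eq hMS a
      have h4 := mNorm_sub_eq hNS a
      have h5 := mNorm_nonneg (S \ modes N) a
      change mNorm (modes N) a ≤ c
      linarith

/-! ### The good set -/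

/-- The sum of the quantities that control `IsGood`. -/
def badness (S : Finset ℤ) (a : Coeff) : ℝ :=
  ‖wickForm S a‖ ^ 2 + pSum S a ^ 2 + (∑ n ∈ S, (n : ℝ) * ‖a n‖ ^ 4) ^ 2 +
    ∑ k ∈ S, ‖wickTriple S a k‖ ^ 2 * (wt k)⁻¹ +
    ∑ d ∈ (diffs S).erase 0, ‖pairCoeff S a d‖ ^ 2 * (wt d)⁻¹ + sNorm S a

/-- Since `k² (wt k)⁻¹ ≤ 1`, the paired part in `H⁻¹` costs only the momentum and the mass, the
latter being at most `1`. -/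
theorem norm_tripleCoeff_sq_le (S : Finset ℤ) (a : Coeff) (hm : mNorm S a ≤ 1) {k : ℤ} (hk : k ∈ S) :
    ‖tripleCoeff S a k‖ ^ 2 * (wt k)⁻¹ ≤
      2 * (‖wickTriple S a k‖ ^ 2 * (wt k)⁻¹) + (16 * pSum S a ^ 2 + 64) * ‖a k‖ ^ 2 := by
  have i0 := inv_wt_nonneg k
  have i1 : (wt k)⁻¹ ≤ 1 := inv_le_one_of_one_le₀ (one_le_wt k)
  have hak : ‖a k‖ ^ 2 ≤ mNorm S a :=
    Finset.single_le_sum (f := fun n => ‖a n‖ ^ 2) (fun n _ => sq_nonneg _) hk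
  set r : ℝ := 2 * (pSum S a + k * mNorm S a) - 2 * k * ‖a k‖ ^ 2 with hr
  have hr2 : r ^ 2 ≤ 8 * pSum S a ^ 2 + 32 * (k : ℝ) ^ 2 := by
    have e : r = 2 * pSum S a + 2 * k * (mNorm S a - ‖a k‖ ^ 2) := by rw [hr]; ring
    have h0 : 0 ≤ mNorm S a - ‖a k‖ ^ 2 := by linarith
    have h1 : mNorm S a - ‖a k‖ ^ 2 ≤ 1 := by nlinarith [sq_nonneg ‖a k‖]
    have h2 : (mNorm S a - ‖a k‖ ^ 2) ^ 2 ≤ 1 := pow_le_one₀ h0 h1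
    have h3 := mul_le_mul_of_nonneg_left h2 (sq_nonneg (k : ℝ))
    rw [e]
    nlinarith [sq_nonneg (pSum S a - k * (mNorm S a - ‖a k‖ ^ 2)), sq_nonneg (k : ℝ)]
  have h1 : ‖tripleCoeff S a k‖ ^ 2 ≤ 2 * ‖wickTriple S a k‖ ^ 2 + 2 * (r ^ 2 * ‖a k‖ ^ 2) := by
    rw [tripleCoeff_eq_wickTriple_add S a hk]
    have h2 := norm_add_le (wickTriple S a k) ((r : ℂ) * a k)
    have h3 : ‖(r : ℂ) * a k‖ ^ 2 = r ^ 2 * ‖a k‖ ^ 2 := by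
      rw [norm_mul, mul_pow, Complex.norm_real, Real.norm_eq_abs, sq_abs]
    have h4 := pow_le_pow_left₀ (norm_nonneg _) h2 2
    rw [← h3]
    nlinarith [sq_nonneg (‖wickTriple S a k‖ - ‖(r : ℂ) * a k‖)]
  have h5 : r ^ 2 * (wt k)⁻¹ ≤ 8 * pSum S a ^ 2 + 32 := by
    have h6 := mul_le_mul_of_nonneg_right hr2 i0
    have h7 := sq_mul_inv_wt_le k
    have h8 := mul_le_mul_of_nonneg_left i1 (sq_nonneg (pSum S a))
    linarith
  have h9 := mul_le_mul_of_nonneg_right h1 i0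
  have h10 := mul_le_mul_of_nonneg_right h5 (sq_nonneg ‖a k‖)
  linarith

theorem isGood_of_badness_le {S : Finset ℤ} {a : Coeff} {b Λ : ℝ} (hb : 0 ≤ b) (hb1 : b ≤ 1)
    (hm : mNorm S a ≤ b ^ 2) (hΛ : badness S a ≤ Λ) : IsGood S b (100 * (1 + Λ)) a := by
  have hm1 : mNorm S a ≤ 1 := hm.trans (pow_le_one₀ hb hb1)
  have m0 := mNorm_nonneg S a
  set x := ‖wickForm S a‖
  set p := pSum S a
  set g := ∑ n ∈ S, (n : ℝ) * ‖a n‖ ^ 4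
  set t := ∑ k ∈ S, ‖wickTriple S a k‖ ^ 2 * (wt k)⁻¹ with ht
  set d := ∑ d ∈ (diffs S).erase 0, ‖pairCoeff S a d‖ ^ 2 * (wt d)⁻¹ with hd
  have t0 : 0 ≤ t := Finset.sum_nonneg fun k _ => mul_nonneg (sq_nonneg _) (inv_wt_nonneg k)
  have d0 : 0 ≤ d := Finset.sum_nonneg fun k _ => mul_nonneg (sq_nonneg _) (inv_wt_nonneg k)
  have s0 := sNorm_nonneg S a
  have hsum : x ^ 2 + p ^ 2 + g ^ 2 + t + d + sNorm S a ≤ Λ := hΛ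
  have x2 := sq_nonneg x
  have p2 := sq_nonneg p
  have g2 := sq_nonneg g
  have hx : x ≤ 1 + Λ := by nlinarith [sq_nonneg (x - 1)]
  have hp : |p| ≤ 1 + Λ := by
    rw [← sq_abs p] at p2 hsum; nlinarith [sq_nonneg (|p| - 1)]
  have hg : |g| ≤ 1 + Λ := by
    rw [← sq_abs g] at g2 hsum; nlinarith [sq_nonneg (|g| - 1)]
  have hsqrt : ∀ y, 0 ≤ y → y ≤ 100 * (1 + Λ) → √y ≤ 100 * (1 + Λ) := by
    intro y y0 hy
    rw [Real.sqrt_le_left (by linarith)]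
    nlinarith
  refine ⟨hm, ?_, hsqrt _ (tripleNorm_nonneg _ _) ?_, hsqrt _ (pairNorm_nonneg _ _) ?_, ?_, ?_⟩
  · rw [qform_eq_wickForm_add]
    refine (norm_add_le _ _).trans ?_
    rw [Complex.norm_real, Real.norm_eq_abs]
    have h1 : |4 * (p * mNorm S a) - 2 * g| ≤ 4 * |p| + 2 * |g| := by
      refine (abs_sub _ _).trans ?_
      rw [abs_mul, abs_mul, abs_mul, abs_of_nonneg m0, abs_of_pos (by norm_num : (0 : ℝ) < 4),
        abs_of_pos (by norm_num : (0 : ℝ) < 2)]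
      have := mul_le_mul_of_nonneg_left hm1 (abs_nonneg p)
      linarith
    have h2 : ‖wickForm S a‖ = x := rfl
    rw [h2]
    linarith
  · refine (Finset.sum_le_sum fun k hk => norm_tripleCoeff_sq_le S a hm1 hk).trans ?_
    rw [Finset.sum_add_distrib, ← Finset.mul_sum, ← Finset.mul_sum, ← ht, ← mNorm]
    have := mul_le_mul_of_nonneg_left hm1 (by positivity : 0 ≤ 16 * p ^ 2 + 64)
    change 2 * t + (16 * p ^ 2 + 64) * mNorm S a ≤ _
    linarith
  · have h1 : pairNorm S a ≤ d + p ^ 2 := by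
      by_cases h0 : (0 : ℤ) ∈ diffs S
      · rw [pairNorm, ← Finset.sum_erase_add _ _ h0, ← hd, pairCoeff_zero]
        simp [wt, p]
      · rw [pairNorm, ← Finset.erase_eq_of_notMem h0, ← hd]
        linarith
    linarith
  · linarith
  · linarith

theorem AllLp.badness (S : Finset ℤ) : AllLp (badness S) := by
  have h1 : AllLp fun a => wickForm S a :=
    AllLp.sum _ fun q _ => ((hasCharge_quad q).const_mul _).allLp
  have h2 : AllLp (pSum S) := AllLp.sum _ fun n _ => (AllLp.coord n).norm_sq.const_mul _
  have h3 : AllLp fun a => ∑ n ∈ S, (n : ℝ) * ‖a n‖ ^ 4 :=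
    AllLp.sum _ fun n _ => ((AllLp.coord n).norm.pow 4).const_mul _
  have h4 : AllLp fun a => ∑ k ∈ S, ‖wickTriple S a k‖ ^ 2 * (wt k)⁻¹ :=
    AllLp.sum _ fun k _ => AllLp.mul (AllLp.norm_sq (AllLp.sum _ fun q _ =>
      (((AllLp.coord _).mul (AllLp.coord _)).mul (AllLp.coord _).star).const_mul _)) (AllLp.const _)
  have h5 : AllLp fun a => ∑ d ∈ (diffs S).erase 0, ‖pairCoeff S a d‖ ^ 2 * (wt d)⁻¹ :=
    AllLp.sum _ fun k _ => AllLp.mul (AllLp.norm_sq (AllLp.sum _ fun q _ =>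
      ((AllLp.coord _).mul (AllLp.coord _).star).const_mul _)) (AllLp.const _)
  have h6 : AllLp (sNorm S) := AllLp.sum _ fun n _ => (AllLp.coord n).norm_sq.const_mul _
  exact ((((h1.norm_sq.add (h2.pow 2)).add (h3.pow 2)).add h4).add h5).add h6

theorem integral_sNorm_le (S : Finset ℤ) :
    ∫ a, sNorm S a ∂wiener ≤ momentBound * ∑' n : ℤ, wts n * (wt n)⁻¹ := by
  unfold sNorm
  rw [integral_finsetSum _ fun n _ => ((AllLp.coord n).norm_sq.const_mul _).integrable]
  calc _ ≤ ∑ n ∈ S, momentBound * (wts n * (wt n)⁻¹) := by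
        refine Finset.sum_le_sum fun n _ => ?_
        simp_rw [norm_sq_eq_nsq, ← mul_assoc]
        rw [integral_const_mul, mul_comm, mul_assoc]
        exact mul_le_mul_of_nonneg_right (integral_nsq_le n)
          (mul_nonneg (wts_pos n).le (inv_wt_nonneg n))
    _ ≤ _ := by
        rw [← Finset.mul_sum]
        refine mul_le_mul_of_nonneg_left (summable_wts_div_wt.sum_le_tsum _ fun n _ => ?_)
          (zero_le_one.trans one_le_momentBound)
        exact mul_nonneg (wts_pos n).le (inv_wt_nonneg n)

theorem exists_integral_badness_le : ∃ C, ∀ N, ∫ a, badness (modes N) a ∂wiener ≤ C := by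
  obtain ⟨C₂, h2⟩ := sqCauchy_pSum.exists_integral_sq_le
  obtain ⟨C₃, h3⟩ := sqCauchy_diag.exists_integral_sq_le
  have hw : ∀ S, AllLp fun a => wickForm S a := fun S =>
    AllLp.sum _ fun q _ => ((hasCharge_quad q).const_mul _).allLp
  have h1 : ∀ S, ∫ a, ‖wickForm S a‖ ^ 2 ∂wiener ≤ 4 * momentBound * (4 * K₁ ^ 3) := by
    intro S
    have := integral_norm_sq_wick_sub_le (Finset.empty_subset S)
    have e : ∀ a, wickForm ∅ a = 0 := fun a => by simp [wickForm, wick, quads]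
    have e' : ∑ q ∈ wick ∅, quadWeight q = 0 := by simp [wick, quads]
    simp only [e, e', sub_zero] at this
    refine this.trans (mul_le_mul_of_nonneg_left (sum_wick_quadWeight_le S) ?_)
    linarith [one_le_momentBound]
  refine ⟨4 * momentBound * (4 * K₁ ^ 3) + C₂ + C₃ + 16 * momentBound * K₁ ^ 3 +
    momentBound * K₁ ^ 2 + momentBound * ∑' n : ℤ, wts n * (wt n)⁻¹, fun N => ?_⟩
  have i1 := (hw (modes N)).norm_sq
  have i2 := (sqCauchy_pSum.allLp N).pow 2
  have i3 := (sqCauchy_diag.allLp N).pow 2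
  have i4 : AllLp fun a => ∑ k ∈ modes N, ‖wickTriple (modes N) a k‖ ^ 2 * (wt k)⁻¹ :=
    AllLp.sum _ fun k _ => AllLp.mul (AllLp.norm_sq (AllLp.sum _ fun q _ =>
      (((AllLp.coord _).mul (AllLp.coord _)).mul (AllLp.coord _).star).const_mul _)) (AllLp.const _)
  have i5 : AllLp fun a => ∑ d ∈ (diffs (modes N)).erase 0,
      ‖pairCoeff (modes N) a d‖ ^ 2 * (wt d)⁻¹ :=
    AllLp.sum _ fun k _ => AllLp.mul (AllLp.norm_sq (AllLp.sum _ fun q _ =>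
      ((AllLp.coord _).mul (AllLp.coord _).star).const_mul _)) (AllLp.const _)
  have i6 : AllLp (sNorm (modes N)) := AllLp.sum _ fun n _ => (AllLp.coord n).norm_sq.const_mul _
  unfold badness
  rw [integral_add ((((i1.add i2).add i3).add i4).add i5).integrable i6.integrable,
    integral_add (((i1.add i2).add i3).add i4).integrable i5.integrable,
    integral_add ((i1.add i2).add i3).integrable i4.integrable,
    integral_add (i1.add i2).integrable i3.integrable,
    integral_add i1.integrable i2.integrable]
  linarith [h1 (modes N), h2 N, h3 N, integral_wickTriple_le (modes N),
    integral_offDiag_pairNorm_le (modes N), integral_sNorm_le (modes N)]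

/-- The small ball has probability at least `p` for every `N`, and Markov's inequality removes at
most `p/2` of it. -/
theorem exists_le_wiener_isGood {b : ℝ} (hb : 0 < b) (hb1 : b ≤ 1) :
    ∃ A : ℝ, 0 ≤ A ∧ ∃ p : ℝ≥0∞, 0 < p ∧ ∀ N, p ≤ wiener {a | IsGood (modes N) b A a} := by
  obtain ⟨p, hp, hpN⟩ := exists_le_wiener_mNorm_le (pow_pos hb 2)
  obtain ⟨C, hC⟩ := exists_integral_badness_le
  have hp1 : p ≠ ⊤ := ((hpN 0).trans_lt (measure_lt_top _ _)).ne
  have hpr : 0 < p.toReal := ENNReal.toReal_pos hp.ne' hp1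
  have hbad0 : ∀ N a, 0 ≤ badness (modes N) a := by
    intro N a
    have t0 : 0 ≤ ∑ k ∈ modes N, ‖wickTriple (modes N) a k‖ ^ 2 * (wt k)⁻¹ :=
      Finset.sum_nonneg fun k _ => mul_nonneg (sq_nonneg _) (inv_wt_nonneg k)
    have d0 : 0 ≤ ∑ d ∈ (diffs (modes N)).erase 0, ‖pairCoeff (modes N) a d‖ ^ 2 * (wt d)⁻¹ :=
      Finset.sum_nonneg fun k _ => mul_nonneg (sq_nonneg _) (inv_wt_nonneg k)
    have s0 := sNorm_nonneg (modes N) a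
    unfold badness; positivity
  have C0 : 0 ≤ C := (integral_nonneg (hbad0 0)).trans (hC 0)
  -- With this `Λ`, `C/Λ ≤ p/2`; the summand `1` keeps `Λ` positive.
  set Λ : ℝ := (2 * C + 1) / p.toReal with hΛ
  have Λ0 : 0 < Λ := by positivity
  refine ⟨100 * (1 + Λ), by positivity, p / 2, ENNReal.half_pos hp.ne', fun N => ?_⟩
  have h1 := mul_measure_lt_le (AllLp.badness (modes N)).integrable (hbad0 N) (hC N) Λ0
  have h2 : ENNReal.ofReal (C / Λ) ≤ p / 2 := by
    rw [← ENNReal.ofReal_toReal (a := p / 2) (ENNReal.div_ne_top hp1 (by simp))]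
    refine ENNReal.ofReal_le_ofReal ?_
    rw [ENNReal.toReal_div, ENNReal.toReal_ofNat, hΛ, div_div_eq_mul_div,
      div_le_div_iff₀ (by positivity) (by norm_num)]
    nlinarith
  have h3 : {a | mNorm (modes N) a ≤ b ^ 2} ⊆
      {a | IsGood (modes N) b (100 * (1 + Λ)) a} ∪ {a | Λ < badness (modes N) a} := by
    intro a ha
    by_cases h : badness (modes N) a ≤ Λ
    · exact Or.inl (isGood_of_badness_le hb.le hb1 ha h)
    · exact Or.inr (not_le.1 h)
  have h4 : p ≤ wiener {a | IsGood (modes N) b (100 * (1 + Λ)) a} + p / 2 :=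
    (hpN N).trans ((measure_mono h3).trans ((measure_union_le _ _).trans
      (add_le_add_right (h1.trans h2) _)))
  calc p / 2 = p - p / 2 := (ENNReal.sub_half hp1).symm
    _ ≤ _ := tsub_le_iff_right.2 h4

/-! ### Uniform bounds for the densities -/

/-- Infimum-convolution with `f = R_N²` and `g = e^{-C}` on good points. Since `R_N²` is `exp(-𝒩)`
on the mass ball, the hypothesis is the bound of `exists_neg_energyN_le` with `h = x - y`, and `∫ g
dρ ≥ e^{-C} p`. -/
theorem exists_lintegral_RN_sq_le {B : ℝ} (hB : 0 < B) (hB' : B ≤ √(2 * Real.pi) / 60) :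
    ∃ D : ℝ≥0∞, D ≠ ⊤ ∧ ∀ N, ∫⁻ a, ENNReal.ofReal (RN B N a ^ 2) ∂wiener ≤ D := by
  have hs : 0 < √(2 * Real.pi) := Real.sqrt_pos.2 (by positivity)
  set b := B / √(2 * Real.pi) with hb
  have b0 : 0 < b := by positivity
  have b1 : b ≤ 1 / 60 := by rw [hb, div_le_iff₀ hs]; linarith
  obtain ⟨A, hA, p, hp, hpN⟩ := exists_le_wiener_isGood b0 (by linarith)
  obtain ⟨C, hC⟩ := exists_neg_energyN_le b0 b1 hA
  have hg0 : ENNReal.ofReal (Real.exp (-C)) * p ≠ 0 :=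
    mul_ne_zero (by simp [Real.exp_pos]) hp.ne'
  refine ⟨(ENNReal.ofReal (Real.exp (-C)) * p)⁻¹, ENNReal.inv_ne_top.2 hg0, fun N => ?_⟩
  set f : (modes N → ℂ) → ℝ≥0∞ := fun w => ENNReal.ofReal (RN B N (embed N w) ^ 2) with hf
  set G : Set (modes N → ℂ) := embed N ⁻¹' {y | IsGood (modes N) b A y} with hG
  have hGm : MeasurableSet G := measurable_embed N (measurableSet_isGood _ _ _)
  set g : (modes N → ℂ) → ℝ≥0∞ := G.indicator fun _ => ENNReal.ofReal (Real.exp (-C)) with hg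
  have hfm : Measurable f :=
    ((((measurable_RN hB.le N).comp (measurable_embed N)).pow_const 2)).ennreal_ofReal
  have key := lintegral_mul_lintegral_wiener_le (modes N) hfm (measurable_const.indicator hGm)
    (g := g) ?_
  · have e1 : ∀ a, f ((modes N).restrict a) = ENNReal.ofReal (RN B N a ^ 2) := by
      intro a
      have : RN B N (embed N ((modes N).restrict a)) = RN B N a :=
        RN_congr (fun n hn => cut_apply hn a) B
      simp only [hf, this]
    have e2 : ENNReal.ofReal (Real.exp (-C)) * p ≤ ∫⁻ a, g ((modes N).restrict a) ∂wiener := by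
      have hpre : MeasurableSet ((modes N).restrict ⁻¹' G : Set Coeff) :=
        (measurePreserving_restrict (modes N)).measurable hGm
      have : ∀ a : Coeff, g ((modes N).restrict a) = ((modes N).restrict ⁻¹' G).indicator
          (fun _ => ENNReal.ofReal (Real.exp (-C))) a := fun a => rfl
      simp_rw [this]
      rw [lintegral_indicator_const hpre]
      refine mul_le_mul_right ((hpN N).trans (measure_mono fun a ha => ?_)) _
      exact IsGood.congr (fun n hn => (cut_apply hn a).symm) ha
    simp_rw [e1] at key
    rw [ENNReal.le_inv_iff_mul_le]
    exact (mul_le_mul_right e2 _).trans key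
  -- Unless `y` is good and `x` lies in the mass ball, the left side vanishes.
  · intro x y
    by_cases hy : y ∈ G
    swap
    · rw [hg, Set.indicator_of_notMem hy, mul_zero]; exact zero_le
    by_cases hx : mNorm (modes N) (embed N x) ≤ b ^ 2
    swap
    · have : f x = 0 := by
        rw [hf]
        simp only [RN, trunc_eq_trig, l2norm_trig_le_iff _ _ hB.le]
        rw [if_neg hx]
        simp
      rw [this, zero_mul]; exact zero_le
    have hfx : f x = ENNReal.ofReal (Real.exp (-energyN N (embed N x))) := by
      rw [hf]
      simp only [RN, trunc_eq_trig, l2norm_trig_le_iff _ _ hB.le]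
      rw [if_pos hx, ← Real.exp_nat_mul]
      congr 2
      push_cast; ring
    rw [hfx, hg, Set.indicator_of_mem hy, ← ENNReal.ofReal_mul (Real.exp_pos _).le, ← Real.exp_add]
    refine ENNReal.ofReal_le_ofReal (Real.exp_le_exp.2 ?_)
    have h1 := hC N (embed N y) (embed N x - embed N y) hy (by rwa [add_sub_cancel])
    rw [add_sub_cancel] at h1
    have h2 : hNorm (modes N) (embed N x - embed N y) / 4 =
        ∑ n : modes N, wt n * ‖x n - y n‖ ^ 2 / 4 := by
      rw [hNorm, Finset.sum_div, ← Finset.sum_coe_sort]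
      refine Finset.sum_congr rfl fun n _ => ?_
      rw [Pi.sub_apply, embed_apply n.2, embed_apply n.2]
    linarith

/-! ### Convergence of the truncations on the circle -/

theorem integral_norm_pow_eq {α E : Type*} [MeasurableSpace α] [NormedAddCommGroup E]
    {ν : Measure α} {p : ℕ} (hp : p ≠ 0) {f : α → E} (hf : MemLp f p ν) :
    ∫ x, ‖f x‖ ^ p ∂ν = (eLpNorm f p ν).toReal ^ p := by
  rw [hf.eLpNorm_eq_integral_rpow_norm (by exact_mod_cast hp) (by simp),
    ENNReal.toReal_ofReal (by positivity)]
  simp only [ENNReal.toReal_natCast, Real.rpow_natCast]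
  rw [Real.rpow_inv_natCast_pow (by positivity) hp]

theorem tendsto_integral_norm_pow {α E : Type*} [MeasurableSpace α] [NormedAddCommGroup E]
    {ν : Measure α} {p : ℕ} (hp : p ≠ 0) {f : ℕ → α → E} {g : α → E}
    (hf : ∀ N, MemLp (f N) p ν) (hg : MemLp g p ν)
    (h : Tendsto (fun N => eLpNorm (f N - g) p ν) atTop (𝓝 0)) :
    Tendsto (fun N => ∫ x, ‖f N x‖ ^ p ∂ν) atTop (𝓝 (∫ x, ‖g x‖ ^ p ∂ν)) := by
  have : Fact ((1 : ℝ≥0∞) ≤ p) := ⟨by exact_mod_cast Nat.one_le_iff_ne_zero.2 hp⟩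
  have h1 := (((Lp.tendsto_Lp_iff_tendsto_eLpNorm'' f hf g hg).2 h).norm).pow p
  simp only [Lp.norm_toLp] at h1
  rw [integral_norm_pow_eq hp hg]
  simpa only [integral_norm_pow_eq hp (hf _)] using h1

/-- Lebesgue measure on `(0, 2π]`. -/
def arc : Measure ℝ := volume.restrict (Set.Ioc 0 (2 * Real.pi))

instance : IsFiniteMeasure arc := by unfold arc; infer_instance

theorem measurePreserving_arc :
    MeasurePreserving (fun x : ℝ => (x : AddCircle (2 * Real.pi))) arc volume := by
  simpa [arc] using AddCircle.measurePreserving_mk (2 * Real.pi) 0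

theorem mass_eq_integral_arc (f : ℝ → ℂ) : mass f = ∫ x, ‖f x‖ ^ 2 ∂arc :=
  intervalIntegral.integral_of_le (by positivity)

theorem quartic_eq_integral_arc (f : ℝ → ℂ) : quartic f = ∫ x, ‖f x‖ ^ 4 ∂arc :=
  intervalIntegral.integral_of_le (by positivity)

theorem memLp_trig (S : Finset ℤ) (a : Coeff) (p : ℝ≥0∞) : MemLp (trig S a) p arc := by
  refine MemLp.of_bound (continuous_trig S a).aestronglyMeasurable (∑ n ∈ S, ‖a n‖)
    (ae_of_all _ fun x => ?_)
  refine (norm_sum_le _ _).trans (Finset.sum_le_sum fun n _ => ?_)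
  have : Complex.I * n * x = ((n * x : ℝ) : ℂ) * Complex.I := by push_cast; ring
  rw [norm_mul, this, Complex.norm_exp_ofReal_mul_I, mul_one]

theorem tendsto_modes : Tendsto modes atTop atTop := by
  refine Filter.tendsto_atTop_finset_of_monotone (fun _ _ h => modes_mono h) fun n => ?_
  exact ⟨n.natAbs, by simp only [modes, Finset.mem_Icc]; omega⟩

theorem memLp_realize {a : Coeff} (h : Memℓp a 2) : MemLp (realize a) 2 arc := by
  rw [realize, dif_pos h]
  refine MemLp.comp_measurePreserving (ν := volume) ?_ measurePreserving_arc
  rw [AddCircle.volume_eq_smul_haarAddCircle]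
  exact (Lp.memLp _).smul_measure ENNReal.ofReal_ne_top

/-- The truncations are symmetric partial sums of the Fourier expansion. Passing from normalized
Haar measure to Lebesgue measure only changes the norms by a constant factor. -/
theorem tendsto_eLpNorm_trunc_sub {a : Coeff} (h : Memℓp a 2) :
    Tendsto (fun N => eLpNorm (trunc N a - realize a) 2 arc) atTop (𝓝 0) := by
  set F := (fourierBasis (T := 2 * Real.pi)).repr.symm (⟨a, h⟩ : lp (fun _ : ℤ => ℂ) 2) with hF
  have h1 := ((fourierBasis (T := 2 * Real.pi)).hasSum_repr_symm
    (⟨a, h⟩ : lp (fun _ : ℤ => ℂ) 2)).comp tendsto_modes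
  rw [← hF, coe_fourierBasis] at h1
  have h2 := (Lp.tendsto_Lp_iff_tendsto_eLpNorm' _ _).1 h1
  set c : ℝ≥0∞ := ENNReal.ofReal (2 * Real.pi) with hc
  have key : ∀ N, eLpNorm (trunc N a - realize a) 2 arc = c ^ (1 / (2 : ℝ≥0∞)).toReal •
      eLpNorm (((∑ n ∈ modes N, a n • fourierLp 2 n : Lp ℂ 2 AddCircle.haarAddCircle) :
        AddCircle (2 * Real.pi) → ℂ) - (F : AddCircle (2 * Real.pi) → ℂ)) 2
          AddCircle.haarAddCircle := by
    intro N
    set G : AddCircle (2 * Real.pi) → ℂ := fun x => ∑ n ∈ modes N, a n * fourier n x with hG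
    have e1 : ((∑ n ∈ modes N, a n • fourierLp 2 n : Lp ℂ 2 AddCircle.haarAddCircle) :
        AddCircle (2 * Real.pi) → ℂ) =ᵐ[AddCircle.haarAddCircle] G := by
      refine (Lp.coeFn_finsetSum _ _).trans ?_
      have : ∀ n ∈ modes N, ((a n • fourierLp 2 n : Lp ℂ 2 AddCircle.haarAddCircle) :
          AddCircle (2 * Real.pi) → ℂ) =ᵐ[AddCircle.haarAddCircle] fun x => a n * fourier n x := by
        intro n _
        filter_upwards [Lp.coeFn_smul (a n) (fourierLp (T := 2 * Real.pi) 2 n),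
          coeFn_fourierLp (T := 2 * Real.pi) 2 n] with x hx hx'
        rw [hx, Pi.smul_apply, hx', smul_eq_mul]
      have := (Finset.eventually_all (modes N)).2 this
      filter_upwards [this] with x hx
      rw [Finset.sum_apply, hG]
      exact Finset.sum_congr rfl hx
    have e2 : trunc N a - realize a = (G - (F : AddCircle (2 * Real.pi) → ℂ)) ∘ fun x : ℝ => (x : AddCircle (2 * Real.pi)) := by
      funext x
      rw [realize, dif_pos h]
      simp only [Pi.sub_apply, Function.comp, hG, trunc, ← hF]
      congr 1
      refine Finset.sum_congr rfl fun n _ => ?_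
      rw [fourier_coe_apply]
      congr 2
      have : (Real.pi : ℂ) ≠ 0 := by exact_mod_cast Real.pi_ne_zero
      push_cast
      field_simp
    have hGc : Continuous G := by rw [hG]; fun_prop
    have hm : AEStronglyMeasurable (G - (F : AddCircle (2 * Real.pi) → ℂ)) AddCircle.haarAddCircle :=
      hGc.aestronglyMeasurable.sub (Lp.aestronglyMeasurable F)
    rw [e2, eLpNorm_comp_measurePreserving (ν := volume) (hm.smul_measure _) measurePreserving_arc,
      AddCircle.volume_eq_smul_haarAddCircle, eLpNorm_smul_measure_of_ne_top (by simp)]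
    congr 1
    exact eLpNorm_congr_ae (e1.symm.sub EventuallyEq.rfl)
  simp_rw [key]
  have := ENNReal.Tendsto.const_mul (a := c ^ (1 / (2 : ℝ≥0∞)).toReal) h2
    (Or.inr (ENNReal.rpow_ne_top_of_nonneg (by simp) ENNReal.ofReal_ne_top))
  rw [mul_zero] at this
  exact this

theorem tendsto_mass_trunc {a : Coeff} (h : Memℓp a 2) :
    Tendsto (fun N => mass (trunc N a)) atTop (𝓝 (mass (realize a))) := by
  simp_rw [mass_eq_integral_arc]
  exact tendsto_integral_norm_pow two_ne_zero (fun N => memLp_trig _ _ _) (memLp_realize h)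
    (tendsto_eLpNorm_trunc_sub h)

theorem trig_sub_trig {S T : Finset ℤ} (h : S ⊆ T) (a : Coeff) :
    trig T a - trig S a = trig (T \ S) a := by
  funext x
  simp only [Pi.sub_apply, trig]
  rw [← Finset.sum_sdiff h]; ring

theorem memℓp_two_of_summable {a : Coeff} (h : Summable fun n => wts n * ‖a n‖ ^ 2) :
    Memℓp a 2 := by
  refine memℓp_gen (Summable.of_nonneg_of_le (fun n => by positivity) (fun n => ?_) h)
  simp only [ENNReal.toReal_ofNat, Real.rpow_ofNat]
  nlinarith [one_le_wts n, sq_nonneg ‖a n‖]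

/-- By `H^{3/8} ⊂ L⁴` the increments of the truncations are controlled in `L⁴` by tails of a
convergent series. The limit is identified through convergence in measure, which the `L²` theory
provides. -/
theorem tendsto_quartic_trunc {a : Coeff} (h : Summable fun n => wts n * ‖a n‖ ^ 2) :
    Tendsto (fun N => quartic (trunc N a)) atTop (𝓝 (quartic (realize a))) := by
  have h2 := memℓp_two_of_summable h
  have hpos : ∀ n, 0 ≤ wts n * ‖a n‖ ^ 2 := fun n => mul_nonneg (wts_pos n).le (sq_nonneg _)
  have hmeas : AEStronglyMeasurable (realize a) arc := (memLp_realize h2).1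
  have him : TendstoInMeasure arc (fun N => trunc N a) atTop (realize a) :=
    tendstoInMeasure_of_tendsto_eLpNorm two_ne_zero (fun N => (memLp_trig _ _ 2).1) hmeas
      (tendsto_eLpNorm_trunc_sub h2)
  set τ : ℕ → ℝ := fun N => ∑' n, wts n * ‖a n‖ ^ 2 - sNorm (modes N) a with hτ
  have hτ0 : Tendsto τ atTop (𝓝 0) := by
    have := (h.hasSum.comp tendsto_modes).const_sub (∑' n, wts n * ‖a n‖ ^ 2)
    rwa [sub_self] at this
  have hbound : ∀ M N, M ≤ N →
      eLpNorm (trunc N a - trunc M a) 4 arc ≤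
        ENNReal.ofReal ((2 * Real.pi * (Kσ * τ M ^ 2)) ^ (4 : ℝ)⁻¹) := by
    intro M N hMN
    rw [trunc_eq_trig, trunc_eq_trig, trig_sub_trig (modes_mono hMN),
      (memLp_trig _ _ 4).eLpNorm_eq_integral_rpow_norm (by simp) (by simp)]
    simp only [ENNReal.toReal_ofNat, Real.rpow_ofNat]
    rw [← quartic_eq_integral_arc]
    have hs0 := sNorm_nonneg (modes N \ modes M) a
    refine ENNReal.ofReal_le_ofReal (Real.rpow_le_rpow (quartic_nonneg _)
      ((quartic_trig_le_sNorm _ _).trans ?_) (by norm_num))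
    have h3 : sNorm (modes N \ modes M) a ≤ τ M := by
      have h4 := Finset.sum_sdiff (modes_mono hMN) (f := fun n => wts n * ‖a n‖ ^ 2)
      have h5 := h.sum_le_tsum (modes N) fun n _ => hpos n
      simp only [hτ, sNorm] at h4 ⊢
      linarith
    have := Kσ_nonneg
    gcongr
  have hlim : ∀ M, eLpNorm (trunc M a - realize a) 4 arc ≤
      ENNReal.ofReal ((2 * Real.pi * (Kσ * τ M ^ 2)) ^ (4 : ℝ)⁻¹) := by
    intro M
    rw [← eLpNorm_neg, neg_sub]
    -- Fatou's lemma in `N` at fixed `M` passes the bound to the limit function.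
    refine eLpNorm_le_of_tendstoInMeasure (u := atTop) (f := fun N => trunc N a - trunc M a)
      (eventually_atTop.2 ⟨M, fun N hN => hbound M N hN⟩) ?_
      fun N => ((memLp_trig _ _ 2).sub (memLp_trig _ _ 2)).1
    rw [tendstoInMeasure_iff_norm] at him ⊢
    simpa using him
  have h0 : Tendsto (fun N => eLpNorm (trunc N a - realize a) 4 arc) atTop (𝓝 0) := by
    refine tendsto_of_tendsto_of_tendsto_of_le_of_le tendsto_const_nhds ?_ (fun N => zero_le) hlim
    have : Tendsto (fun N => (2 * Real.pi * (Kσ * τ N ^ 2)) ^ (4 : ℝ)⁻¹) atTop (𝓝 0) := by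
      have h1 : Tendsto (fun N => 2 * Real.pi * (Kσ * τ N ^ 2)) atTop (𝓝 0) := by
        simpa using ((hτ0.pow 2).const_mul Kσ).const_mul (2 * Real.pi)
      have := h1.rpow_const (p := (4 : ℝ)⁻¹) (Or.inr (by norm_num))
      rwa [Real.zero_rpow (by norm_num)] at this
    simpa using ENNReal.tendsto_ofReal this
  have hF4 : MemLp (realize a) 4 arc := by
    refine ⟨hmeas, ?_⟩
    have e : realize a = trunc 0 a - (trunc 0 a - realize a) := by abel
    rw [e]
    refine (eLpNorm_sub_le (memLp_trig _ _ 4).1 ((memLp_trig _ _ 4).1.sub hmeas) (by norm_num)).trans_lt ?_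
    exact ENNReal.add_lt_top.2 ⟨(memLp_trig _ _ 4).2, (hlim 0).trans_lt ENNReal.ofReal_lt_top⟩
  simp_rw [quartic_eq_integral_arc]
  exact tendsto_integral_norm_pow (p := 4) (by norm_num) (fun N => memLp_trig _ _ _) hF4 h0

/-! ### Almost sure regularity -/

theorem ae_summable_of_integral_le {f : ℤ → Coeff → ℝ} (hf : ∀ n a, 0 ≤ f n a)
    (hi : ∀ n, Integrable (f n) wiener) {u : ℤ → ℝ} (hu : Summable u)
    (h : ∀ n, ∫ a, f n a ∂wiener ≤ u n) : ∀ᵐ a ∂wiener, Summable fun n => f n a := by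
  have h1 : ∫⁻ a, ∑' n, ENNReal.ofReal (f n a) ∂wiener ≠ ⊤ := by
    rw [lintegral_tsum fun n => (hi n).1.aemeasurable.ennreal_ofReal]
    refine ne_top_of_le_ne_top hu.tsum_ofReal_ne_top (ENNReal.tsum_le_tsum fun n => ?_)
    rw [← ofReal_integral_eq_lintegral_ofReal (hi n) (ae_of_all _ (hf n))]
    exact ENNReal.ofReal_le_ofReal (h n)
  filter_upwards [ae_lt_top' (AEMeasurable.tsum fun n =>
    (hi n).1.aemeasurable.ennreal_ofReal) h1] with a ha
  have := ENNReal.summable_toReal ha.ne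
  simpa only [ENNReal.toReal_ofReal (hf _ a)] using this

theorem ae_summable_wts : ∀ᵐ a ∂wiener, Summable fun n => wts n * ‖a n‖ ^ 2 := by
  refine ae_summable_of_integral_le (fun n a => mul_nonneg (wts_pos n).le (sq_nonneg _))
    (fun n => ((AllLp.coord n).norm_sq.const_mul _).integrable)
    (summable_wts_div_wt.mul_left momentBound) fun n => ?_
  simp_rw [norm_sq_eq_nsq, ← mul_assoc]
  rw [integral_const_mul, mul_comm, mul_assoc]
  exact mul_le_mul_of_nonneg_right (integral_nsq_le n)
    (mul_nonneg (wts_pos n).le (inv_wt_nonneg n))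

/-! ### Convergence of the densities -/

theorem RN_nonneg (B : ℝ) (N : ℕ) (a : Coeff) : 0 ≤ RN B N a := by
  unfold RN; split_ifs <;> positivity

theorem R_nonneg (B : ℝ) (a : Coeff) : 0 ≤ R B a := by
  unfold R; split_ifs <;> positivity

theorem mass_trunc_le_mass_realize {a : Coeff} (h : Memℓp a 2) (N : ℕ) :
    mass (trunc N a) ≤ mass (realize a) := by
  have hmono : Monotone fun N => mass (trunc N a) := by
    intro M N hMN
    simp only [trunc_eq_trig, mass_trig]
    gcongr
    exact modes_mono hMN
  exact hmono.ge_of_tendsto (tendsto_mass_trunc h) N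

/-- The masses of the truncations increase to that of `v`. If the latter is within the cutoff, so
are all truncations, and otherwise they eventually leave it; hence the boundary `‖v‖ = B` needs no
separate argument. -/
theorem tendsto_RN_of_tendsto {B : ℝ} {a : Coeff} {ns : ℕ → ℕ} (hns : Tendsto ns atTop atTop)
    (hs : Summable fun n => wts n * ‖a n‖ ^ 2)
    (hm : Tendsto (fun i => momentum (trunc (ns i) a)) atTop (𝓝 (momentumLim a)))
    (hc : Tendsto (fun i => cubic (trunc (ns i) a)) atTop (𝓝 (cubicLim a))) :
    Tendsto (fun i => RN B (ns i) a) atTop (𝓝 (R B a)) := by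
  have h2 := memℓp_two_of_summable hs
  have hmass := (tendsto_mass_trunc h2).comp hns
  have hquart := (tendsto_quartic_trunc hs).comp hns
  have hE : Tendsto (fun i => energyN (ns i) a) atTop (𝓝 (energy a)) := by
    unfold energyN energy energyExpr
    exact (((hc.const_mul _).sub ((hmass.mul hquart).const_mul _)).add
      ((hmass.mul hm).const_mul _)).add ((hmass.pow 3).const_mul _)
  by_cases hle : l2norm (realize a) ≤ B
  · rw [R, if_pos ⟨h2, hle⟩]
    have : ∀ i, RN B (ns i) a = Real.exp (-(1 / 2) * energyN (ns i) a) := fun i =>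
      if_pos ((Real.sqrt_le_sqrt (mass_trunc_le_mass_realize h2 _)).trans hle)
    simp_rw [this]
    exact (Real.continuous_exp.tendsto _).comp (hE.const_mul _)
  · rw [R, if_neg fun h => hle h.2]
    have h1 : Tendsto (fun i => l2norm (trunc (ns i) a)) atTop (𝓝 (l2norm (realize a))) :=
      hmass.sqrt
    refine tendsto_const_nhds.congr' ?_
    filter_upwards [h1.eventually (lt_mem_nhds (not_le.1 hle))] with i hi
    exact (if_neg (not_le.2 hi)).symm

theorem tendstoInMeasure_of_tendstoL2 {Q : ℕ → Coeff → ℝ} (hQ : SqCauchy Q) :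
    TendstoInMeasure wiener Q atTop (limL2 Q) :=
  tendstoInMeasure_of_tendsto_eLpNorm two_ne_zero (fun N => (hQ.allLp N 2 (by simp)).1)
    (measurable_limL2 Q).aestronglyMeasurable hQ.tendstoL2_limL2

/-- The singular integrals converge in `L²(ρ)`, so almost everywhere only along subsequences.
Convergence in measure is tested on subsequences, with one extraction for each integral. -/
theorem tendstoInMeasure_RN {B : ℝ} (hB : 0 ≤ B) :
    TendstoInMeasure wiener (fun N => RN B N) atTop (R B) := by
  rw [exists_seq_tendstoInMeasure_atTop_iff fun N => (measurable_RN hB N).aestronglyMeasurable]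
  intro ns hns
  obtain ⟨ms, hms, h1⟩ := ((tendstoInMeasure_of_tendstoL2 sqCauchy_momentum).comp
    hns.tendsto_atTop).exists_seq_tendsto_ae
  obtain ⟨ks, hks, h2⟩ := ((tendstoInMeasure_of_tendstoL2 sqCauchy_cubic).comp
    (hns.comp hms).tendsto_atTop).exists_seq_tendsto_ae
  refine ⟨ms ∘ ks, hms.comp hks, ?_⟩
  filter_upwards [h1, h2, ae_summable_wts] with a ha1 ha2 ha3
  exact tendsto_RN_of_tendsto (hns.comp (hms.comp hks)).tendsto_atTop ha3
    (ha1.comp hks.tendsto_atTop) ha2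

theorem exists_eLpNorm_RN_le {B : ℝ} (hB : 0 < B) (hB' : B ≤ √(2 * Real.pi) / 60) :
    ∃ D : ℝ≥0, ∀ N, eLpNorm (RN B N) 2 wiener ≤ D := by
  obtain ⟨D, hD, hDN⟩ := exists_lintegral_RN_sq_le hB hB'
  refine ⟨(D ^ (1 / (2 : ℝ))).toNNReal, fun N => ?_⟩
  rw [ENNReal.coe_toNNReal (ENNReal.rpow_ne_top_of_nonneg (by norm_num) hD),
    eLpNorm_eq_lintegral_rpow_enorm_toReal (by simp) (by simp)]
  simp only [ENNReal.toReal_ofNat]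
  refine ENNReal.rpow_le_rpow (le_trans (le_of_eq ?_) (hDN N)) (by norm_num)
  refine lintegral_congr fun a => ?_
  rw [Real.enorm_eq_ofReal (RN_nonneg B N a), ENNReal.ofReal_rpow_of_nonneg (RN_nonneg B N a)
    (by norm_num), Real.rpow_ofNat]

/-- Fatou's lemma along convergence in measure, with the uniform `L²` bound. -/
theorem memLp_R {B : ℝ} (hB : 0 < B) (hB' : B ≤ √(2 * Real.pi) / 60) : MemLp (R B) 2 wiener := by
  obtain ⟨D, hD⟩ := exists_eLpNorm_RN_le hB hB'
  have hm := fun N => (measurable_RN hB.le N).aestronglyMeasurable (μ := wiener)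
  exact ⟨(tendstoInMeasure_RN hB.le).aestronglyMeasurable hm,
    (eLpNorm_le_of_tendstoInMeasure (Eventually.of_forall hD) (tendstoInMeasure_RN hB.le) hm).trans_lt
      ENNReal.coe_lt_top⟩

/-- Where `|f| ≥ C` one has `|f| ≤ f²/C`, so the tails are at most `D²/C`. -/
theorem unifIntegrable_of_eLpNorm_two_le {α : Type*} [MeasurableSpace α] {μ : Measure α}
    {f : ℕ → α → ℝ} (hf : ∀ N, AEStronglyMeasurable (f N) μ) {D : ℝ≥0}
    (hD : ∀ N, eLpNorm (f N) 2 μ ≤ D) : UnifIntegrable f 1 μ := by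
  refine unifIntegrable_of le_rfl (by simp) hf fun ε hε => ?_
  refine ⟨(D ^ 2 / ε.toNNReal) + 1, fun N => ?_⟩
  set C : ℝ≥0 := (D ^ 2 / ε.toNNReal) + 1 with hC
  have hC0 : (C : ℝ≥0∞) ≠ 0 := by simp [hC]
  have h2 : ∫⁻ x, ‖f N x‖ₑ ^ 2 ∂μ ≤ (D : ℝ≥0∞) ^ 2 := by
    have := pow_le_pow_left₀ zero_le (hD N) 2
    rw [eLpNorm_eq_lintegral_rpow_enorm_toReal (by simp) (by simp), ← ENNReal.rpow_natCast,
      ← ENNReal.rpow_mul] at this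
    simpa using this
  rw [eLpNorm_one_eq_lintegral_enorm]
  have hpt : ∀ x, ‖({x | C ≤ ‖f N x‖₊}.indicator (f N)) x‖ₑ ≤ (C : ℝ≥0∞)⁻¹ * ‖f N x‖ₑ ^ 2 := by
    intro x
    by_cases hx : C ≤ ‖f N x‖₊
    · rw [Set.indicator_of_mem (by exact hx), sq, ← mul_assoc]
      have h3 : (C : ℝ≥0∞) ≤ ‖f N x‖ₑ := by rw [enorm_eq_nnnorm]; exact_mod_cast hx
      calc ‖f N x‖ₑ = 1 * ‖f N x‖ₑ := (one_mul _).symm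
        _ ≤ _ := by
          gcongr
          rw [← ENNReal.inv_mul_cancel hC0 ENNReal.coe_ne_top]
          gcongr
    · rw [Set.indicator_of_notMem (by exact hx)]; simp
  refine (lintegral_mono hpt).trans ?_
  rw [lintegral_const_mul' _ _ (ENNReal.inv_ne_top.2 hC0)]
  refine (mul_le_mul_right h2 _).trans ?_
  have hε' : 0 < ε.toNNReal := Real.toNNReal_pos.2 hε
  have : C⁻¹ * D ^ 2 ≤ ε.toNNReal := by
    rw [inv_mul_le_iff₀ (by positivity), hC, add_mul, div_mul_cancel₀ _ hε'.ne']
    exact le_self_add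
  calc (C : ℝ≥0∞)⁻¹ * (D : ℝ≥0∞) ^ 2 = ((C⁻¹ * D ^ 2 : ℝ≥0) : ℝ≥0∞) := by
        rw [ENNReal.coe_mul, ENNReal.coe_inv (by positivity), ENNReal.coe_pow]
    _ ≤ _ := ENNReal.coe_le_coe.2 this

theorem tendsto_eLpNorm_RN_sub_R {B : ℝ} (hB : 0 < B) (hB' : B ≤ √(2 * Real.pi) / 60) :
    Tendsto (fun N => eLpNorm (RN B N - R B) 1 wiener) atTop (𝓝 0) := by
  obtain ⟨D, hD⟩ := exists_eLpNorm_RN_le hB hB'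
  have hm := fun N => (measurable_RN hB.le N).aestronglyMeasurable (μ := wiener)
  exact tendsto_Lp_finite_of_tendstoInMeasure le_rfl (by simp) hm
    ((memLp_R hB hB').mono_exponent (by norm_num))
    (unifIntegrable_of_eLpNorm_two_le hm hD) (tendstoInMeasure_RN hB.le)

/-! ### Positivity of the partition functions -/

theorem lintegral_RN_ne_zero {B : ℝ} (hB : 0 < B) (N : ℕ) :
    ∫⁻ a, ENNReal.ofReal (RN B N a) ∂wiener ≠ 0 := by
  rw [Ne, lintegral_eq_zero_iff (measurable_RN hB.le N).ennreal_ofReal]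
  intro h
  have hb : 0 < (B / √(2 * Real.pi)) ^ 2 := by positivity
  have h1 := wiener_mNorm_le_pos (modes N) hb
  refine h1.ne' (measure_mono_null (fun a ha => ?_) (ae_iff.1 h))
  have : RN B N a = Real.exp (-(1 / 2) * energyN N a) :=
    if_pos ((l2norm_trig_le_iff (modes N) a hB.le).2 ha)
  simp [this, Real.exp_pos]

/-- The events that `v^N` lies in the cutoff ball decrease in `N` and have probability at least `p`
uniformly, so their intersection does too; almost everywhere on it `R` is an exponential. -/
theorem lintegral_R_ne_zero {B : ℝ} (hB : 0 < B) (hB' : B ≤ √(2 * Real.pi) / 60) :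
    ∫⁻ a, ENNReal.ofReal (R B a) ∂wiener ≠ 0 := by
  rw [Ne, lintegral_eq_zero_iff' (memLp_R hB hB').1.aemeasurable.ennreal_ofReal]
  intro h
  have hb : 0 < (B / √(2 * Real.pi)) ^ 2 := by positivity
  obtain ⟨p, hp, hpN⟩ := exists_le_wiener_mNorm_le hb
  set E : ℕ → Set Coeff := fun N => {a | mNorm (modes N) a ≤ (B / √(2 * Real.pi)) ^ 2} with hE
  have hanti : Antitone E := by
    intro M N hMN a ha
    have h1 := mNorm_sub_eq (modes_mono hMN) a
    have h2 := mNorm_nonneg (modes N \ modes M) a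
    have h3 : mNorm (modes N) a ≤ (B / √(2 * Real.pi)) ^ 2 := ha
    change mNorm (modes M) a ≤ _
    linarith
  have hlim := tendsto_measure_iInter_atTop (μ := wiener) (s := E)
    (fun N => (measurableSet_le (by fun_prop) measurable_const).nullMeasurableSet) hanti
    ⟨0, measure_ne_top _ _⟩
  have hinter : p ≤ wiener (⋂ N, E N) := ge_of_tendsto' hlim hpN
  refine (hp.trans_le hinter).ne' ?_
  have hnull : ∀ᵐ a ∂wiener, a ∉ ⋂ N, E N := by
    filter_upwards [h, ae_summable_wts] with a ha hs hmem
    have h2 := memℓp_two_of_summable hs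
    have hle : l2norm (realize a) ≤ B := by
      have h3 : Tendsto (fun N => l2norm (trunc N a)) atTop (𝓝 (l2norm (realize a))) :=
        (tendsto_mass_trunc h2).sqrt
      exact le_of_tendsto' h3 fun N =>
        (l2norm_trig_le_iff (modes N) a hB.le).2 (Set.mem_iInter.1 hmem N)
    rw [R, if_pos ⟨h2, hle⟩] at ha
    simp only [Pi.zero_apply, ENNReal.ofReal_eq_zero] at ha
    exact absurd ha (not_le.2 (Real.exp_pos _))
  simpa only [ae_iff, not_not, Set.ofPred_mem_eq] using hnull

/-! ### The finite-dimensional Gaussian measures -/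

theorem pi_modeLaw_eq_withDensity {ι : Type*} [Fintype ι] (n : ι → ℤ) :
    Measure.pi (fun i => modeLaw (n i)) =
      (volume : Measure (ι → ℂ)).withDensity fun w => ENNReal.ofReal (∏ i, modePDF (n i) (w i)) := by
  refine Measure.pi_eq fun s hs => ?_
  have hfint : ∀ i, Integrable (modePDF (n i)) (volume : Measure ℂ) := by
    intro i
    refine ⟨(measurable_modePDF _).aestronglyMeasurable, ?_⟩
    have h1 : modeLaw (n i) Set.univ = 1 := measure_univ
    rw [modeLaw_eq_withDensity, withDensity_apply _ MeasurableSet.univ, Measure.restrict_univ] at h1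
    rw [hasFiniteIntegral_iff_ofReal (ae_of_all _ fun z => (modePDF_pos _ z).le), h1]
    exact ENNReal.one_lt_top
  set g : ι → ℂ → ℝ := fun i => (s i).indicator (modePDF (n i)) with hg
  have hgi : ∀ i, Integrable (g i) (volume : Measure ℂ) := fun i => (hfint i).indicator (hs i)
  have g0 : ∀ i z, 0 ≤ g i z := fun i z => Set.indicator_nonneg (fun z _ => (modePDF_pos _ z).le) z
  have hbox : (Set.univ.pi s).indicator (fun w : ι → ℂ => ENNReal.ofReal (∏ i, modePDF (n i) (w i))) =
      fun w => ENNReal.ofReal (∏ i, g i (w i)) := by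
    funext w
    by_cases hw : w ∈ Set.univ.pi s
    · rw [Set.indicator_of_mem hw]
      congr 1
      exact Finset.prod_congr rfl fun i _ => (Set.indicator_of_mem (hw i trivial) _).symm
    · rw [Set.indicator_of_notMem hw]
      simp only [Set.mem_univ_pi, not_forall] at hw
      obtain ⟨i, hi⟩ := hw
      rw [Finset.prod_eq_zero (Finset.mem_univ i) (Set.indicator_of_notMem hi _), ENNReal.ofReal_zero]
  rw [withDensity_apply _ (MeasurableSet.univ_pi hs), ← lintegral_indicator (MeasurableSet.univ_pi hs),
    hbox]
  have hprod : Integrable (fun w : ι → ℂ => ∏ i, g i (w i)) volume := Integrable.fintype_prod hgi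
  rw [← ofReal_integral_eq_lintegral_ofReal hprod
      (ae_of_all _ fun w => Finset.prod_nonneg fun i _ => g0 i _)]
  have := integral_fintype_prod_volume_eq_prod (𝕜 := ℝ) g
  rw [this, ENNReal.ofReal_prod_of_nonneg fun i _ => integral_nonneg (g0 i)]
  refine Finset.prod_congr rfl fun i _ => ?_
  rw [modeLaw_eq_withDensity, withDensity_apply _ (hs i), hg]
  dsimp only
  rw [integral_indicator (hs i), ofReal_integral_eq_lintegral_ofReal (hfint i).integrableOn
    (ae_of_all _ fun z => (modePDF_pos _ z).le)]

theorem normalize_smul {α : Type*} [MeasurableSpace α] (m : Measure α) [IsProbabilityMeasure m]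
    {c : ℝ≥0∞} (h0 : c ≠ 0) (h1 : c ≠ ⊤) : normalize (c • m) = m := by
  rw [normalize, Measure.smul_apply, measure_univ, smul_smul]
  simp [ENNReal.inv_mul_cancel h0 h1]

@[fun_prop]
theorem measurable_cut (N : ℕ) : Measurable (cut N) :=
  (measurable_embed N).comp (Finset.measurable_restrict _)

/-- After normalization the Gaussian density is that of the product of the mode laws, the marginal
of `ρ` on frequencies `|n| ≤ N`. -/
theorem wienerN_eq_map_cut (N : ℕ) : wienerN N = wiener.map (cut N) := by
  have h1 : (volume : Measure (modes N → ℂ)).withDensity (fun w => ENNReal.ofReal (Real.exp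
      (-(1 / 2) * ∑ n : modes N, (1 + ((n : ℤ) : ℝ) ^ 2) * ‖w n‖ ^ 2))) =
      ENNReal.ofReal (∏ n : modes N, wt n / (2 * Real.pi))⁻¹ •
        Measure.pi fun n : modes N => modeLaw n := by
    have hc : 0 < ∏ n : modes N, wt n / (2 * Real.pi) :=
      Finset.prod_pos fun n _ => div_pos (wt_pos n) (by positivity)
    rw [pi_modeLaw_eq_withDensity, ← withDensity_smul' _ _ ENNReal.ofReal_ne_top]
    congr 1
    funext w
    rw [Pi.smul_apply, smul_eq_mul, ← ENNReal.ofReal_mul (inv_nonneg.2 hc.le)]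
    congr 1
    unfold modePDF
    rw [Finset.prod_mul_distrib, ← mul_assoc, inv_mul_cancel₀ hc.ne', one_mul, ← Real.exp_sum,
      ← Finset.mul_sum]
    rfl
  have hc : 0 < ∏ n : modes N, wt n / (2 * Real.pi) :=
    Finset.prod_pos fun n _ => div_pos (wt_pos n) (by positivity)
  rw [wienerN, h1, normalize_smul _ (by simpa only [ne_eq, ENNReal.ofReal_eq_zero, not_le, inv_pos] using hc) ENNReal.ofReal_ne_top,
    ← (measurePreserving_restrict (modes N)).map_eq,
    Measure.map_map (measurable_embed N) (Finset.measurable_restrict _)]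
  rfl

/-- `R_N` depends on `v^N` only. Hence integrals over `μ_N` become integrals over `ρ`, and all `N`
live on one probability space. -/
theorem withDensity_RN_wienerN {B : ℝ} (hB : 0 ≤ B) (N : ℕ) :
    (wienerN N).withDensity (fun a => ENNReal.ofReal (RN B N a)) =
      (wiener.withDensity fun a => ENNReal.ofReal (RN B N a)).map (cut N) := by
  have h := (measurePreserving_withDensity (μ := wiener) (ν := wienerN N) (T := cut N)
    ⟨measurable_cut N, (wienerN_eq_map_cut N).symm⟩ (measurable_RN hB N).ennreal_ofReal).map_eq
  rw [← h]
  congr 2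
  funext a
  rw [RN_congr fun n hn => cut_apply hn a]

/-! ### The Fourier–Lebesgue spaces as Polish spaces -/

section FLspace

variable {s : ℝ} {r : ℝ≥0∞}

theorem bracket_eq (n : ℤ) : bracket n = √(wt n) := rfl

theorem one_le_bracket (n : ℤ) : 1 ≤ bracket n := by
  rw [bracket_eq]; exact Real.one_le_sqrt.2 (one_le_wt n)

theorem norm_weight (s : ℝ) (a : Coeff) (n : ℤ) : ‖weight s a n‖ = bracket n ^ s * ‖a n‖ := by
  change ‖((bracket n ^ s : ℝ) : ℂ) * a n‖ = _
  rw [norm_mul, Complex.norm_real, Real.norm_of_nonneg (Real.rpow_nonneg (bracket_pos n).le s)]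

theorem toLp_surjective : Function.Surjective (FL.toLp s r) := by
  intro f
  have hb : ∀ n : ℤ, ((bracket n ^ s : ℝ) : ℂ) ≠ 0 := fun n =>
    Complex.ofReal_ne_zero.mpr (Real.rpow_pos_of_pos (bracket_pos n) s).ne'
  have h : weight s (fun n => ((bracket n ^ s : ℝ) : ℂ)⁻¹ * f n) = f := by
    funext n
    exact mul_inv_cancel_left₀ (hb n) _
  exact ⟨⟨fun n => ((bracket n ^ s : ℝ) : ℂ)⁻¹ * f n, by rw [h]; exact f.2⟩, Subtype.ext h⟩

theorem coeff_injective : Function.Injective (FL.coeff (s := s) (r := r)) := Subtype.val_injective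

theorem range_coeff : Set.range (FL.coeff (s := s) (r := r)) = {a | Memℓp (weight s a) r} :=
  Subtype.range_val

theorem cut_apply_of_notMem {N : ℕ} {n : ℤ} (hn : n ∉ modes N) (a : Coeff) : cut N a n = 0 :=
  dif_neg hn

theorem memℓp_cut (N : ℕ) (a : Coeff) : Memℓp (weight s (cut N a)) r := by
  refine Memℓp.of_exponent_ge (memℓp_zero ?_) zero_le
  refine (modes N).finite_toSet.subset fun n hn => ?_
  by_contra h
  refine hn ?_
  change ((bracket n ^ s : ℝ) : ℂ) * cut N a n = 0
  rw [cut_apply_of_notMem h, mul_zero]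

/-- The projection `P_N` on `FL^{s,r}`. -/
def cutFL (N : ℕ) (v : FL s r) : FL s r := ⟨cut N v.coeff, memℓp_cut N _⟩

variable [Fact (1 ≤ r)]

theorem isometry_toLp : Isometry (FL.toLp s r) := AddMonoidHomClass.isometry_of_norm _ fun _ => rfl

theorem separableSpace_lp (hr : r ≠ ⊤) :
    TopologicalSpace.SeparableSpace (lp (fun _ : ℤ => ℂ) r) := by
  set T : Set (lp (fun _ : ℤ => ℂ) r) := Set.range fun n : ℤ => lp.single r n (1 : ℂ)
  have hT : TopologicalSpace.IsSeparable (closure (Submodule.span ℂ T : Set (lp (fun _ : ℤ => ℂ) r))) :=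
    ((Set.countable_range _).isSeparable.span (R := ℂ)).closure
  have : closure (Submodule.span ℂ T : Set (lp (fun _ : ℤ => ℂ) r)) = Set.univ := by
    refine Set.eq_univ_of_forall fun f => ?_
    refine mem_closure_of_tendsto (lp.hasSum_single hr f) (Eventually.of_forall fun S => ?_)
    refine Submodule.sum_mem _ fun n _ => ?_
    have : lp.single r n (f n) = f n • lp.single (E := fun _ : ℤ => ℂ) r n (1 : ℂ) := by
      rw [← lp.single_smul]; simp
    rw [this]
    exact Submodule.smul_mem _ _ (Submodule.subset_span ⟨n, rfl⟩)
  rw [this] at hT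
  exact TopologicalSpace.isSeparable_univ_iff.1 hT

theorem polishSpace_FL (hr : r ≠ ⊤) : PolishSpace (FL s r) := by
  have := separableSpace_lp hr
  have : SecondCountableTopology (lp (fun _ : ℤ => ℂ) r) := UniformSpace.secondCountable_of_separable _
  have : SecondCountableTopology (FL s r) :=
    (isometry_toLp (s := s) (r := r)).isUniformInducing.isInducing.secondCountableTopology
  have : CompleteSpace (FL s r) :=
    (isometry_toLp.isUniformInducing.completeSpace_congr toLp_surjective).2 inferInstance
  infer_instance

theorem continuous_coeff : Continuous (FL.coeff (s := s) (r := r)) := by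
  refine continuous_pi fun n => ?_
  have hb : ((bracket n ^ s : ℝ) : ℂ) ≠ 0 :=
    Complex.ofReal_ne_zero.mpr (Real.rpow_pos_of_pos (bracket_pos n) s).ne'
  have h1 : Continuous fun v : FL s r => ((bracket n ^ s : ℝ) : ℂ)⁻¹ * FL.toLp s r v n :=
    continuous_const.mul ((continuous_apply n).comp
      (lp.uniformContinuous_coe.continuous.comp isometry_toLp.continuous))
  refine h1.congr fun v => ?_
  exact inv_mul_cancel_left₀ hb _

/-- A continuous injection of a Polish space has Borel image and inverse (Lusin–Souslin). This is
what makes `onFL`, defined by pulling back, take the intended values on Borel sets. -/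
theorem measurableEmbedding_coeff (hr : r ≠ ⊤) :
    MeasurableEmbedding (FL.coeff (s := s) (r := r)) := by
  have := polishSpace_FL (s := s) hr
  exact continuous_coeff.measurableEmbedding coeff_injective

theorem tendsto_cutFL (hr : r ≠ ⊤) (v : FL s r) :
    Tendsto (fun N => cutFL N v) atTop (𝓝 v) := by
  rw [(isometry_toLp (s := s) (r := r)).isUniformInducing.isInducing.tendsto_nhds_iff]
  refine ((lp.hasSum_single hr (FL.toLp s r v)).comp tendsto_modes).congr fun N => ?_
  refine lp.ext (funext fun n => ?_)
  simp only [Function.comp, lp.coeFn_sum, Finset.sum_apply, lp.single_apply]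
  change _ = ((bracket n ^ s : ℝ) : ℂ) * cut N v.coeff n
  by_cases hn : n ∈ modes N
  · rw [cut_apply hn, Finset.sum_eq_single n (fun m _ hm => Pi.single_eq_of_ne hm.symm _)
      (fun h => absurd hn h), Pi.single_eq_same]
    rfl
  · rw [cut_apply_of_notMem hn, mul_zero]
    exact Finset.sum_eq_zero fun m hm => Pi.single_eq_of_ne (by rintro rfl; exact hn hm) _

end FLspace

/-! ### Gaussian tails in the Fourier–Lebesgue norm -/

/-- The `n`-th term of the `ρ`-th power of the Fourier–Lebesgue norm. -/
def flTerm (s ρ : ℝ) (n : ℤ) (a : Coeff) : ℝ := (bracket n ^ s * ‖a n‖) ^ ρ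

/-- The Fourier–Lebesgue norm of the part of `a` with frequencies in `S`. -/
def flNorm (s ρ : ℝ) (S : Finset ℤ) (a : Coeff) : ℝ := (∑ n ∈ S, flTerm s ρ n a) ^ (1 / ρ)

theorem flTerm_nonneg (s ρ : ℝ) (n : ℤ) (a : Coeff) : 0 ≤ flTerm s ρ n a :=
  Real.rpow_nonneg (mul_nonneg (Real.rpow_nonneg (bracket_pos n).le s) (norm_nonneg _)) ρ

theorem flNorm_nonneg (s ρ : ℝ) (S : Finset ℤ) (a : Coeff) : 0 ≤ flNorm s ρ S a :=
  Real.rpow_nonneg (Finset.sum_nonneg fun n _ => flTerm_nonneg s ρ n a) _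

@[fun_prop]
theorem measurable_flTerm (s ρ : ℝ) (n : ℤ) : Measurable (flTerm s ρ n) := by
  unfold flTerm
  exact Measurable.pow_const (by fun_prop) ρ

@[fun_prop]
theorem measurable_flNorm (s ρ : ℝ) (S : Finset ℤ) : Measurable (flNorm s ρ S) := by
  unfold flNorm
  exact Measurable.pow_const (by fun_prop) _

/-- The exponent `(s - 1) ρ / 2` of `wt n` makes the expected terms summable exactly under `(s - 1)
ρ < -1`. -/
theorem flTerm_eq (s : ℝ) {ρ : ℝ} (n : ℤ) (a : Coeff) :
    flTerm s ρ n a = wt n ^ ((s - 1) * ρ / 2) * ‖((√(wt n) : ℝ) : ℂ) * a n‖ ^ ρ := by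
  have w := wt_pos n
  have e1 : bracket n ^ s = wt n ^ ((s - 1) / 2) * √(wt n) := by
    rw [bracket_eq, Real.sqrt_eq_rpow, ← Real.rpow_mul w.le, ← Real.rpow_add w]
    congr 1; ring
  rw [flTerm, e1, norm_mul, Complex.norm_real, Real.norm_of_nonneg (Real.sqrt_nonneg _), mul_assoc,
    Real.mul_rpow (by positivity) (by positivity), ← Real.rpow_mul w.le]
  congr 2; ring

theorem integrable_scaled_rpow {ρ : ℝ} (hρ : 0 < ρ) (n : ℤ) :
    Integrable (fun a : Coeff => ‖((√(wt n) : ℝ) : ℂ) * a n‖ ^ ρ) wiener := by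
  have h := ((memLp_id_modeLaw_zero (p := ENNReal.ofReal ρ) (by simp)).comp_measurePreserving
    (measurePreserving_scaled n)).integrable_norm_rpow (by simpa using hρ) (by simp)
  simpa [ENNReal.toReal_ofReal hρ.le] using h

theorem integral_flTerm (s : ℝ) {ρ : ℝ} (n : ℤ) :
    ∫ a, flTerm s ρ n a ∂wiener = wt n ^ ((s - 1) * ρ / 2) * ∫ z, ‖z‖ ^ ρ ∂modeLaw 0 := by
  simp_rw [flTerm_eq]
  have hm := measurePreserving_scaled n
  rw [integral_const_mul, ← hm.map_eq, integral_map hm.measurable.aemeasurable]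
  exact (Measurable.pow_const (by fun_prop) ρ).aestronglyMeasurable

theorem integrable_flTerm (s : ℝ) {ρ : ℝ} (hρ : 0 < ρ) (n : ℤ) :
    Integrable (flTerm s ρ n) wiener := by
  have : flTerm s ρ n = fun a => wt n ^ ((s - 1) * ρ / 2) * ‖((√(wt n) : ℝ) : ℂ) * a n‖ ^ ρ :=
    funext fun a => flTerm_eq s n a
  rw [this]
  exact (integrable_scaled_rpow hρ n).const_mul _

theorem summable_integral_flTerm {s ρ : ℝ} (h : (s - 1) * ρ < -1) :
    Summable fun n => ∫ a, flTerm s ρ n a ∂wiener := by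
  simp_rw [integral_flTerm]
  exact (summable_wt_rpow (by linarith)).mul_right _

theorem ae_memℓp_weight {s : ℝ} {r : ℝ≥0∞} (hr0 : 0 < r.toReal) (h : (s - 1) * r.toReal < -1) :
    ∀ᵐ a ∂wiener, Memℓp (weight s a) r := by
  filter_upwards [ae_summable_of_integral_le (fun n a => flTerm_nonneg s r.toReal n a)
    (integrable_flTerm s hr0) (summable_integral_flTerm h) fun n => le_rfl] with a ha
  rw [memℓp_gen_iff hr0]
  simpa only [norm_weight, flTerm] using ha

theorem sum_rpow_le_rpow_sum {ι : Type*} (S : Finset ι) {x : ι → ℝ} (hx : ∀ i, 0 ≤ x i) {p : ℝ}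
    (hp : 1 ≤ p) : ∑ i ∈ S, x i ^ p ≤ (∑ i ∈ S, x i) ^ p := by
  have hX : 0 ≤ ∑ i ∈ S, x i := Finset.sum_nonneg fun i _ => hx i
  have key : ∀ y : ℝ, 0 ≤ y → y ^ p = y * y ^ (p - 1) := by
    intro y hy
    rcases hy.eq_or_lt with rfl | hy
    · rw [Real.zero_rpow (by linarith), zero_mul]
    · rw [Real.rpow_sub_one hy.ne']; field_simp
  rw [key _ hX, Finset.sum_mul]
  refine Finset.sum_le_sum fun i hi => ?_
  rw [key _ (hx i)]
  exact mul_le_mul_of_nonneg_left (Real.rpow_le_rpow (hx i)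
    (Finset.single_le_sum (fun j _ => hx j) hi) (by linarith)) (hx i)

/-- With `s ≤ 1` and `ρ ≥ 2` this is `ℓ² ⊂ ℓ^ρ` with smaller weights: the norm is `1`-Lipschitz
along Cameron–Martin directions. -/
theorem flNorm_le_sqrt_hNorm {s ρ : ℝ} (hs : s ≤ 1) (hρ : 2 ≤ ρ) (S : Finset ℤ) (h : Coeff) :
    flNorm s ρ S h ≤ √(hNorm S h) := by
  have h1 : ∀ n, flTerm s ρ n h ≤ (wt n * ‖h n‖ ^ 2) ^ (ρ / 2) := by
    intro n
    have e : (wt n * ‖h n‖ ^ 2) ^ (ρ / 2) = (bracket n * ‖h n‖) ^ ρ := by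
      have : wt n * ‖h n‖ ^ 2 = (bracket n * ‖h n‖) ^ (2 : ℝ) := by
        rw [Real.rpow_ofNat, mul_pow, bracket_eq, Real.sq_sqrt (wt_pos n).le]
      rw [this, ← Real.rpow_mul (mul_nonneg (bracket_pos n).le (norm_nonneg _))]
      congr 1; ring
    rw [e, flTerm]
    refine Real.rpow_le_rpow (mul_nonneg (Real.rpow_nonneg (bracket_pos n).le s) (norm_nonneg _))
      (mul_le_mul_of_nonneg_right ?_ (norm_nonneg _)) (by linarith)
    calc bracket n ^ s ≤ bracket n ^ (1 : ℝ) := Real.rpow_le_rpow_of_exponent_le (one_le_bracket n) hs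
      _ = _ := Real.rpow_one _
  have h2 : ∑ n ∈ S, flTerm s ρ n h ≤ hNorm S h ^ (ρ / 2) :=
    (Finset.sum_le_sum fun n _ => h1 n).trans (sum_rpow_le_rpow_sum S
      (fun n => mul_nonneg (wt_pos n).le (sq_nonneg _)) (by linarith))
  calc flNorm s ρ S h ≤ (hNorm S h ^ (ρ / 2)) ^ (1 / ρ) :=
        Real.rpow_le_rpow (Finset.sum_nonneg fun n _ => flTerm_nonneg s ρ n h) h2 (by positivity)
    _ = _ := by
        rw [← Real.rpow_mul (hNorm_nonneg S h), Real.sqrt_eq_rpow]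
        congr 1; field_simp

theorem flNorm_add_le {s ρ : ℝ} (hρ : 1 ≤ ρ) (S : Finset ℤ) (y h : Coeff) :
    flNorm s ρ S (y + h) ≤ flNorm s ρ S y + flNorm s ρ S h := by
  have b0 : ∀ n : ℤ, 0 ≤ bracket n ^ s := fun n => Real.rpow_nonneg (bracket_pos n).le s
  have := Real.Lp_add_le S (fun n => bracket n ^ s * ‖y n‖) (fun n => bracket n ^ s * ‖h n‖) hρ
  have e : ∀ n z, |bracket n ^ s * ‖(z : ℂ)‖| = bracket n ^ s * ‖z‖ := fun n z =>
    abs_of_nonneg (mul_nonneg (b0 n) (norm_nonneg _))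
  have e' : ∀ n : ℤ, |bracket n ^ s * ‖y n‖ + bracket n ^ s * ‖h n‖| =
      bracket n ^ s * ‖y n‖ + bracket n ^ s * ‖h n‖ := fun n =>
    abs_of_nonneg (add_nonneg (mul_nonneg (b0 n) (norm_nonneg _)) (mul_nonneg (b0 n) (norm_nonneg _)))
  simp only [e, e'] at this
  refine le_trans (Real.rpow_le_rpow (Finset.sum_nonneg fun n _ => flTerm_nonneg s ρ n _)
    (Finset.sum_le_sum fun n _ => ?_) (by positivity)) this
  refine Real.rpow_le_rpow (mul_nonneg (b0 n) (norm_nonneg _)) ?_ (by linarith)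
  rw [← mul_add]
  exact mul_le_mul_of_nonneg_left (norm_add_le _ _) (b0 n)

theorem flNorm_congr {s ρ : ℝ} {S : Finset ℤ} {a b : Coeff} (h : ∀ n ∈ S, a n = b n) :
    flNorm s ρ S a = flNorm s ρ S b := by
  unfold flNorm
  congr 1
  exact Finset.sum_congr rfl fun n hn => by rw [flTerm, flTerm, h n hn]

/-- Writing `φ` for the norm, `φ(x) ≤ φ(y) + ‖x - y‖` gives `φ(x)²/8 - φ(y)²/4 ≤ ‖x - y‖²/4`.
Infimum-convolution with `f = exp(φ²/8)` and `g = exp(-φ²/4)` thus bounds the exponential moment of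
`φ²`. -/
theorem exists_wiener_lt_flNorm_le {s ρ : ℝ} (hs : s ≤ 1) (hρ : 2 ≤ ρ) (h : (s - 1) * ρ < -1) :
    ∃ C : ℝ, 0 < C ∧ ∀ N (K : ℝ), 0 ≤ K → wiener {a | K < flNorm s ρ (modes N) a} ≤
      ENNReal.ofReal (C * Real.exp (-(K ^ 2 / 8))) := by
  have ρ0 : 0 < ρ := by linarith
  set T : ℝ := (∑' n, ∫ a, flTerm s ρ n a ∂wiener) + 1 with hT
  have hterm0 : ∀ n, 0 ≤ ∫ a, flTerm s ρ n a ∂wiener := fun n =>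
    integral_nonneg fun a => flTerm_nonneg s ρ n a
  have T0 : 0 < T := by
    have : 0 ≤ ∑' n, ∫ a, flTerm s ρ n a ∂wiener := tsum_nonneg hterm0
    linarith
  -- By Markov's inequality the norm is at most `L` with probability at least one half, for every
  -- `N`, whence `∫ g dρ ≥ c`.
  set L : ℝ := (2 * T) ^ (1 / ρ) with hL
  set c : ℝ := 1 / 2 * Real.exp (-(L ^ 2 / 4)) with hc
  have c0 : 0 < c := by positivity
  have hhalf : ∀ N, ENNReal.ofReal (1 / 2) ≤ wiener {a | flNorm s ρ (modes N) a ≤ L} := by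
    intro N
    have hi := fun n => integrable_flTerm s ρ0 n
    have h1 : ∫ a, ∑ n ∈ modes N, flTerm s ρ n a ∂wiener ≤ T := by
      rw [integral_finsetSum _ fun n _ => hi n]
      have := (summable_integral_flTerm h).sum_le_tsum (modes N) fun n _ => hterm0 n
      linarith
    have h2 := mul_measure_lt_le (integrable_finsetSum (modes N) fun n _ => hi n)
      (fun a => Finset.sum_nonneg fun n _ => flTerm_nonneg s ρ n a) h1 (by linarith : 0 < 2 * T)
    have hmeas : MeasurableSet {a : Coeff | 2 * T < ∑ n ∈ modes N, flTerm s ρ n a} :=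
      measurableSet_lt measurable_const (by fun_prop)
    calc ENNReal.ofReal (1 / 2) = 1 - ENNReal.ofReal (T / (2 * T)) := by
          rw [← ENNReal.ofReal_one, ← ENNReal.ofReal_sub _ (by positivity)]
          congr 1; field_simp; norm_num
      _ ≤ 1 - wiener {a | 2 * T < ∑ n ∈ modes N, flTerm s ρ n a} := tsub_le_tsub_left h2 1
      _ = wiener {a | 2 * T < ∑ n ∈ modes N, flTerm s ρ n a}ᶜ := (prob_compl_eq_one_sub hmeas).symm
      _ ≤ _ := by
          refine measure_mono fun a ha => ?_
          have ha' : ∑ n ∈ modes N, flTerm s ρ n a ≤ 2 * T := not_lt.1 ha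
          exact Real.rpow_le_rpow (Finset.sum_nonneg fun n _ => flTerm_nonneg s ρ n a) ha'
            (by positivity)
  refine ⟨c⁻¹, by positivity, fun N K hK => ?_⟩
  set f : (modes N → ℂ) → ℝ≥0∞ := fun w =>
    ENNReal.ofReal (Real.exp (flNorm s ρ (modes N) (embed N w) ^ 2 / 8)) with hf
  set g : (modes N → ℂ) → ℝ≥0∞ := fun w =>
    ENNReal.ofReal (Real.exp (-(flNorm s ρ (modes N) (embed N w) ^ 2 / 4))) with hg
  have hφ : Measurable fun w => flNorm s ρ (modes N) (embed N w) :=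
    (measurable_flNorm s ρ _).comp (measurable_embed N)
  have key := lintegral_mul_lintegral_wiener_le (modes N) (f := f) (g := g)
    (by rw [hf]; fun_prop) (by rw [hg]; fun_prop) ?_
  swap
  · intro x y
    rw [hf, hg]
    dsimp only
    rw [← ENNReal.ofReal_mul (Real.exp_pos _).le, ← Real.exp_add]
    refine ENNReal.ofReal_le_ofReal (Real.exp_le_exp.2 ?_)
    have h1 := flNorm_add_le (s := s) (by linarith : 1 ≤ ρ) (modes N) (embed N y)
      (embed N x - embed N y)
    rw [add_sub_cancel] at h1
    have h2 := h1.trans (add_le_add_right (flNorm_le_sqrt_hNorm hs hρ (modes N)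
      (embed N x - embed N y)) _)
    have h3 : hNorm (modes N) (embed N x - embed N y) / 4 =
        ∑ n : modes N, wt n * ‖x n - y n‖ ^ 2 / 4 := by
      rw [hNorm, Finset.sum_div, ← Finset.sum_coe_sort]
      refine Finset.sum_congr rfl fun n _ => ?_
      rw [Pi.sub_apply, embed_apply n.2, embed_apply n.2]
    rw [← h3]
    have h4 := Real.sq_sqrt (hNorm_nonneg (modes N) (embed N x - embed N y))
    have h5 := pow_le_pow_left₀ (flNorm_nonneg s ρ (modes N) (embed N x)) h2 2
    nlinarith [sq_nonneg (flNorm s ρ (modes N) (embed N y) -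
      √(hNorm (modes N) (embed N x - embed N y)))]
  have hres : ∀ a : Coeff, flNorm s ρ (modes N) (embed N ((modes N).restrict a)) =
      flNorm s ρ (modes N) a := fun a => flNorm_congr fun n hn => cut_apply hn a
  simp only [hf, hg, hres] at key
  have hg' : ENNReal.ofReal c ≤
      ∫⁻ a, ENNReal.ofReal (Real.exp (-(flNorm s ρ (modes N) a ^ 2 / 4))) ∂wiener := by
    have hmeas : MeasurableSet {a : Coeff | flNorm s ρ (modes N) a ≤ L} :=
      measurableSet_le (by fun_prop) measurable_const
    calc ENNReal.ofReal c = ENNReal.ofReal (Real.exp (-(L ^ 2 / 4))) * ENNReal.ofReal (1 / 2) := by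
          rw [← ENNReal.ofReal_mul (Real.exp_pos _).le, hc, mul_comm]
      _ ≤ ENNReal.ofReal (Real.exp (-(L ^ 2 / 4))) * wiener {a | flNorm s ρ (modes N) a ≤ L} := by
          gcongr; exact hhalf N
      _ = ∫⁻ a in {a | flNorm s ρ (modes N) a ≤ L},
            ENNReal.ofReal (Real.exp (-(L ^ 2 / 4))) ∂wiener := by rw [setLIntegral_const]
      _ ≤ ∫⁻ a in {a | flNorm s ρ (modes N) a ≤ L},
            ENNReal.ofReal (Real.exp (-(flNorm s ρ (modes N) a ^ 2 / 4))) ∂wiener := by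
          refine setLIntegral_mono' hmeas fun a ha => ENNReal.ofReal_le_ofReal (Real.exp_le_exp.2 ?_)
          have := pow_le_pow_left₀ (flNorm_nonneg s ρ (modes N) a) ha 2
          linarith
      _ ≤ _ := setLIntegral_le_lintegral _ _
  have hf' : ENNReal.ofReal (Real.exp (K ^ 2 / 8)) * wiener {a | K < flNorm s ρ (modes N) a} ≤
      ∫⁻ a, ENNReal.ofReal (Real.exp (flNorm s ρ (modes N) a ^ 2 / 8)) ∂wiener := by
    have hmeas : MeasurableSet {a : Coeff | K < flNorm s ρ (modes N) a} :=
      measurableSet_lt measurable_const (by fun_prop)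
    rw [← setLIntegral_const]
    refine (setLIntegral_mono' hmeas fun a ha => ENNReal.ofReal_le_ofReal (Real.exp_le_exp.2 ?_)).trans
      (setLIntegral_le_lintegral _ _)
    have := pow_le_pow_left₀ hK (le_of_lt (show K < flNorm s ρ (modes N) a from ha)) 2
    linarith
  have hfin := (mul_le_mul' hf' hg').trans key
  set p := wiener {a | K < flNorm s ρ (modes N) a}
  have e0 : ENNReal.ofReal (Real.exp (K ^ 2 / 8) * c) * p ≤ 1 := by
    rw [ENNReal.ofReal_mul (Real.exp_pos _).le]
    calc _ = ENNReal.ofReal (Real.exp (K ^ 2 / 8)) * p * ENNReal.ofReal c := by ring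
      _ ≤ 1 := hfin
  have e1 : ENNReal.ofReal (c⁻¹ * Real.exp (-(K ^ 2 / 8))) =
      (ENNReal.ofReal (Real.exp (K ^ 2 / 8) * c))⁻¹ := by
    rw [← ENNReal.ofReal_inv_of_pos (by positivity), mul_inv_rev (Real.exp _) c, ← Real.exp_neg]
  rw [e1, ENNReal.le_inv_iff_mul_le, mul_comm]
  exact e0

theorem exists_wiener_iUnion_lt_flNorm_le {s ρ : ℝ} (hs : s ≤ 1) (hρ : 2 ≤ ρ)
    (h : (s - 1) * ρ < -1) :
    ∃ C : ℝ, 0 < C ∧ ∀ K : ℝ, 0 ≤ K → wiener (⋃ N, {a | K < flNorm s ρ (modes N) a}) ≤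
      ENNReal.ofReal (C * Real.exp (-(K ^ 2 / 8))) := by
  obtain ⟨C, hC, hCN⟩ := exists_wiener_lt_flNorm_le hs hρ h
  refine ⟨C, hC, fun K hK => ?_⟩
  have hmono : Monotone fun N => {a : Coeff | K < flNorm s ρ (modes N) a} := by
    intro M N hMN a ha
    refine lt_of_lt_of_le (show K < flNorm s ρ (modes M) a from ha) ?_
    exact Real.rpow_le_rpow (Finset.sum_nonneg fun n _ => flTerm_nonneg s ρ n a)
      (Finset.sum_le_sum_of_subset_of_nonneg (modes_mono hMN) fun n _ _ => flTerm_nonneg s ρ n a)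
      (by positivity)
  rw [hmono.measure_iUnion]
  exact iSup_le fun N => hCN N K hK

theorem coeff_image_lt_norm_subset {s : ℝ} {r : ℝ≥0∞} [Fact (1 ≤ r)] (hr0 : 0 < r.toReal) {K : ℝ}
    (hK : 0 ≤ K) : FL.coeff '' {v : FL s r | K < ‖v‖} ⊆
      ⋃ N, {a | K < flNorm s r.toReal (modes N) a} := by
  rintro _ ⟨v, hv, rfl⟩
  by_contra hcon
  simp only [Set.mem_iUnion, Set.mem_ofPred_eq, not_exists, not_lt] at hcon
  refine absurd (show K < ‖v‖ from hv) (not_lt.2 ?_)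
  change ‖FL.toLp s r v‖ ≤ K
  refine lp.norm_le_of_forall_sum_le hr0 hK fun S => ?_
  obtain ⟨N, hN⟩ := (tendsto_modes.eventually (eventually_ge_atTop S)).exists
  have h1 : ∑ n ∈ S, ‖FL.toLp s r v n‖ ^ r.toReal ≤ ∑ n ∈ modes N, flTerm s r.toReal n v.coeff := by
    refine le_trans (Finset.sum_le_sum_of_subset_of_nonneg hN fun n _ _ => by positivity) (le_of_eq ?_)
    refine Finset.sum_congr rfl fun n _ => ?_
    change ‖weight s v.coeff n‖ ^ r.toReal = _
    rw [norm_weight]; rfl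
  refine h1.trans ?_
  have h2 := Real.rpow_le_rpow (flNorm_nonneg _ _ _ _) (hcon N) hr0.le
  rwa [flNorm, ← Real.rpow_mul (Finset.sum_nonneg fun n _ => flTerm_nonneg s r.toReal n v.coeff),
    one_div, inv_mul_cancel₀ hr0.ne', Real.rpow_one] at h2

/-! ### The weighted measures -/

theorem isProbabilityMeasure_normalize {α : Type*} [MeasurableSpace α] {m : Measure α}
    (h0 : m Set.univ ≠ 0) (h1 : m Set.univ ≠ ⊤) : IsProbabilityMeasure (normalize m) :=
  ⟨by rw [normalize, Measure.smul_apply, smul_eq_mul, ENNReal.inv_mul_cancel h0 h1]⟩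

theorem lintegral_ofReal_ne_top {f : Coeff → ℝ} (hf : MemLp f 2 wiener) :
    ∫⁻ a, ENNReal.ofReal (f a) ∂wiener ≠ ⊤ := by
  have h := (hf.integrable one_le_two).2
  refine ne_top_of_le_ne_top h.ne (lintegral_mono fun a => ?_)
  exact Real.ofReal_le_enorm (f a)

section Measures

variable {B : ℝ}

theorem isProbabilityMeasure_mu (hB : 0 < B) (hB' : B ≤ √(2 * Real.pi) / 60) :
    IsProbabilityMeasure (mu B) := by
  refine isProbabilityMeasure_normalize ?_ ?_ <;>
    rw [withDensity_apply _ MeasurableSet.univ, Measure.restrict_univ]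
  exacts [lintegral_R_ne_zero hB hB', lintegral_ofReal_ne_top (memLp_R hB hB')]

theorem mu_absolutelyContinuous (B : ℝ) : mu B ≪ wiener :=
  (withDensity_absolutelyContinuous _ _).smul_left _

theorem memLp_RN (hB : 0 < B) (hB' : B ≤ √(2 * Real.pi) / 60) (N : ℕ) :
    MemLp (RN B N) 2 wiener := by
  obtain ⟨D, hD⟩ := exists_eLpNorm_RN_le hB hB'
  exact ⟨(measurable_RN hB.le N).aestronglyMeasurable, (hD N).trans_lt ENNReal.coe_lt_top⟩

theorem muN_eq (hB : 0 ≤ B) (N : ℕ) :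
    muN B N = normalize ((wiener.withDensity fun a => ENNReal.ofReal (RN B N a)).map (cut N)) := by
  rw [muN, withDensity_RN_wienerN hB]

theorem map_cut_univ (N : ℕ) :
    (wiener.withDensity fun a => ENNReal.ofReal (RN B N a)).map (cut N) Set.univ =
      ∫⁻ a, ENNReal.ofReal (RN B N a) ∂wiener := by
  rw [Measure.map_apply (measurable_cut N) MeasurableSet.univ, Set.preimage_univ,
    withDensity_apply _ MeasurableSet.univ, Measure.restrict_univ]

theorem isProbabilityMeasure_muN (hB : 0 < B) (hB' : B ≤ √(2 * Real.pi) / 60) (N : ℕ) :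
    IsProbabilityMeasure (muN B N) := by
  rw [muN_eq hB.le]
  refine isProbabilityMeasure_normalize ?_ ?_ <;> rw [map_cut_univ]
  exacts [lintegral_RN_ne_zero hB N, lintegral_ofReal_ne_top (memLp_RN hB hB' N)]

end Measures

section OnFL

variable {s : ℝ} {r : ℝ≥0∞}

/-- Extension by zero of a function on `FL^{s,r}` to all coefficients. -/
def extendFL (F : FL s r → ℝ) : Coeff → ℝ := Function.extend FL.coeff F 0

theorem extendFL_coeff (F : FL s r → ℝ) (v : FL s r) : extendFL F v.coeff = F v :=
  coeff_injective.extend_apply F 0 v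

variable [Fact (1 ≤ r)]

theorem measurableSet_memℓp_weight (hr : r ≠ ⊤) : MeasurableSet {a | Memℓp (weight s a) r} := by
  rw [← range_coeff]
  exact (measurableEmbedding_coeff hr).measurableSet_range

theorem isProbabilityMeasure_onFL (hr : r ≠ ⊤) {m : Measure Coeff} [IsProbabilityMeasure m]
    (hm : ∀ᵐ a ∂m, Memℓp (weight s a) r) : IsProbabilityMeasure (onFL s r m) := by
  refine ⟨?_⟩
  rw [onFL, (measurableEmbedding_coeff hr).comap_apply, Set.image_univ, range_coeff]
  exact (mem_ae_iff_prob_eq_one (measurableSet_memℓp_weight hr)).1 hm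

theorem measurable_extendFL (hr : r ≠ ⊤) {F : FL s r → ℝ} (hF : Measurable F) :
    Measurable (extendFL F) :=
  (measurableEmbedding_coeff hr).measurable_extend hF measurable_zero

theorem norm_extendFL_le (F : FL s r →ᵇ ℝ) (a : Coeff) : ‖extendFL F a‖ ≤ ‖F‖ := by
  by_cases h : ∃ v : FL s r, v.coeff = a
  · obtain ⟨v, rfl⟩ := h
    rw [extendFL_coeff]
    exact F.norm_coe_le_norm v
  · rw [extendFL, Function.extend_apply' _ _ _ h]
    simp

theorem integral_onFL (hr : r ≠ ⊤) {m : Measure Coeff} (hm : ∀ᵐ a ∂m, Memℓp (weight s a) r)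
    (F : FL s r → ℝ) : ∫ v, F v ∂onFL s r m = ∫ a, extendFL F a ∂m := by
  have he := measurableEmbedding_coeff (s := s) hr
  have h1 := he.integral_map (μ := onFL s r m) (extendFL F)
  simp_rw [extendFL_coeff] at h1
  rw [← h1, onFL, he.map_comap, range_coeff]
  congr 1
  exact Measure.restrict_eq_self_of_ae_mem hm

theorem tendsto_extendFL_cut (hr : r ≠ ⊤) (F : FL s r →ᵇ ℝ) {a : Coeff}
    (ha : Memℓp (weight s a) r) :
    Tendsto (fun N => extendFL F (cut N a)) atTop (𝓝 (extendFL F a)) := by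
  set v : FL s r := ⟨a, ha⟩ with hv
  have h1 := (F.continuous.tendsto v).comp (tendsto_cutFL hr v)
  have h2 : extendFL F a = F v := extendFL_coeff F v
  rw [h2]
  refine h1.congr fun N => ?_
  exact (extendFL_coeff F (cutFL N v)).symm

end OnFL

/-! ### Convergence of integrals -/

/-- The weights converge in `L¹` against bounded test functions, and the test functions converge
almost everywhere under the fixed weight `f₀`, where dominated convergence applies. -/
theorem tendsto_integral_mul {α : Type*} [MeasurableSpace α] {μ : Measure α} {f : ℕ → α → ℝ}
    {f₀ : α → ℝ} (hf : ∀ N, Integrable (f N) μ) (hf₀ : Integrable f₀ μ)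
    (hlim : Tendsto (fun N => eLpNorm (f N - f₀) 1 μ) atTop (𝓝 0)) {g : ℕ → α → ℝ} {g₀ : α → ℝ}
    (hg : ∀ N, AEStronglyMeasurable (g N) μ) {M : ℝ} (hM : ∀ N x, ‖g N x‖ ≤ M)
    (hglim : ∀ᵐ x ∂μ, Tendsto (fun N => g N x) atTop (𝓝 (g₀ x))) :
    Tendsto (fun N => ∫ x, f N x * g N x ∂μ) atTop (𝓝 (∫ x, f₀ x * g₀ x ∂μ)) := by
  have h1 : Tendsto (fun N => ∫ x, f₀ x * g N x ∂μ) atTop (𝓝 (∫ x, f₀ x * g₀ x ∂μ)) := by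
    refine tendsto_integral_of_dominated_convergence (fun x => ‖f₀ x‖ * M)
      (fun N => hf₀.1.mul (hg N)) (hf₀.norm.mul_const M) (fun N => ae_of_all _ fun x => ?_) ?_
    · rw [norm_mul]
      exact mul_le_mul_of_nonneg_left (hM N x) (norm_nonneg _)
    · filter_upwards [hglim] with x hx using hx.const_mul _
  have h2 : Tendsto (fun N => (eLpNorm (f N - f₀) 1 μ).toReal * M) atTop (𝓝 0) := by
    have := ((ENNReal.tendsto_toReal ENNReal.zero_ne_top).comp hlim).mul_const M
    simpa using this
  refine tendsto_of_tendsto_of_dist h1 (squeeze_zero (fun N => dist_nonneg) (fun N => ?_) h2)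
  have i1 : Integrable (fun x => f₀ x * g N x) μ :=
    hf₀.mul_bdd (hg N) (ae_of_all _ (hM N))
  have i2 : Integrable (fun x => f N x * g N x) μ :=
    (hf N).mul_bdd (hg N) (ae_of_all _ (hM N))
  have i3 : Integrable (fun x => f N x - f₀ x) μ := (hf N).sub hf₀
  rw [dist_comm, dist_eq_norm, ← integral_sub i2 i1]
  calc ‖∫ x, f N x * g N x - f₀ x * g N x ∂μ‖ ≤ ∫ x, ‖f N x - f₀ x‖ * M ∂μ := by
        refine norm_integral_le_of_norm_le (i3.norm.mul_const M) (ae_of_all _ fun x => ?_)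
        rw [← sub_mul, norm_mul]
        exact mul_le_mul_of_nonneg_left (hM N x) (norm_nonneg _)
    _ = _ := by
        rw [integral_mul_const, integral_norm_eq_lintegral_enorm i3.1,
          eLpNorm_one_eq_lintegral_enorm]
        rfl

theorem integral_normalize {α : Type*} [MeasurableSpace α] (m : Measure α) (g : α → ℝ) :
    ∫ x, g x ∂normalize m = (m Set.univ).toReal⁻¹ * ∫ x, g x ∂m := by
  rw [normalize, integral_smul_measure, ENNReal.toReal_inv, smul_eq_mul]

theorem integral_withDensity_ofReal {α : Type*} [MeasurableSpace α] {m : Measure α} {f : α → ℝ}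
    (hf : AEMeasurable f m) (h0 : ∀ x, 0 ≤ f x) (g : α → ℝ) :
    ∫ x, g x ∂m.withDensity (fun x => ENNReal.ofReal (f x)) = ∫ x, f x * g x ∂m := by
  rw [integral_withDensity_eq_integral_toReal_smul₀ hf.ennreal_ofReal
    (ae_of_all _ fun x => ENNReal.ofReal_lt_top)]
  simp only [ENNReal.toReal_ofReal (h0 _), smul_eq_mul]

theorem integral_mu {B : ℝ} (hB : 0 < B) (hB' : B ≤ √(2 * Real.pi) / 60) (g : Coeff → ℝ) :
    ∫ a, g a ∂mu B = (∫ a, R B a ∂wiener)⁻¹ * ∫ a, R B a * g a ∂wiener := by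
  have hR := memLp_R hB hB'
  rw [mu, integral_normalize, integral_withDensity_ofReal hR.1.aemeasurable (R_nonneg B),
    withDensity_apply _ MeasurableSet.univ, Measure.restrict_univ,
    ← ofReal_integral_eq_lintegral_ofReal (hR.integrable one_le_two) (ae_of_all _ (R_nonneg B)),
    ENNReal.toReal_ofReal (integral_nonneg (R_nonneg B))]

theorem integral_muN {B : ℝ} (hB : 0 < B) (hB' : B ≤ √(2 * Real.pi) / 60) (N : ℕ)
    {g : Coeff → ℝ} (hg : Measurable g) :
    ∫ a, g a ∂muN B N = (∫ a, RN B N a ∂wiener)⁻¹ * ∫ a, RN B N a * g (cut N a) ∂wiener := by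
  have hR := memLp_RN hB hB' N
  rw [muN_eq hB.le, integral_normalize, map_cut_univ,
    ← ofReal_integral_eq_lintegral_ofReal (hR.integrable one_le_two) (ae_of_all _ (RN_nonneg B N)),
    ENNReal.toReal_ofReal (integral_nonneg (RN_nonneg B N)),
    integral_map (measurable_cut N).aemeasurable hg.aestronglyMeasurable,
    integral_withDensity_ofReal hR.1.aemeasurable (RN_nonneg B N)]

theorem ae_muN_memℓp_weight {B : ℝ} (hB : 0 ≤ B) (N : ℕ) {s : ℝ} {r : ℝ≥0∞} [Fact (1 ≤ r)]
    (hr : r ≠ ⊤) : ∀ᵐ a ∂muN B N, Memℓp (weight s a) r := by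
  rw [muN_eq hB, normalize]
  refine Measure.ae_smul_measure ?_ _
  exact (ae_map_iff (measurable_cut N).aemeasurable (measurableSet_memℓp_weight hr)).2
    (ae_of_all _ fun a => memℓp_cut N a)

/-- Written over `ρ`, the test function is evaluated at `v^N`, which tends to `v` in `FL^{s,r}`,
while the densities converge in `L¹(ρ)`. The constant test function gives the convergence of the
partition functions. -/
theorem tendsto_integral_onFL_muN {B : ℝ} (hB : 0 < B) (hB' : B ≤ √(2 * Real.pi) / 60) {s : ℝ}
    {r : ℝ≥0∞} [Fact (1 ≤ r)] (hr : r ≠ ⊤) (hw : ∀ᵐ a ∂wiener, Memℓp (weight s a) r)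
    (F : FL s r →ᵇ ℝ) :
    Tendsto (fun N => ∫ v, F v ∂onFL s r (muN B N)) atTop (𝓝 (∫ v, F v ∂onFL s r (mu B))) := by
  have hFm := measurable_extendFL hr F.continuous.measurable
  have hR := memLp_R hB hB'
  have hRN := memLp_RN hB hB'
  simp_rw [integral_onFL hr (ae_muN_memℓp_weight hB.le _ hr),
    integral_onFL hr ((mu_absolutelyContinuous B).ae_le hw), integral_muN hB hB' _ hFm,
    integral_mu hB hB']
  have hlim := tendsto_eLpNorm_RN_sub_R hB hB'
  have hZ : Tendsto (fun N => ∫ a, RN B N a ∂wiener) atTop (𝓝 (∫ a, R B a ∂wiener)) := by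
    simpa using tendsto_integral_mul (fun N => (hRN N).integrable one_le_two)
      (hR.integrable one_le_two) hlim (g := fun _ _ => 1) (g₀ := fun _ => 1)
      (fun N => aestronglyMeasurable_const) (M := 1) (fun N x => by simp)
      (ae_of_all _ fun x => tendsto_const_nhds)
  have hZ0 : ∫ a, R B a ∂wiener ≠ 0 := by
    intro h
    have := ofReal_integral_eq_lintegral_ofReal (hR.integrable one_le_two)
      (ae_of_all _ (R_nonneg B))
    rw [h, ENNReal.ofReal_zero] at this
    exact lintegral_R_ne_zero hB hB' this.symm
  refine (hZ.inv₀ hZ0).mul (tendsto_integral_mul (fun N => (hRN N).integrable one_le_two)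
    (hR.integrable one_le_two) hlim
    (fun N => (hFm.comp (measurable_cut N)).aestronglyMeasurable)
    (fun N x => norm_extendFL_le F _) ?_)
  filter_upwards [hw] with a ha using tendsto_extendFL_cut hr F ha

/-! ### The tail bound -/

theorem setLIntegral_ofReal_le {f : Coeff → ℝ} (hf : AEMeasurable f wiener) {E : Set Coeff}
    (hE : MeasurableSet E) : ∫⁻ a in E, ENNReal.ofReal (f a) ∂wiener ≤
      (∫⁻ a, ENNReal.ofReal (f a) ^ (2 : ℝ) ∂wiener) ^ (1 / (2 : ℝ)) * wiener E ^ (1 / (2 : ℝ)) := by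
  have h := ENNReal.lintegral_mul_le_Lp_mul_Lq wiener Real.HolderConjugate.two_two
    hf.ennreal_ofReal (measurable_one.indicator hE).aemeasurable (g := E.indicator 1)
  have e1 : ∀ a, ((fun a => ENNReal.ofReal (f a)) * E.indicator (1 : Coeff → ℝ≥0∞)) a =
      E.indicator (fun a => ENNReal.ofReal (f a)) a := by
    intro a
    by_cases ha : a ∈ E <;> simp [ha]
  have e2 : ∀ a, E.indicator (1 : Coeff → ℝ≥0∞) a ^ (2 : ℝ) = E.indicator 1 a := by
    intro a
    by_cases ha : a ∈ E <;> simp [ha]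
  simp_rw [e1, e2] at h
  rwa [lintegral_indicator hE, lintegral_indicator_one hE] at h

/-- Cauchy–Schwarz with `R ∈ L²(ρ)` halves the Gaussian rate `1/8`; half of the remaining `1/16` is
spent on absorbing the prefactor `A`. -/
theorem exists_onFL_mu_tail {B : ℝ} (hB : 0 < B) (hB' : B ≤ √(2 * Real.pi) / 60) {s : ℝ}
    {r : ℝ≥0∞} [Fact (1 ≤ r)] (hr2 : 2 ≤ r) (hr : r ≠ ⊤) (h : (s - 1) * r.toReal < -1) :
    ∃ c : ℝ, 0 < c ∧ ∃ K₀ : ℝ, 0 < K₀ ∧ ∀ K : ℝ, K₀ ≤ K →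
      onFL s r (mu B) {v : FL s r | K < ‖v‖} ≤ ENNReal.ofReal (Real.exp (-(c * K ^ 2))) := by
  have hρ : 2 ≤ r.toReal := by simpa using ENNReal.toReal_mono hr hr2
  have hs : s ≤ 1 := by nlinarith
  obtain ⟨C, hC, hCK⟩ := exists_wiener_iUnion_lt_flNorm_le hs hρ h
  have hR := memLp_R hB hB'
  set Z := ∫⁻ a, ENNReal.ofReal (R B a) ∂wiener with hZ
  set D := (∫⁻ a, ENNReal.ofReal (R B a) ^ (2 : ℝ) ∂wiener) ^ (1 / (2 : ℝ)) with hD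
  have hDtop : D ≠ ⊤ := by
    have h1 := hR.2
    rw [eLpNorm_eq_lintegral_rpow_enorm_toReal (by simp) (by simp)] at h1
    simp only [ENNReal.toReal_ofNat, Real.enorm_eq_ofReal (R_nonneg B _)] at h1
    exact h1.ne
  have hA : Z⁻¹ * D ≠ ⊤ :=
    ENNReal.mul_ne_top (ENNReal.inv_ne_top.2 (lintegral_R_ne_zero hB hB')) hDtop
  set A : ℝ := (Z⁻¹ * D).toReal * √C with hAdef
  have A0 : 0 ≤ A := by positivity
  refine ⟨1 / 32, by norm_num, 32 * A + 1, by positivity, fun K hK => ?_⟩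
  have K1 : 1 ≤ K := by linarith
  have K0 : 0 ≤ K := by linarith
  set E : Set Coeff := ⋃ N, {a | K < flNorm s r.toReal (modes N) a} with hE
  have hEm : MeasurableSet E :=
    MeasurableSet.iUnion fun N => measurableSet_lt measurable_const (by fun_prop)
  have hsqrt : ENNReal.ofReal (C * Real.exp (-(K ^ 2 / 8))) ^ (1 / (2 : ℝ)) =
      ENNReal.ofReal (√C * Real.exp (-(K ^ 2 / 16))) := by
    rw [ENNReal.ofReal_rpow_of_nonneg (by positivity) (by norm_num), ← Real.sqrt_eq_rpow,
      Real.sqrt_mul hC.le, ← Real.exp_half]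
    congr 4; ring
  calc onFL s r (mu B) {v : FL s r | K < ‖v‖} = mu B (FL.coeff '' {v : FL s r | K < ‖v‖}) := by
        rw [onFL, (measurableEmbedding_coeff hr).comap_apply]
    _ ≤ mu B E := measure_mono (coeff_image_lt_norm_subset (by linarith) K0)
    _ = Z⁻¹ * ∫⁻ a in E, ENNReal.ofReal (R B a) ∂wiener := by
        rw [mu, normalize, Measure.smul_apply, smul_eq_mul, withDensity_apply _ hEm,
          withDensity_apply _ MeasurableSet.univ, Measure.restrict_univ]
    _ ≤ Z⁻¹ * (D * wiener E ^ (1 / (2 : ℝ))) := by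
        gcongr
        exact setLIntegral_ofReal_le hR.1.aemeasurable hEm
    _ ≤ Z⁻¹ * (D * ENNReal.ofReal (C * Real.exp (-(K ^ 2 / 8))) ^ (1 / (2 : ℝ))) := by
        gcongr
        exact hCK K K0
    _ = ENNReal.ofReal (A * Real.exp (-(K ^ 2 / 16))) := by
        rw [hsqrt, ← mul_assoc, ← ENNReal.ofReal_toReal hA,
          ← ENNReal.ofReal_mul ENNReal.toReal_nonneg, hAdef, mul_assoc]
    _ ≤ _ := by
        refine ENNReal.ofReal_le_ofReal ?_
        -- Here `K ≥ 32 A + 1` enters: `K² ≥ K ≥ 32 A`.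
        have h1 : A ≤ Real.exp (K ^ 2 / 32) := by
          have h2 := Real.add_one_le_exp (K ^ 2 / 32)
          nlinarith
        calc A * Real.exp (-(K ^ 2 / 16)) ≤ Real.exp (K ^ 2 / 32) * Real.exp (-(K ^ 2 / 16)) :=
              mul_le_mul_of_nonneg_right h1 (Real.exp_pos _).le
          _ = _ := by rw [← Real.exp_add]; congr 1; ring

end WeightedWiener

end

theorem proposition5p10 :
    -- the two singular integrals in `𝒩` exist as limits in `L²(dρ)`
    TendstoL2 (fun N a => momentum (trunc N a)) momentumLim ∧
    TendstoL2 (fun N a => cubic (trunc N a)) cubicLim ∧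
    ∃ B₀ : ℝ, 0 < B₀ ∧ ∀ B : ℝ, 0 < B → B ≤ B₀ →
      -- (a)
      (MemLp (R B) 2 wiener ∧ IsProbabilityMeasure (mu B) ∧ mu B ≪ wiener) ∧
      ∀ (s : ℝ) (r : ℝ≥0∞) [Fact (1 ≤ r)], 2 ≤ r → r ≠ ⊤ → (s - 1) * r.toReal < -1 →
        ∃ (hμ : IsProbabilityMeasure (onFL s r (mu B)))
          (hμN : ∀ N : ℕ, IsProbabilityMeasure (onFL s r (muN B N))),
          -- (b)
          (∃ c : ℝ, 0 < c ∧ ∃ K₀ : ℝ, 0 < K₀ ∧ ∀ K : ℝ, K₀ ≤ K →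
            onFL s r (mu B) {v : FL s r | K < ‖v‖} ≤
              ENNReal.ofReal (Real.exp (-(c * K ^ 2)))) ∧
          -- (c)
          Tendsto (fun N : ℕ => asProb (onFL s r (muN B N)) (hμN N)) atTop
            (𝓝 (asProb (onFL s r (mu B)) hμ)) := by
  refine ⟨sqCauchy_momentum.tendstoL2_limL2, sqCauchy_cubic.tendstoL2_limL2,
    -- Parseval's identity carries a factor `2π`, so this is the condition `b ≤ 1/60` of
    -- `exists_neg_energyN_le` for `b = B/√(2π)`.
    √(2 * Real.pi) / 60, by positivity, fun B hB hB' => ⟨⟨memLp_R hB hB',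
      isProbabilityMeasure_mu hB hB', mu_absolutelyContinuous B⟩, fun s r _ hr2 hr h => ?_⟩⟩
  have hr0 : 0 < r.toReal := ENNReal.toReal_pos (by rintro rfl; simp at hr2) hr
  have hw := ae_memℓp_weight hr0 h
  have := isProbabilityMeasure_mu hB hB'
  have := isProbabilityMeasure_muN hB hB'
  refine ⟨isProbabilityMeasure_onFL hr ((mu_absolutelyContinuous B).ae_le hw),
    fun N => isProbabilityMeasure_onFL hr (ae_muN_memℓp_weight hB.le N hr),
    exists_onFL_mu_tail hB hB' hr2 hr h, ?_⟩
  rw [ProbabilityMeasure.tendsto_iff_forall_integral_tendsto]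
  exact fun F => tendsto_integral_onFL_muN hB hB' hr hw F
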